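/- Let $\mathbf{k}$ be an algebraically closed field of characteristic $0$, $R$ a commutative unital $\mathbf{k}$-algebra, $V$ a $\mathbf{k}$-vector space with a bilinear product $\curvearrowright\colon V\otimes V\to V$, and $f_V\colon V\to \mathrm{Der}(R)$ a linear map. All tensor products are over $\mathbf{k}$ unless indicated. **Definitions.** A *post-Lie product* on a Lie algebra $\mathfrak g$ is a bilinear $\rhd$ with $x\rhd[y,z]=[x\rhd y,z]+[y,x\rhd z]$ and $([x,y]+x\rhd y-y\rhd x)\rhd z=x\rhd(y\rhd z)-y\rhd(x\rhd z)$; then $[x,y]_\rhd:=x\rhd y-y\rhd x+[x,y]$ is the sub-adjacent Lie bracket. A *post-Lie-Rinehart algebra* over $R$ is a Lie $R$-algebra $L$ (with $R$-bilinear bracket), a $\mathbf k$-bilinear post-Lie product $\rhd$ and an $R$-linear anchor $\rho\colon L\to\mathrm{Der}(R)$ with $\rho([x,y]_\rhd)=[\rho(x),\rho(y)]$, $fx\rhd y=f(x\rhd y)$, $x\rhd fy=f(x\rhd y)+\rho(x)(f)y$. Homomorphisms are $R$-linear Lie maps compatible with $\rhd$ and with the anchors. A *post-Hopf algebra* is a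 Hopf algebra $H$ with a coalgebra map $\rhd\colon H\otimes H\to H$ such that $x\rhd(yz)=(x_1\rhd y)(x_2\rhd z)$, $x\rhd(y\rhd z)=(x_1(x_2\rhd y))\rhd z$ and $x\mapsto(x\rhd\cdot)$ has a convolution inverse $\beta$. If $H$ is cocommutative, $H_\rhd$ is its sub-adjacent Hopf algebra, with the coalgebra of $H$, product $x*_\rhd y=x_1(x_2\rhd y)$ and antipode $S_\rhd(x)=\beta_{x_1}(S(x_2))$. A *weak post-Hopf algebroid* over $R$ is a cocommutative Hopf algebra $H$ over the commutative ring $R$, with unit map $\iota\colon R\to H$, and a $\mathbf k$-bilinear $\rhd$ on $H$ with $\Delta(x\rhd y)=(x_1\rhd y_1)\otimes_R(x_2\rhd y_2)$, $x\rhd 1=\iota\varepsilon(x)$, $1\rhd x=x$, $\iota\varepsilon(x\rhd y)=x\rhd\iota\varepsilon(y)$, $fx\rhd y=f(x\rhd y)$, $x\rhd yz=(x_1\rhd y)(x_2\rhd z)$, $x\rhd(y\rhd z)=(x_1(x_2\rhd y))\rhd z$. Put $x*_\rhd y=x_1(x_2\rhd y)$. It is a *post-Hopf algebroid* $(H,\iota,\rhd,\theta)$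 if $\theta$ is a $\mathbf k$-linear bijection of $H$ with $\theta(1)=1$, $\theta(x*_\rhd y)=\theta(y)*_\rhd\theta(x)$ and there is a $\mathbf k$-linear section $\gamma$ of the projection $H\otimes H\to H\otimes_RH$ such that, writing $\gamma(\Delta(x))=x_1\otimes x_2$, one has $\Delta(\theta(x))=\theta(x_1)\otimes_R\theta(x_2)$, $x_1*_\rhd\theta(x_2)=\iota\varepsilon(x)$ and $\theta(x_1)*_\rhd x_2=\iota\varepsilon(\theta(x))$. The *universal enveloping algebra* of a post-Lie-Rinehart algebra $L$ is the universal enveloping algebra $\mathscr U_R(L)$ of the Lie $R$-algebra $L$, with its usual Hopf $R$-algebra structure (elements of $L$ are primitive, $S(x)=-x$) and the product given recursively, for $f\in R$, $x,y\in L$, $X,Y\in\mathscr U_R(L)$, by $f\rhd X=fX$, $x\rhd f=\rho(x)(f)$, $x\rhd yX=(x\rhd y)X+y(x\rhd X)$, $xX\rhd Y=x\rhd(X\rhd Y)-(x\rhd X)\rhd Y$. **Claim.** 1. There is a unique post-Lie product $\rhd_V$ on the free Lie algebra $\mathrm{Lie}(V)$ that extends $\curvearrowright$, and $f_V$ extends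 to a Lie algebra homomorphism $\rho_V\colon(\mathrm{Lie}(V),[\cdot,\cdot]_{\rhd_V})\to\mathrm{Der}(R)$. With $[fX,gY]=fg[X,Y]$, $fX\,\overline\rhd_V\,gY=f\rho_V(X)(g)Y+fg(X\rhd_VY)$ and $\overline\rho_V(fX)=f\rho_V(X)$, the module $\mathrm{PostLR}(V)=R\otimes\mathrm{Lie}(V)$ is a post-Lie-Rinehart algebra. It is the free one generated by $(V,\curvearrowright,f_V)$: we have $\overline\rho_V(1\otimes v)=f_V(v)$ and $1\otimes(v\curvearrowright w)=(1\otimes v)\,\overline\rhd_V\,(1\otimes w)$, and for every post-Lie-Rinehart algebra $(L,\rho,\rhd)$ over $R$ and linear $\varphi\colon V\to L$ with $\varphi(v\curvearrowright w)=\varphi(v)\rhd\varphi(w)$ and $\rho\varphi=f_V$ there is a unique homomorphism $\tilde\varphi\colon\mathrm{PostLR}(V)\to L$ with $\tilde\varphi(1\otimes v)=\varphi(v)$. 2. There is a unique product $\rhd_V$ on $T(V)$ extending $\curvearrowright$ that makes the coshuffle Hopf algebra $T(V)$ (concatenation product, $V$ primitive) a post-Hopf algebra. There is a Hopf algebra isomorphism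 $K\colon T(V)_{\rhd_V}\to T(V)$ with $K(v)=v$ for $v\in V$ (Gavrilov's $K$-map). Letting $T(V)$ act on $R$ by the algebra map $T(V)\to\mathrm{End}(R)$ that extends $f_V$, the formula $X\rightharpoonup f:=K(X)\cdot f$ makes $R$ a $T(V)_{\rhd_V}$-module algebra, and $vX\rightharpoonup f=v\rightharpoonup(X\rightharpoonup f)-(v\rhd_VX)\rightharpoonup f$ for $v\in V$, $X\in T(V)$. 3. The tensor product Hopf $R$-algebra $R\otimes T(V)$ with $fa\,\overline\rhd_V\,gb=f(a_1\rightharpoonup g)(a_2\rhd_Vb)$ and $\theta(fa)=(S_{\rhd_V}(a_1)\rightharpoonup f)S_{\rhd_V}(a_2)$ is a post-Hopf algebroid $T_R(V)$ over $R$ (the action post-Hopf algebroid), where one can take $\gamma(fa\otimes_R b)=fa\otimes b$. 4. The universal enveloping algebra $\mathscr U_R(\mathrm{PostLR}(V))$ is a post-Hopf algebroid over $R$ for a suitable $\theta$, and there is an isomorphism of post-Hopf algebroids $\mathscr U_R(\mathrm{PostLR}(V))\cong T_R(V)$, that is, an isomorphism of Hopf $R$-algebras compatible with the products $\rhd$ and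 with the maps $\theta$. It sends $fX$, for $f\in R$ and $X\in\mathrm{Lie}(V)$, to $f\otimes X$, where $X$ is regarded as an element of $T(V)$ through the canonical Lie algebra map $\mathrm{Lie}(V)\to T(V)$. -/

import Mathlib

open scoped TensorProduct

universe u v w l t

noncomputable section

/-! ## The antipode axiom only has to be checked on generators -/

section AntipodeAux

variable {R A : Type*} [CommRing R] [Ring A] [Bialgebra R A]

theorem antipode_left_mul (S : A →ₗ[R] A) (hS : ∀ x y, S (x * y) = S y * S x) {x y : A}
    (hx : LinearMap.mul' R A (S.rTensor A (Coalgebra.comul x)) =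
      algebraMap R A (Coalgebra.counit x))
    (hy : LinearMap.mul' R A (S.rTensor A (Coalgebra.comul y)) =
      algebraMap R A (Coalgebra.counit y)) :
    LinearMap.mul' R A (S.rTensor A (Coalgebra.comul (R := R) (x * y))) =
      algebraMap R A (Coalgebra.counit (R := R) (x * y)) := by
  have key : ∀ s t : A ⊗[R] A, LinearMap.mul' R A (S.rTensor A s) ∈ (algebraMap R A).range →
      LinearMap.mul' R A (S.rTensor A (s * t)) =
        LinearMap.mul' R A (S.rTensor A s) * LinearMap.mul' R A (S.rTensor A t) := by
    intro s t hs
    obtain ⟨r, hr⟩ := hs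
    induction t with
    | zero => simp
    | add t u ht hu => rw [mul_add, map_add, map_add, ht, hu, map_add, map_add, mul_add]
    | tmul a b =>
      have h2 : ∀ s : A ⊗[R] A, LinearMap.mul' R A (S.rTensor A (s * a ⊗ₜ[R] b)) =
          S a * LinearMap.mul' R A (S.rTensor A s) * b := by
        intro s
        induction s with
        | zero => simp
        | add t u ht hu => rw [add_mul, map_add, map_add, ht, hu, map_add, map_add, mul_add,
            add_mul]
        | tmul c d => simp [hS, mul_assoc]
      rw [h2, ← hr, LinearMap.rTensor_tmul, LinearMap.mul'_apply, ← Algebra.commutes, mul_assoc]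
  rw [Bialgebra.comul_mul, key _ _ ⟨_, hx.symm⟩, hx, hy, Bialgebra.counit_mul, map_mul]

theorem antipode_right_mul (S : A →ₗ[R] A) (hS : ∀ x y, S (x * y) = S y * S x) {x y : A}
    (hx : LinearMap.mul' R A (S.lTensor A (Coalgebra.comul x)) =
      algebraMap R A (Coalgebra.counit x))
    (hy : LinearMap.mul' R A (S.lTensor A (Coalgebra.comul y)) =
      algebraMap R A (Coalgebra.counit y)) :
    LinearMap.mul' R A (S.lTensor A (Coalgebra.comul (R := R) (x * y))) =
      algebraMap R A (Coalgebra.counit (R := R) (x * y)) := by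
  have key : ∀ s t : A ⊗[R] A, LinearMap.mul' R A (S.lTensor A t) ∈ (algebraMap R A).range →
      LinearMap.mul' R A (S.lTensor A (s * t)) =
        LinearMap.mul' R A (S.lTensor A s) * LinearMap.mul' R A (S.lTensor A t) := by
    intro s t hs
    obtain ⟨r, hr⟩ := hs
    induction s with
    | zero => simp
    | add s u ht hu => rw [add_mul, map_add, map_add, ht, hu, map_add, map_add, add_mul]
    | tmul a b =>
      have h2 : ∀ t : A ⊗[R] A, LinearMap.mul' R A (S.lTensor A (a ⊗ₜ[R] b * t)) =
          a * LinearMap.mul' R A (S.lTensor A t) * S b := by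
        intro s
        induction s with
        | zero => simp
        | add t u ht hu => rw [mul_add, map_add, map_add, ht, hu, map_add, map_add, mul_add,
            add_mul]
        | tmul c d => simp [hS, mul_assoc]
      rw [h2, ← hr, LinearMap.lTensor_tmul, LinearMap.mul'_apply, mul_assoc, Algebra.commutes,
        mul_assoc]
  rw [Bialgebra.comul_mul, key _ _ ⟨_, hy.symm⟩, hx, hy, Bialgebra.counit_mul, map_mul]

end AntipodeAux

/-! ## The coshuffle Hopf algebra `T(V)` -/

namespace TensorAlgebra

variable (k : Type*) [CommRing k] (V : Type*) [AddCommGroup V] [Module k V]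

/-- Concatenation product, `Δ v = v ⊗ 1 + 1 ⊗ v` and `ε v = 0` for `v ∈ V`. -/
instance instCoshuffleBialgebra : Bialgebra k (TensorAlgebra k V) :=
  .ofAlgHom
    (lift k <| (TensorProduct.mk k _ _).flip 1 ∘ₗ ι k + TensorProduct.mk k _ _ 1 ∘ₗ ι k)
    algebraMapInv
    (by
      ext x
      simp [Algebra.TensorProduct.one_def, TensorProduct.add_tmul, TensorProduct.tmul_add]
      abel)
    (by ext x; simp [algebraMapInv])
    (by ext x; simp [algebraMapInv])

variable {V} in
theorem comul_ι (x : V) :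
    Coalgebra.comul (R := k) (ι k x) = ι k x ⊗ₜ[k] 1 + 1 ⊗ₜ[k] ι k x :=
  lift_ι_apply _ x

variable {V} in
theorem counit_ι (x : V) : Coalgebra.counit (R := k) (ι k x) = 0 := by
  change algebraMapInv (ι k x) = 0
  simp [algebraMapInv]

/-- The anti-automorphism of `T(V)` with `v ↦ -v`. -/
def coshuffleAntipode : TensorAlgebra k V →ₗ[k] TensorAlgebra k V :=
  (MulOpposite.opLinearEquiv k).symm.toLinearMap ∘ₗ
    (lift k (-((MulOpposite.opLinearEquiv k).toLinearMap ∘ₗ ι k (M := V)))).toLinearMap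

theorem coshuffleAntipode_mul (x y : TensorAlgebra k V) :
    coshuffleAntipode k V (x * y) = coshuffleAntipode k V y * coshuffleAntipode k V x := by
  simp [coshuffleAntipode]

theorem coshuffleAntipode_one : coshuffleAntipode k V 1 = 1 := by
  simp [coshuffleAntipode]

variable {V} in
theorem coshuffleAntipode_ι (v : V) : coshuffleAntipode k V (ι k v) = - ι k v := by
  simp [coshuffleAntipode]

instance instCoshuffleHopfAlgebra : HopfAlgebra k (TensorAlgebra k V) where
  antipode := coshuffleAntipode k V
  mul_antipode_rTensor_comul := by
    ext x
    induction x using TensorAlgebra.induction with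
    | algebraMap r =>
      simp [Algebra.algebraMap_eq_smul_one, coshuffleAntipode_one, Algebra.TensorProduct.one_def]
    | ι x => simp [comul_ι, counit_ι, coshuffleAntipode_ι, coshuffleAntipode_one]
    | mul x y hx hy => exact antipode_left_mul _ (coshuffleAntipode_mul k V) hx hy
    | add x y hx hy => rw [map_add, map_add, hx, hy]
  mul_antipode_lTensor_comul := by
    ext x
    induction x using TensorAlgebra.induction with
    | algebraMap r =>
      simp [Algebra.algebraMap_eq_smul_one, coshuffleAntipode_one, Algebra.TensorProduct.one_def]
    | ι x => simp [comul_ι, counit_ι, coshuffleAntipode_ι, coshuffleAntipode_one]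
    | mul x y hx hy => exact antipode_right_mul _ (coshuffleAntipode_mul k V) hx hy
    | add x y hx hy => rw [map_add, map_add, hx, hy]

instance instCoshuffleIsCocomm : Coalgebra.IsCocomm k (TensorAlgebra k V) where
  comm_comp_comul := by
    have h : (Algebra.TensorProduct.comm k (TensorAlgebra k V)
          (TensorAlgebra k V)).toAlgHom.comp (Bialgebra.comulAlgHom k _) =
        Bialgebra.comulAlgHom k (TensorAlgebra k V) := by
      ext x
      simp [comul_ι]
      abel
    exact congr(($h).toLinearMap)

end TensorAlgebra

/-! ## The Hopf algebra structure of the universal enveloping algebra -/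

namespace UniversalEnvelopingAlgebra

attribute [local instance 100] LieRing.ofAssociativeRing

variable (R : Type*) [CommRing R] (L : Type*) [LieRing L] [LieAlgebra R L]

variable {R L} in
theorem induction_gen {C : UniversalEnvelopingAlgebra R L → Prop}
    (algebraMap : ∀ r, C (algebraMap R _ r)) (gen : ∀ x, C (ι R x))
    (mul : ∀ a b, C a → C b → C (a * b)) (add : ∀ a b, C a → C b → C (a + b))
    (a : UniversalEnvelopingAlgebra R L) : C a := by
  let s : Subalgebra R (UniversalEnvelopingAlgebra R L) :=
    { carrier := {a | C a}
      mul_mem' := @mul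
      add_mem' := @add
      algebraMap_mem' := algebraMap }
  let g : L →ₗ⁅R⁆ s :=
    { (ι R (L := L) : L →ₗ[R] UniversalEnvelopingAlgebra R L).codRestrict
        (Subalgebra.toSubmodule s) gen with
      map_lie' := by
        intro x y
        apply Subtype.ext
        exact LieHom.map_lie (ι R) x y }
  have h : s.val.comp (lift R g) = AlgHom.id R _ := by
    apply hom_ext
    ext x
    change ((lift R g (ι R x) : s) : UniversalEnvelopingAlgebra R L) = ι R x
    rw [lift_ι_apply]
    rfl
  have h2 := congr($h a)
  have h3 : ((lift R g a : s) : UniversalEnvelopingAlgebra R L) = a := h2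
  rw [← h3]
  exact (lift R g a).2

/-- The comultiplication, as the algebra map with `x ↦ x ⊗ 1 + 1 ⊗ x` on `L`. -/
def comulHom : UniversalEnvelopingAlgebra R L →ₐ[R]
    UniversalEnvelopingAlgebra R L ⊗[R] UniversalEnvelopingAlgebra R L :=
  lift R
    { (TensorProduct.mk R _ _).flip 1 ∘ₗ (ι R (L := L) : L →ₗ[R] _) +
        TensorProduct.mk R _ _ 1 ∘ₗ (ι R (L := L) : L →ₗ[R] _) with
      map_lie' := by
        intro x y
        simp [LieRing.of_associative_ring_bracket,
          TensorProduct.tmul_sub, mul_add, add_mul]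
        abel }

/-- The counit, as the algebra map with `x ↦ 0` on `L`. -/
def counitHom : UniversalEnvelopingAlgebra R L →ₐ[R] R := lift R 0

variable {L} in
theorem comulHom_ι (x : L) :
    comulHom R L (ι R x) = ι R x ⊗ₜ[R] 1 + 1 ⊗ₜ[R] ι R x := by
  rw [comulHom, lift_ι_apply]
  rfl

variable {L} in
theorem counitHom_ι (x : L) : counitHom R L (ι R x) = 0 := by
  rw [counitHom, lift_ι_apply]
  rfl

theorem algHom_ext_gen {A : Type*} [Ring A] [Algebra R A]
    {f g : UniversalEnvelopingAlgebra R L →ₐ[R] A} (h : ∀ x, f (ι R x) = g (ι R x)) : f = g :=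
  hom_ext R (LieHom.ext h)

/-- `Δ x = x ⊗ 1 + 1 ⊗ x` and `ε x = 0` for `x ∈ L`. -/
instance instBialgebra : Bialgebra R (UniversalEnvelopingAlgebra R L) :=
  .ofAlgHom (comulHom R L) (counitHom R L)
    (by
      apply algHom_ext_gen
      intro x
      simp [-ι_apply, comulHom_ι, Algebra.TensorProduct.one_def, TensorProduct.add_tmul,
        TensorProduct.tmul_add]
      abel)
    (by apply algHom_ext_gen; intro x; simp [-ι_apply, comulHom_ι, counitHom_ι])
    (by apply algHom_ext_gen; intro x; simp [-ι_apply, comulHom_ι, counitHom_ι])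

variable {L} in
theorem comul_ι (x : L) :
    Coalgebra.comul (R := R) (ι R x) = ι R x ⊗ₜ[R] 1 + 1 ⊗ₜ[R] ι R x :=
  comulHom_ι R x

variable {L} in
theorem counit_ι (x : L) : Coalgebra.counit (R := R) (ι R x) = 0 :=
  counitHom_ι R x

/-- The algebra map to the opposite algebra with `x ↦ -x` on `L`. -/
def antipodeHom : UniversalEnvelopingAlgebra R L →ₐ[R] (UniversalEnvelopingAlgebra R L)ᵐᵒᵖ :=
  lift R
    { (-((MulOpposite.opLinearEquiv R).toLinearMap ∘ₗ
          (ι R (L := L) : L →ₗ[R] UniversalEnvelopingAlgebra R L)) :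
        L →ₗ[R] (UniversalEnvelopingAlgebra R L)ᵐᵒᵖ) with
      map_lie' := by
        intro x y
        simp [LieRing.of_associative_ring_bracket] }

/-- The anti-automorphism of the universal enveloping algebra with `x ↦ -x` on `L`. -/
def antipodeMap : UniversalEnvelopingAlgebra R L →ₗ[R] UniversalEnvelopingAlgebra R L :=
  (MulOpposite.opLinearEquiv R).symm.toLinearMap ∘ₗ (antipodeHom R L).toLinearMap

theorem antipodeMap_mul (x y : UniversalEnvelopingAlgebra R L) :
    antipodeMap R L (x * y) = antipodeMap R L y * antipodeMap R L x := by
  simp [antipodeMap]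

theorem antipodeMap_one : antipodeMap R L 1 = 1 := by
  simp [antipodeMap]

variable {L} in
theorem antipodeMap_ι (x : L) : antipodeMap R L (ι R x) = - ι R x := by
  have : antipodeHom R L (ι R x) = - MulOpposite.op (ι R x) := by
    rw [antipodeHom, lift_ι_apply]
    rfl
  simp only [antipodeMap, LinearMap.comp_apply, AlgHom.toLinearMap_apply, this]
  simp

instance instHopfAlgebra : HopfAlgebra R (UniversalEnvelopingAlgebra R L) where
  antipode := antipodeMap R L
  mul_antipode_rTensor_comul := by
    ext x
    induction x using induction_gen with
    | algebraMap r =>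
      simp [Algebra.algebraMap_eq_smul_one, antipodeMap_one, Algebra.TensorProduct.one_def]
    | gen x =>
      rw [LinearMap.comp_apply, LinearMap.comp_apply, LinearMap.comp_apply, comul_ι, counit_ι,
        map_add, LinearMap.rTensor_tmul, LinearMap.rTensor_tmul, antipodeMap_ι, antipodeMap_one]
      simp
    | mul x y hx hy => exact antipode_left_mul _ (antipodeMap_mul R L) hx hy
    | add x y hx hy => rw [map_add, map_add, hx, hy]
  mul_antipode_lTensor_comul := by
    ext x
    induction x using induction_gen with
    | algebraMap r =>
      simp [Algebra.algebraMap_eq_smul_one, antipodeMap_one, Algebra.TensorProduct.one_def]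
    | gen x =>
      rw [LinearMap.comp_apply, LinearMap.comp_apply, LinearMap.comp_apply, comul_ι, counit_ι,
        map_add, LinearMap.lTensor_tmul, LinearMap.lTensor_tmul, antipodeMap_ι, antipodeMap_one]
      simp
    | mul x y hx hy => exact antipode_right_mul _ (antipodeMap_mul R L) hx hy
    | add x y hx hy => rw [map_add, map_add, hx, hy]

instance instIsCocomm : Coalgebra.IsCocomm R (UniversalEnvelopingAlgebra R L) where
  comm_comp_comul := by
    have h : (Algebra.TensorProduct.comm R (UniversalEnvelopingAlgebra R L)
          (UniversalEnvelopingAlgebra R L)).toAlgHom.comp (Bialgebra.comulAlgHom R _) =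
        Bialgebra.comulAlgHom R (UniversalEnvelopingAlgebra R L) := by
      apply algHom_ext_gen
      intro x
      change TensorProduct.comm R _ _ (Coalgebra.comul (R := R) (ι R x)) =
        Coalgebra.comul (R := R) (ι R x)
      rw [comul_ι, map_add, TensorProduct.comm_tmul, TensorProduct.comm_tmul, add_comm]
    exact congr(($h).toLinearMap)

section Base

variable (k : Type*) [CommRing k] [Algebra k R]

/-- Restriction of scalars along `k → R`. -/
instance (priority := 10) instAlgebraBase : Algebra k (UniversalEnvelopingAlgebra R L) :=
  Algebra.compHom _ (algebraMap k R)

instance (priority := 10) instIsScalarTowerBase : IsScalarTower k R (UniversalEnvelopingAlgebra R L) :=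
  IsScalarTower.of_algebraMap_eq fun _ => rfl

/-- `UniversalEnvelopingAlgebra R L` of a Lie `R`-algebra has the universal property of the
universal enveloping algebra of the Lie-Rinehart algebra `(R, L)` with zero anchor. -/
theorem lieRinehart_universal {A : Type*} [Ring A] [Algebra k A] [Module k L]
    [IsScalarTower k R L] (κR : R →ₐ[k] A) (κL : L →ₗ[k] A)
    (hlie : ∀ x y, κL ⁅x, y⁆ = κL x * κL y - κL y * κL x)
    (hmul : ∀ (f : R) (x : L), κR f * κL x = κL (f • x))
    (hcomm : ∀ (f : R) (x : L), κL x * κR f - κR f * κL x = 0) :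
    ∃! F : UniversalEnvelopingAlgebra R L →ₐ[k] A,
      (∀ f, F (algebraMap R _ f) = κR f) ∧ ∀ x, F (ι R x) = κL x := by
  let C : Subalgebra k A := Subalgebra.centralizer k (Set.range κR)
  have hRC : ∀ f, κR f ∈ C := by
    intro f
    rw [Subalgebra.mem_centralizer_iff]
    rintro _ ⟨g, rfl⟩
    rw [← map_mul, ← map_mul, mul_comm]
  have hLC : ∀ x, κL x ∈ C := by
    intro x
    rw [Subalgebra.mem_centralizer_iff]
    rintro _ ⟨g, rfl⟩
    exact (sub_eq_zero.mp (hcomm g x)).symm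
  let κC : R →ₐ[k] C := κR.codRestrict C hRC
  letI : Algebra R C := RingHom.toAlgebra' κC.toRingHom (by
    intro f c
    apply Subtype.ext
    exact (Subalgebra.mem_centralizer_iff k).mp c.2 _ ⟨f, rfl⟩)
  let g : L →ₗ⁅R⁆ C :=
    { toFun := fun x => ⟨κL x, hLC x⟩
      map_add' := by intro x y; apply Subtype.ext; exact map_add κL x y
      map_smul' := by
        intro f x
        rw [RingHom.id_apply, Algebra.smul_def]
        apply Subtype.ext
        exact (hmul f x).symm
      map_lie' := by intro x y; apply Subtype.ext; exact hlie x y }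
  have hcomp : ∀ c : k, lift R g (algebraMap k _ c) = algebraMap k C c := by
    intro c
    rw [IsScalarTower.algebraMap_apply k R (UniversalEnvelopingAlgebra R L), AlgHom.commutes]
    exact κC.commutes c
  let G : UniversalEnvelopingAlgebra R L →ₐ[k] C :=
    { (lift R g).toRingHom with commutes' := hcomp }
  refine ⟨C.val.comp G, ⟨?_, ?_⟩, ?_⟩
  · intro f
    have : lift R g (algebraMap R _ f) = algebraMap R C f := AlgHom.commutes _ f
    exact congrArg Subtype.val this
  · intro x
    have : lift R g (ι R x) = g x := lift_ι_apply R g x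
    exact congrArg Subtype.val this
  · rintro F ⟨hF1, hF2⟩
    ext u
    induction u using induction_gen with
    | algebraMap r =>
      rw [hF1]
      have : lift R g (algebraMap R _ r) = algebraMap R C r := AlgHom.commutes _ r
      exact (congrArg Subtype.val this).symm
    | gen x =>
      rw [hF2]
      have : lift R g (ι R x) = g x := lift_ι_apply R g x
      exact (congrArg Subtype.val this).symm
    | mul a b ha hb => rw [map_mul, map_mul, ha, hb]
    | add a b ha hb => rw [map_add, map_add, ha, hb]

end Base

end UniversalEnvelopingAlgebra

/-! ## The free Lie algebra `Lie(V)` on a module -/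

section FreeLie

variable (k : Type*) [CommRing k] (V : Type*) [AddCommGroup V] [Module k V]

/-- The Lie ideal making `V → FreeLieAlgebra k V` linear. -/
def freeLieIdeal : LieIdeal k (FreeLieAlgebra k V) :=
  LieSubmodule.lieSpan k (FreeLieAlgebra k V)
    ({x | ∃ v w : V, x = FreeLieAlgebra.of k (v + w) -
        (FreeLieAlgebra.of k v + FreeLieAlgebra.of k w)} ∪
      {x | ∃ (c : k) (v : V), x = FreeLieAlgebra.of k (c • v) - c • FreeLieAlgebra.of k v})

/-- The free Lie algebra on the `k`-module `V`. -/
def FreeLie : Type _ := FreeLieAlgebra k V ⧸ freeLieIdeal k V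

namespace FreeLie

instance : LieRing (FreeLie k V) :=
  inferInstanceAs (LieRing (FreeLieAlgebra k V ⧸ freeLieIdeal k V))

instance : LieAlgebra k (FreeLie k V) :=
  inferInstanceAs (LieAlgebra k (FreeLieAlgebra k V ⧸ freeLieIdeal k V))

/-- The inclusion `V → Lie(V)`. -/
def ι : V →ₗ[k] FreeLie k V where
  toFun v := LieSubmodule.Quotient.mk' (freeLieIdeal k V) (FreeLieAlgebra.of k v)
  map_add' v w := by
    have h : LieSubmodule.Quotient.mk' (freeLieIdeal k V) (FreeLieAlgebra.of k (v + w) -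
        (FreeLieAlgebra.of k v + FreeLieAlgebra.of k w)) = 0 := by
      rw [LieSubmodule.Quotient.mk_eq_zero]
      exact LieSubmodule.subset_lieSpan (Or.inl ⟨v, w, rfl⟩)
    rw [map_sub, map_add, sub_eq_zero] at h
    exact h
  map_smul' c v := by
    have h : LieSubmodule.Quotient.mk' (freeLieIdeal k V) (FreeLieAlgebra.of k (c • v) -
        c • FreeLieAlgebra.of k v) = 0 := by
      rw [LieSubmodule.Quotient.mk_eq_zero]
      exact LieSubmodule.subset_lieSpan (Or.inr ⟨c, v, rfl⟩)
    rw [map_sub, map_smul, sub_eq_zero] at h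
    exact h

theorem exists_lift {L : Type*} [LieRing L] [LieAlgebra k L] (f : V →ₗ[k] L) :
    ∃! F : FreeLie k V →ₗ⁅k⁆ L, ∀ v, F (ι k V v) = f v := by
  have hker : freeLieIdeal k V ≤ (FreeLieAlgebra.lift k (f : V → L)).ker := by
    rw [freeLieIdeal, LieSubmodule.lieSpan_le]
    rintro x (⟨v, w, rfl⟩ | ⟨c, v, rfl⟩)
    · simp [LieHom.mem_ker]
    · simp [LieHom.mem_ker]
  let F0 : (FreeLieAlgebra k V ⧸ freeLieIdeal k V) →ₗ[k] L :=
    (freeLieIdeal k V).toSubmodule.liftQ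
      (FreeLieAlgebra.lift k (f : V → L) : FreeLieAlgebra k V →ₗ[k] L)
      (fun x hx => (LieHom.mem_ker).mp (hker hx))
  let F : (FreeLieAlgebra k V ⧸ freeLieIdeal k V) →ₗ⁅k⁆ L :=
    { F0 with
      map_lie' := by
        intro x y
        obtain ⟨x, rfl⟩ := LieSubmodule.Quotient.surjective_mk' _ x
        obtain ⟨y, rfl⟩ := LieSubmodule.Quotient.surjective_mk' _ y
        exact LieHom.map_lie (FreeLieAlgebra.lift k (f : V → L)) x y }
  refine ⟨F, fun v => FreeLieAlgebra.lift_of_apply _ v, ?_⟩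
  intro G hG
  let q : FreeLieAlgebra k V →ₗ⁅k⁆ FreeLie k V :=
    { (LieSubmodule.Quotient.mk' (freeLieIdeal k V) :
        FreeLieAlgebra k V →ₗ[k] FreeLieAlgebra k V ⧸ freeLieIdeal k V) with
      map_lie' := by intro x y; rfl }
  have h : G.comp q = FreeLieAlgebra.lift k (f : V → L) := by
    ext v
    rw [FreeLieAlgebra.lift_of_apply]
    exact hG v
  ext x
  obtain ⟨x, rfl⟩ := LieSubmodule.Quotient.surjective_mk' _ x
  exact congr($h x)

attribute [local instance 100] LieRing.ofAssociativeRing in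
/-- The Lie algebra map `Lie(V) → T(V)` (commutator bracket on `T(V)`) that is the identity
on `V`. -/
def toTensor : FreeLie k V →ₗ[k] TensorAlgebra k V :=
  ((exists_lift k V (TensorAlgebra.ι k (M := V))).choose : FreeLie k V →ₗ[k] TensorAlgebra k V)

theorem toTensor_ι (v : V) : toTensor k V (ι k V v) = TensorAlgebra.ι k v :=
  let _ := LieRing.ofAssociativeRing (A := TensorAlgebra k V)
  (exists_lift k V (TensorAlgebra.ι k (M := V))).choose_spec.1 v

theorem toTensor_lie (x y : FreeLie k V) :
    toTensor k V ⁅x, y⁆ =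
      toTensor k V x * toTensor k V y - toTensor k V y * toTensor k V x :=
  let _ := LieRing.ofAssociativeRing (A := TensorAlgebra k V)
  LieHom.map_lie (exists_lift k V (TensorAlgebra.ι k (M := V))).choose x y

end FreeLie

end FreeLie

/-! ## Post-Lie algebras and post-Lie-Rinehart algebras -/

/-- A post-Lie product on the Lie algebra `g`. -/
structure PostLieAlg (k g : Type*) [CommRing k] [LieRing g] [LieAlgebra k g] where
  tri : g →ₗ[k] g →ₗ[k] g
  tri_lie : ∀ x y z, tri x ⁅y, z⁆ = ⁅tri x y, z⁆ + ⁅y, tri x z⁆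
  lie_tri : ∀ x y z, tri (⁅x, y⁆ + tri x y - tri y x) z =
    tri x (tri y z) - tri y (tri x z)

/-- A post-Lie-Rinehart algebra structure on the Lie `R`-algebra `L`. The anchor is
`R`-linear, the product is `R`-linear in its first argument and `k`-linear in the second. -/
structure PostLieRinehart (k R L : Type*) [CommRing k] [CommRing R] [Algebra k R]
    [LieRing L] [LieAlgebra R L] [Module k L] [IsScalarTower k R L] where
  tri : L →ₗ[R] L →ₗ[k] L
  rho : L →ₗ[R] Derivation k R R
  tri_lie : ∀ x y z, tri x ⁅y, z⁆ = ⁅tri x y, z⁆ + ⁅y, tri x z⁆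
  lie_tri : ∀ x y z, tri (⁅x, y⁆ + tri x y - tri y x) z =
    tri x (tri y z) - tri y (tri x z)
  rho_lie : ∀ x y, rho (tri x y - tri y x + ⁅x, y⁆) = ⁅rho x, rho y⁆
  tri_smul : ∀ (x : L) (f : R) (y : L), tri x (f • y) = f • tri x y + rho x f • y

section Free

variable {k : Type u} {R : Type v} {V : Type w} {L : Type l} [CommRing k] [CommRing R]
  [Algebra k R] [AddCommGroup V] [Module k V] [LieRing L] [LieAlgebra R L] [Module k L] [IsScalarTower k R L]

/-- `P`, with the map `i : V → L`, is the free post-Lie-Rinehart algebra generated by the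
magma algebra `(V, mag)` together with `fV : V → Der(R)`. -/
def IsFreePostLieRinehart (mag : V →ₗ[k] V →ₗ[k] V) (fV : V →ₗ[k] Derivation k R R)
    (P : PostLieRinehart k R L) (i : V →ₗ[k] L) : Prop :=
  (∀ v w, i (mag v w) = P.tri (i v) (i w)) ∧ (∀ v, P.rho (i v) = fV v) ∧
  ∀ (L' : Type t) [LieRing L'] [LieAlgebra R L'] [Module k L'] [IsScalarTower k R L']
    (P' : PostLieRinehart k R L') (φ : V →ₗ[k] L'),
    (∀ v w, φ (mag v w) = P'.tri (φ v) (φ w)) → (∀ v, P'.rho (φ v) = fV v) →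
    ∃! F : L →ₗ⁅R⁆ L', (∀ x y, F (P.tri x y) = P'.tri (F x) (F y)) ∧
      (∀ x, P'.rho (F x) = P.rho x) ∧ ∀ v, F (i v) = φ v

end Free

/-- `𝓛` is the action post-Lie-Rinehart algebra on `R ⊗ g` given by the post-Lie algebra `P`
and the action `ρ` of its sub-adjacent Lie algebra on `R`. (The bracket of `R ⊗ g` is the
`R`-bilinear extension of that of `g`.) -/
structure IsActionPostLieRinehart {k R g : Type*} [CommRing k] [CommRing R] [Algebra k R]
    [LieRing g] [LieAlgebra k g] (P : PostLieAlg k g) (ρ : g →ₗ[k] Derivation k R R)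
    (𝓛 : PostLieRinehart k R (R ⊗[k] g)) : Prop where
  rho_lie : ∀ x y, ρ (P.tri x y - P.tri y x + ⁅x, y⁆) = ⁅ρ x, ρ y⁆
  tri_tmul : ∀ (f₁ f₂ : R) (x₁ x₂ : g), 𝓛.tri (f₁ ⊗ₜ[k] x₁) (f₂ ⊗ₜ[k] x₂) =
    (f₁ * ρ x₁ f₂) ⊗ₜ[k] x₂ + (f₁ * f₂) ⊗ₜ[k] P.tri x₁ x₂
  rho_tmul : ∀ (f : R) (x : g), 𝓛.rho (f ⊗ₜ[k] x) = f • ρ x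

/-- The inclusion `Der(R) → End(R)`. -/
def derToEnd (k R : Type*) [CommRing k] [CommRing R] [Algebra k R] :
    Derivation k R R →ₗ[k] Module.End k R where
  toFun D := D.toLinearMap
  map_add' _ _ := rfl
  map_smul' _ _ := rfl

/-! ## Post-Hopf algebras -/

section GrossmanLarson

variable {k R H : Type*} [CommRing k] [CommRing R] [Algebra k R] [Ring H] [Algebra k H]

/-- The Grossman-Larson product `x * y = ∑ x₁ (x₂ ▷ y)`. -/
def grossmanLarson [Bialgebra R H] [IsScalarTower k R H] (tri : H →ₗ[R] H →ₗ[k] H) :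
    H →ₗ[k] H →ₗ[k] H :=
  LinearMap.mk₂ k
    (fun x y => LinearMap.mul' R H ((tri.flip y).lTensor H (Coalgebra.comul (R := R) x)))
    (fun x y z => by simp only [map_add])
    (fun c x y => by
      rw [← algebraMap_smul R c x, map_smul, map_smul, map_smul, algebraMap_smul])
    (fun x y z => by
      rw [map_add, LinearMap.lTensor_add, LinearMap.add_apply, map_add])
    (fun c x y => by
      generalize Coalgebra.comul (R := R) x = t
      induction t with
      | zero => simp
      | add s t hs ht => rw [map_add, map_add, hs, ht, map_add, map_add, smul_add]
      | tmul a b => simp)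

theorem grossmanLarson_eq_sum [Bialgebra R H] [IsScalarTower k R H] (tri : H →ₗ[R] H →ₗ[k] H)
    (x y : H) {ι : Type*} (r : Coalgebra.Repr R x ι) :
    grossmanLarson tri x y = ∑ i ∈ r.index, r.left i * tri (r.right i) y := by
  simp [grossmanLarson, ← r.eq]

end GrossmanLarson

/-- A post-Hopf algebra structure on the Hopf algebra `H`; `beta` is the (unique) convolution
inverse of `x ↦ (x ▷ ·)`. Sums over a `Coalgebra.Repr` are Sweedler sums. -/
structure PostHopf (k : Type u) (H : Type v) [CommRing k] [Ring H] [HopfAlgebra k H] where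
  tri : H →ₗ[k] H →ₗ[k] H
  beta : H →ₗ[k] H →ₗ[k] H
  comul_tri : ∀ (x y : H) {ι κ : Type v} (r : Coalgebra.Repr k x ι) (s : Coalgebra.Repr k y κ),
    Coalgebra.comul (R := k) (tri x y) = ∑ i ∈ r.index, ∑ j ∈ s.index,
      tri (r.left i) (s.left j) ⊗ₜ[k] tri (r.right i) (s.right j)
  counit_tri : ∀ x y : H, Coalgebra.counit (R := k) (tri x y) =
    Coalgebra.counit (R := k) x * Coalgebra.counit (R := k) y
  tri_mul : ∀ (x y z : H) {ι : Type v} (r : Coalgebra.Repr k x ι),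
    tri x (y * z) = ∑ i ∈ r.index, tri (r.left i) y * tri (r.right i) z
  tri_tri : ∀ (x y z : H) {ι : Type v} (r : Coalgebra.Repr k x ι),
    tri x (tri y z) = tri (∑ i ∈ r.index, r.left i * tri (r.right i) y) z
  tri_beta : ∀ (x y : H) {ι : Type v} (r : Coalgebra.Repr k x ι),
    ∑ i ∈ r.index, tri (r.left i) (beta (r.right i) y) = Coalgebra.counit (R := k) x • y
  beta_tri : ∀ (x y : H) {ι : Type v} (r : Coalgebra.Repr k x ι),
    ∑ i ∈ r.index, beta (r.left i) (tri (r.right i) y) = Coalgebra.counit (R := k) x • y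

namespace PostHopf

variable {k H : Type*} [CommRing k] [Ring H] [HopfAlgebra k H] (Q : PostHopf k H)

/-- The product of the sub-adjacent Hopf algebra. -/
def gl : H →ₗ[k] H →ₗ[k] H := grossmanLarson Q.tri

/-- The antipode of the sub-adjacent Hopf algebra, `∑ β(x₁)(S x₂)`. -/
def glAntipode : H →ₗ[k] H :=
  TensorProduct.lift Q.beta ∘ₗ (HopfAlgebra.antipode k (A := H)).lTensor H ∘ₗ
    Coalgebra.comul (R := k)

/-- `act` makes the commutative algebra `R` a module algebra over the sub-adjacent Hopf algebra
(same coalgebra, product `gl`). -/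
structure IsModuleAlgebra {k : Type u} {H : Type v} [CommRing k] [Ring H] [HopfAlgebra k H]
    (Q : PostHopf k H) {R : Type*} [CommRing R] [Algebra k R]
    (act : H →ₗ[k] R →ₗ[k] R) : Prop where
  gl_act : ∀ x y f, act (Q.gl x y) f = act x (act y f)
  one_act : ∀ f, act 1 f = f
  act_mul : ∀ (x : H) (f g : R) {ι : Type v} (r : Coalgebra.Repr k x ι),
    act x (f * g) = ∑ i ∈ r.index, act (r.left i) f * act (r.right i) g
  act_one : ∀ x, act x 1 = algebraMap k R (Coalgebra.counit x)

end PostHopf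

/-! ## Post-Hopf algebroids -/

/-- A weak post-Hopf algebroid over `R` on the cocommutative Hopf `R`-algebra `H`.
(A Hopf `R`-algebra is a Hopf algebra over the commutative ring `R`, with `ι = algebraMap R H`.)
The product is `R`-linear in its first argument: `(f x) ▷ y = f (x ▷ y)`. -/
structure WeakPostHopfAlgebroid (k : Type u) (R : Type v) (H : Type w) [CommRing k]
    [CommRing R] [Algebra k R] [Ring H] [HopfAlgebra R H] [Coalgebra.IsCocomm R H] [Algebra k H]
    [IsScalarTower k R H] where
  tri : H →ₗ[R] H →ₗ[k] H
  comul_tri : ∀ (x y : H) {ι κ : Type w} (r : Coalgebra.Repr R x ι) (s : Coalgebra.Repr R y κ),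
    Coalgebra.comul (R := R) (tri x y) = ∑ i ∈ r.index, ∑ j ∈ s.index,
      tri (r.left i) (s.left j) ⊗ₜ[R] tri (r.right i) (s.right j)
  tri_one : ∀ x : H, tri x 1 = algebraMap R H (Coalgebra.counit x)
  one_tri : ∀ x : H, tri 1 x = x
  counit_tri : ∀ x y : H, algebraMap R H (Coalgebra.counit (tri x y)) =
    tri x (algebraMap R H (Coalgebra.counit y))
  tri_mul : ∀ (x y z : H) {ι : Type w} (r : Coalgebra.Repr R x ι),
    tri x (y * z) = ∑ i ∈ r.index, tri (r.left i) y * tri (r.right i) z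
  tri_tri : ∀ (x y z : H) {ι : Type w} (r : Coalgebra.Repr R x ι),
    tri x (tri y z) = tri (∑ i ∈ r.index, r.left i * tri (r.right i) y) z

namespace WeakPostHopfAlgebroid

variable {k R H : Type*} [CommRing k] [CommRing R] [Algebra k R] [Ring H] [HopfAlgebra R H]
  [Coalgebra.IsCocomm R H] [Algebra k H] [IsScalarTower k R H]

/-- The product of the Grossman-Larson bialgebroid. -/
def gl (W : WeakPostHopfAlgebroid k R H) : H →ₗ[k] H →ₗ[k] H := grossmanLarson W.tri

/-- `θ` is an antipode of the Grossman-Larson bialgebroid with respect to the `k`-linear section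
`γ` of the projection `H ⊗[k] H → H ⊗[R] H`. As `θ` is not `R`-linear, the Sweedler expressions
`θ(x₁) ⊗ θ(x₂)`, `x₁ * θ(x₂)` and `θ(x₁) * x₂` are evaluated on the representative `γ (Δ x)`. -/
structure IsAntipodeWith (W : WeakPostHopfAlgebroid k R H) (θ : H ≃ₗ[k] H)
    (γ : H ⊗[R] H →ₗ[k] H ⊗[k] H) : Prop where
  section_apply : ∀ t, TensorProduct.mapOfCompatibleSMul R k k H H (γ t) = t
  map_one : θ 1 = 1
  map_gl : ∀ x y, θ (W.gl x y) = W.gl (θ y) (θ x)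
  comul_map : ∀ x, Coalgebra.comul (R := R) (θ x) =
    TensorProduct.mapOfCompatibleSMul R k k H H
      (TensorProduct.map θ.toLinearMap θ.toLinearMap (γ (Coalgebra.comul (R := R) x)))
  gl_map_right : ∀ x, TensorProduct.lift W.gl
      (TensorProduct.map LinearMap.id θ.toLinearMap (γ (Coalgebra.comul (R := R) x))) =
    algebraMap R H (Coalgebra.counit x)
  gl_map_left : ∀ x, TensorProduct.lift W.gl
      (TensorProduct.map θ.toLinearMap LinearMap.id (γ (Coalgebra.comul (R := R) x))) =
    algebraMap R H (Coalgebra.counit (θ x))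

end WeakPostHopfAlgebroid

/-- A post-Hopf algebroid `(H, ι, ▷, θ)` over `R`. -/
structure PostHopfAlgebroid (k R H : Type*) [CommRing k]
    [CommRing R] [Algebra k R] [Ring H] [HopfAlgebra R H] [Coalgebra.IsCocomm R H] [Algebra k H]
    [IsScalarTower k R H] extends WeakPostHopfAlgebroid k R H where
  theta : H ≃ₗ[k] H
  exists_section : ∃ γ : H ⊗[R] H →ₗ[k] H ⊗[k] H,
    toWeakPostHopfAlgebroid.IsAntipodeWith theta γ

/-- `𝓗` is the action post-Hopf algebroid on the tensor product Hopf `R`-algebra `R ⊗ A` given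
by the cocommutative post-Hopf algebra `Q` on `A` and the module algebra action `act` of its
sub-adjacent Hopf algebra on `R`; the section of `(R ⊗ A) ⊗[k] (R ⊗ A) → (R ⊗ A) ⊗[R] (R ⊗ A)`
is `f a ⊗ b ↦ f a ⊗ b`. -/
structure IsActionPostHopfAlgebroid {k : Type u} {R : Type v} {A : Type w} [CommRing k]
    [CommRing R] [Algebra k R] [Ring A] [HopfAlgebra k A] [Coalgebra.IsCocomm k A]
    (Q : PostHopf k A) (act : A →ₗ[k] R →ₗ[k] R)
    (𝓗 : PostHopfAlgebroid k R (R ⊗[k] A)) : Prop where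
  isModuleAlgebra : Q.IsModuleAlgebra act
  tri_tmul : ∀ (f g : R) (a b : A) {ι : Type w} (r : Coalgebra.Repr k a ι),
    𝓗.tri (f ⊗ₜ[k] a) (g ⊗ₜ[k] b) =
      ∑ i ∈ r.index, (f * act (r.left i) g) ⊗ₜ[k] Q.tri (r.right i) b
  theta_tmul : ∀ (f : R) (a : A) {ι : Type w} (r : Coalgebra.Repr k a ι),
    𝓗.theta (f ⊗ₜ[k] a) =
      ∑ i ∈ r.index, act (Q.glAntipode (r.left i)) f ⊗ₜ[k] Q.glAntipode (r.right i)
  section_tmul : ∃ γ : (R ⊗[k] A) ⊗[R] (R ⊗[k] A) →ₗ[k] (R ⊗[k] A) ⊗[k] (R ⊗[k] A),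
    𝓗.toWeakPostHopfAlgebroid.IsAntipodeWith 𝓗.theta γ ∧
    ∀ (f : R) (a b : A), γ ((f ⊗ₜ[k] a) ⊗ₜ[R] (1 ⊗ₜ[k] b)) = (f ⊗ₜ[k] a) ⊗ₜ[k] (1 ⊗ₜ[k] b)

/-! ## The universal enveloping algebra of a post-Lie-Rinehart algebra -/

open UniversalEnvelopingAlgebra in
/-- `W` is the weak post-Hopf algebroid structure on the Hopf `R`-algebra `𝓤_R(L)` that is
defined recursively by the post-Lie-Rinehart structure `P` of `L`: the universal enveloping
algebra of `P`. -/
structure IsUniversalEnveloping {k R L : Type*} [CommRing k] [CommRing R] [Algebra k R]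
    [LieRing L] [LieAlgebra R L] [Module k L] [IsScalarTower k R L] (P : PostLieRinehart k R L)
    (W : WeakPostHopfAlgebroid k R (UniversalEnvelopingAlgebra R L)) : Prop where
  base_tri : ∀ (f : R) X, W.tri (algebraMap R _ f) X = algebraMap R _ f * X
  tri_base : ∀ (x : L) (f : R), W.tri (ι R x) (algebraMap R _ f) = algebraMap R _ (P.rho x f)
  tri_mul : ∀ (x y : L) X, W.tri (ι R x) (ι R y * X) =
    ι R (P.tri x y) * X + ι R y * W.tri (ι R x) X
  mul_tri : ∀ (x : L) X Y, W.tri (ι R x * X) Y =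
    W.tri (ι R x) (W.tri X Y) - W.tri (W.tri (ι R x) X) Y

end

noncomputable section

/-! ## Filtrations generated by operators -/

section Filtration

variable {k V M : Type*} [CommRing k] [AddCommGroup M] [Module k M]

/-! A post-Lie product on `Lie(V)` makes `x ↦ (x ▷ ·)` a Lie map from the sub-adjacent bracket to
derivations. That bracket depends on the unknown product, but it should again be free on `V`, so the
construction starts on the free side. Let `D_v` be the derivation that extends `mag v`, and extend
`v ↦ D_v` to a Lie map `x ↦ D_x` for the free bracket (`derAction`). The Lie map `v ↦ (v, D_v)` into
`Lie(V) ⋊ Der(Lie(V))` has a first component `κ` (`toSubadjacent`) with `κ[x,y] = [κx,κy] + D_x κy -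
D_y κx`. On brackets with a generator, `κ` differs from the identity by terms of smaller length, so
it is bijective (`bijective_of_opFiltration`), and `x ▷ y = D_{κ⁻¹x} y` is a post-Lie product.
Uniqueness and freeness follow by induction on the length of the first argument
(`lift_postLie_tri`). The sub-adjacent Lie algebra is free on `V` through `κ`, which produces the
anchor (`subadjacentLift_unique`).

The tensor algebra is treated in the same way. Let `v` act by `x ↦ vx + D_v x` (`glAction`), and let
`κ(X) = X · 1`; again `κ` is bijective for reasons of length, and `K = κ⁻¹`. The product is `X ▷ Y =
D_{K(X)} Y`. The operators involved are compatible with the coproduct, so `κ` and `K` are coalgebra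
maps, and each Sweedler identity reduces to a Leibniz rule for `v ∈ V` (`equivariant_kMap`). In
particular `X * Y` is the action of `K(X)` on `Y`, whence `K(X * Y) = K(X)K(Y)`.

On `R ⊗ T(V)` the operators are extended by `v(f) ⊗ x`. The single identity `baseExt_baseOp` gives
both the weighted associativity of the product and the associativity of its Grossman-Larson product.
The antipode is `θ(f ⊗ a) = S(K(a)) · (f ⊗ 1)`; it is an anti-multiplicative involution.

Finally, `Lie(V) → T(V)` intertwines the two maps `κ` (`glAction_toTensor`), so the two products
agree on Lie elements. Universal properties give `𝓤_R(R ⊗ Lie(V)) ≅ R ⊗ T(V)`, the structure is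
transported back, and the recursion that defines the product on the enveloping algebra holds because
elements of the Lie algebra are primitive. -/

theorem bijective_of_filtration (κ : M →ₗ[k] M) (F : ℕ → Submodule k M)
    (hF : ∀ x, ∃ n, x ∈ F n) (h0 : ∀ x ∈ F 0, κ x = x)
    (hs : ∀ n, ∀ x ∈ F (n + 1), κ x - x ∈ F n) : Function.Bijective κ := by
  constructor
  -- If `κ x = 0`, then `-x = κ x - x` lies one level lower; descending, `x` reaches `F 0`, where
  -- `κ` is the identity.
  · have key : ∀ n, ∀ x ∈ F n, κ x = 0 → x = 0 := by
      intro n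
      induction n with
      | zero => intro x hx h; rw [← h0 x hx, h]
      | succ n ih =>
        intro x hx h
        have h1 := hs n x hx
        rw [h, zero_sub, neg_mem_iff] at h1
        exact ih x h1 h
    rw [injective_iff_map_eq_zero]
    intro x hx
    obtain ⟨n, hn⟩ := hF x
    exact key n x hn hx
  -- Here `x = κ x - (κ x - x)`, and the correction lies one level lower.
  · have key : ∀ n, ∀ x ∈ F n, x ∈ LinearMap.range κ := by
      intro n
      induction n with
      | zero => intro x hx; exact ⟨x, h0 x hx⟩
      | succ n ih =>
        intro x hx
        have h1 : x = κ x - (κ x - x) := by abel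
        rw [h1]
        exact sub_mem ⟨x, rfl⟩ (ih _ (hs n x hx))
    intro x
    obtain ⟨n, hn⟩ := hF x
    exact key n x hn

/-- The filtration of `M` generated from `F₀` by the operators `a v`. -/
def opFiltration (a : V → Module.End k M) (F₀ : Submodule k M) : ℕ → Submodule k M
  | 0 => F₀
  | n + 1 => opFiltration a F₀ n ⊔
      Submodule.span k {x | ∃ v, ∃ y ∈ opFiltration a F₀ n, x = a v y}

variable {a : V → Module.End k M} {F₀ : Submodule k M}

theorem opFiltration_le_succ (n : ℕ) : opFiltration a F₀ n ≤ opFiltration a F₀ (n + 1) :=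
  le_sup_left

theorem opFiltration_mono : Monotone (opFiltration a F₀) :=
  monotone_nat_of_le_succ opFiltration_le_succ

theorem apply_mem_opFiltration (v : V) {n : ℕ} {y : M} (hy : y ∈ opFiltration a F₀ n) :
    a v y ∈ opFiltration a F₀ (n + 1) :=
  le_sup_right (α := Submodule k M) (Submodule.subset_span ⟨v, y, hy, rfl⟩)

theorem opFiltration_succ_le {C : Submodule k M} {n : ℕ} (h : opFiltration a F₀ n ≤ C)
    (h' : ∀ v, ∀ y ∈ opFiltration a F₀ n, a v y ∈ C) : opFiltration a F₀ (n + 1) ≤ C := by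
  refine sup_le h (Submodule.span_le.mpr ?_)
  rintro _ ⟨v, y, hy, rfl⟩
  exact h' v y hy

/-- Induction on length in which the hypothesis covers the whole level and not only `y`. The
applications need this: their recursions for `a v y` involve `v ▷ y`, another element of the level
of `y`. -/
theorem mem_of_opFiltration (hF : ∀ x, ∃ n, x ∈ opFiltration a F₀ n) (C : Submodule k M)
    (h0 : F₀ ≤ C) (hs : ∀ n, opFiltration a F₀ n ≤ C →
      ∀ v, ∀ y ∈ opFiltration a F₀ n, a v y ∈ C) (x : M) : x ∈ C := by
  have key : ∀ n, opFiltration a F₀ n ≤ C := by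
    intro n
    induction n with
    | zero => exact h0
    | succ n ih => exact opFiltration_succ_le ih (hs n ih)
  obtain ⟨n, hn⟩ := hF x
  exact key n hn

theorem map_mem_opFiltration (D : M →ₗ[k] M) (h0 : ∀ x ∈ F₀, D x ∈ F₀)
    (hs : ∀ n v, ∀ y ∈ opFiltration a F₀ n, D y ∈ opFiltration a F₀ n →
      D (a v y) ∈ opFiltration a F₀ (n + 1)) (n : ℕ) :
    ∀ x ∈ opFiltration a F₀ n, D x ∈ opFiltration a F₀ n := by
  induction n with
  | zero => exact h0
  | succ n ih =>
    have : opFiltration a F₀ (n + 1) ≤ (opFiltration a F₀ (n + 1)).comap D :=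
      opFiltration_succ_le (fun x hx => opFiltration_le_succ n (ih x hx))
        (fun v y hy => hs n v y hy (ih y hy))
    exact this

/-- It suffices that `κ` commutes with the generating operators up to shorter terms: `κ(a v y) - a v
y` is the sum of `κ(a v y) - a v (κ y)` and `a v (κ y - y)`, and in the second term `κ y - y` has
already dropped one level. -/
theorem bijective_of_opFiltration (hF : ∀ x, ∃ n, x ∈ opFiltration a F₀ n) (κ : M →ₗ[k] M)
    (h0 : ∀ x ∈ F₀, κ x = x)
    (hs : ∀ n v, ∀ y ∈ opFiltration a F₀ n, κ y ∈ opFiltration a F₀ n →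
      κ (a v y) - a v (κ y) ∈ opFiltration a F₀ n) : Function.Bijective κ := by
  refine bijective_of_filtration κ (opFiltration a F₀) hF h0 ?_
  -- The second conjunct replaces "`κ x - x` lies in level `n - 1`", which has no meaning for `n =
  -- 0`; there `κ x - x` vanishes.
  have key : ∀ n, (∀ x ∈ opFiltration a F₀ n, κ x ∈ opFiltration a F₀ n) ∧
      (∀ v, ∀ x ∈ opFiltration a F₀ n, a v (κ x - x) ∈ opFiltration a F₀ n) →
      ∀ x ∈ opFiltration a F₀ (n + 1), κ x - x ∈ opFiltration a F₀ n := by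
    intro n ⟨h1, h2⟩
    have : opFiltration a F₀ (n + 1) ≤ (opFiltration a F₀ n).comap
        (κ - (LinearMap.id : M →ₗ[k] M)) := by
      refine opFiltration_succ_le (fun x hx => sub_mem (h1 x hx) hx) (fun v y hy => ?_)
      have h3 : (κ - (LinearMap.id : M →ₗ[k] M)) (a v y) = (κ (a v y) - a v (κ y)) + a v (κ y - y) := by
        simp
      rw [Submodule.mem_comap, h3]
      exact add_mem (hs n v y hy (h1 y hy)) (h2 v y hy)
    exact this
  intro n
  apply key
  induction n with
  | zero =>
    refine ⟨fun x hx => by rw [h0 x hx]; exact hx, fun v x hx => ?_⟩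
    rw [h0 x hx, sub_self, map_zero]
    exact zero_mem _
  | succ n ih =>
    have h := key n ih
    refine ⟨fun x hx => ?_, fun v x hx => apply_mem_opFiltration v (h x hx)⟩
    rw [← sub_add_cancel (κ x) x]
    exact add_mem (opFiltration_le_succ n (h x hx)) hx

end Filtration

/-! ## Free Lie algebras: induction, derivations, filtration -/

namespace FreeLie

variable {k : Type*} [CommRing k] {V : Type*} [AddCommGroup V] [Module k V]

section Lift

variable {L : Type*} [LieRing L] [LieAlgebra k L]

/-- The Lie algebra map that extends a linear map. -/
def lift (f : V →ₗ[k] L) : FreeLie k V →ₗ⁅k⁆ L := (exists_lift k V f).choose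

@[simp]
theorem lift_ι (f : V →ₗ[k] L) (v : V) : lift f (ι k V v) = f v :=
  (exists_lift k V f).choose_spec.1 v

theorem hom_ext {F G : FreeLie k V →ₗ⁅k⁆ L} (h : ∀ v, F (ι k V v) = G (ι k V v)) : F = G :=
  (exists_lift k V ((G : FreeLie k V →ₗ[k] L) ∘ₗ ι k V)).unique h (fun _ => rfl)

end Lift

/-- The elements satisfying `C` form a Lie subalgebra containing `V`. The lift of `V` into it,
followed by the inclusion, is the identity by uniqueness, so the subalgebra is everything. -/
theorem induction {C : FreeLie k V → Prop} (hι : ∀ v, C (ι k V v))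
    (add : ∀ x y, C x → C y → C (x + y)) (smul : ∀ (c : k) x, C x → C (c • x))
    (lie : ∀ x y, C x → C y → C ⁅x, y⁆) (x : FreeLie k V) : C x := by
  let S : LieSubalgebra k (FreeLie k V) :=
    { carrier := {x | C x}
      add_mem' := fun {a b} ha hb => add a b ha hb
      zero_mem' := by
        have := smul 0 _ (hι 0)
        rwa [zero_smul] at this
      smul_mem' := fun c {x} hx => smul c x hx
      lie_mem' := fun {x y} hx hy => lie x y hx hy }
  let g : V →ₗ[k] S := (ι k V).codRestrict S.toSubmodule hι
  have h : S.incl.comp (lift g) = LieHom.id := by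
    apply hom_ext
    intro v
    simp [g]
    rfl
  have h2 : S.incl (lift g x) = x := congr($h x)
  rw [← h2]
  exact (lift g x).2

theorem derivation_ext {D E : LieDerivation k (FreeLie k V) (FreeLie k V)}
    (h : ∀ v, D (ι k V v) = E (ι k V v)) : D = E := by
  ext x
  induction x using induction with
  | hι v => exact h v
  | add x y hx hy => rw [map_add, map_add, hx, hy]
  | smul c x hx => rw [map_smul, map_smul, hx]
  | lie x y hx hy => rw [LieDerivation.apply_lie_eq_add, LieDerivation.apply_lie_eq_add, hx, hy]

end FreeLie

/-- The module `g × g` with the bracket of `g ⊗ k[ε]`, `ε² = 0`. -/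
def TangentLie (g : Type*) : Type _ := g × g

namespace TangentLie

variable {k g : Type*} [CommRing k] [LieRing g] [LieAlgebra k g]

instance : AddCommGroup (TangentLie g) := inferInstanceAs (AddCommGroup (g × g))

instance : Module k (TangentLie g) := inferInstanceAs (Module k (g × g))

instance : LieRing (TangentLie g) where
  bracket x y := (⁅x.1, y.1⁆, ⁅x.2, y.1⁆ + ⁅x.1, y.2⁆)
  add_lie x y z := Prod.ext (add_lie x.1 y.1 z.1) (by
    change ⁅x.2 + y.2, z.1⁆ + ⁅x.1 + y.1, z.2⁆ = ⁅x.2, z.1⁆ + ⁅x.1, z.2⁆ + (⁅y.2, z.1⁆ + ⁅y.1, z.2⁆)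
    rw [add_lie, add_lie]
    abel)
  lie_add x y z := Prod.ext (lie_add x.1 y.1 z.1) (by
    change ⁅x.2, y.1 + z.1⁆ + ⁅x.1, y.2 + z.2⁆ = ⁅x.2, y.1⁆ + ⁅x.1, y.2⁆ + (⁅x.2, z.1⁆ + ⁅x.1, z.2⁆)
    rw [lie_add, lie_add]
    abel)
  lie_self x := Prod.ext (lie_self x.1) (by
    change ⁅x.2, x.1⁆ + ⁅x.1, x.2⁆ = 0
    rw [← lie_skew, neg_add_cancel])
  leibniz_lie x y z := Prod.ext (leibniz_lie x.1 y.1 z.1) (by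
    change ⁅x.2, ⁅y.1, z.1⁆⁆ + ⁅x.1, ⁅y.2, z.1⁆ + ⁅y.1, z.2⁆⁆ =
      ⁅⁅x.2, y.1⁆ + ⁅x.1, y.2⁆, z.1⁆ + ⁅⁅x.1, y.1⁆, z.2⁆ +
        (⁅y.2, ⁅x.1, z.1⁆⁆ + ⁅y.1, ⁅x.2, z.1⁆ + ⁅x.1, z.2⁆⁆)
    rw [lie_add, lie_add, add_lie, leibniz_lie x.2, leibniz_lie x.1, leibniz_lie x.1]
    abel)

instance : LieAlgebra k (TangentLie g) where
  lie_smul c x y := Prod.ext (lie_smul c x.1 y.1) (by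
    change ⁅x.2, c • y.1⁆ + ⁅x.1, c • y.2⁆ = c • (⁅x.2, y.1⁆ + ⁅x.1, y.2⁆)
    rw [lie_smul, lie_smul, smul_add])

theorem lie_fst (x y : TangentLie g) : (⁅x, y⁆ : TangentLie g).1 = ⁅x.1, y.1⁆ := rfl

theorem lie_snd (x y : TangentLie g) : (⁅x, y⁆ : TangentLie g).2 = ⁅x.2, y.1⁆ + ⁅x.1, y.2⁆ := rfl

end TangentLie

namespace FreeLie

variable {k : Type*} [CommRing k] {V : Type*} [AddCommGroup V] [Module k V]

/-- A derivation is the infinitesimal part of a Lie map to the dual numbers: lift `v ↦ v + ε f(v)`.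
The first component is the identity, which turns the bracket formula for the second one into the
Leibniz rule. -/
theorem exists_derivation (f : V →ₗ[k] FreeLie k V) :
    ∃ D : LieDerivation k (FreeLie k V) (FreeLie k V), ∀ v, D (ι k V v) = f v := by
  let j : V →ₗ[k] TangentLie (FreeLie k V) := LinearMap.prod (ι k V) f
  let F := lift j
  have h1 : ∀ x, (F x).1 = x := by
    intro x
    induction x using induction with
    | hι v => rw [lift_ι]; rfl
    | add x y hx hy => rw [map_add]; exact congr_arg₂ (· + ·) hx hy
    | smul c x hx => rw [map_smul]; exact congr_arg (c • ·) hx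
    | lie x y hx hy => rw [LieHom.map_lie, TangentLie.lie_fst, hx, hy]
  refine ⟨{ toLinearMap := LinearMap.snd k (FreeLie k V) (FreeLie k V) ∘ₗ
              (F : FreeLie k V →ₗ[k] TangentLie (FreeLie k V))
            leibniz' := fun x y => ?_ }, fun v => ?_⟩
  · change (F ⁅x, y⁆).2 = ⁅x, (F y).2⁆ - ⁅y, (F x).2⁆
    rw [LieHom.map_lie, TangentLie.lie_snd, h1, h1, ← lie_skew y, sub_neg_eq_add, add_comm]
  · change (F (ι k V v)).2 = _
    rw [lift_ι]
    rfl

/-- The derivation of `Lie(V)` that extends `f`. -/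
def derivation (f : V →ₗ[k] FreeLie k V) : LieDerivation k (FreeLie k V) (FreeLie k V) :=
  (exists_derivation f).choose

@[simp]
theorem derivation_ι (f : V →ₗ[k] FreeLie k V) (v : V) : derivation f (ι k V v) = f v :=
  (exists_derivation f).choose_spec v

/-- The operators `⁅v, ·⁆`. -/
def adι (v : V) : Module.End k (FreeLie k V) := (LieModule.toEnd k (FreeLie k V) (FreeLie k V) (ι k V v))

theorem adι_apply (v : V) (x : FreeLie k V) : adι v x = ⁅ι k V v, x⁆ := rfl

variable (k V) in
/-- The filtration of `Lie(V)` by bracket length. -/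
abbrev filtration : ℕ → Submodule k (FreeLie k V) :=
  opFiltration (adι (k := k) (V := V)) (LinearMap.range (ι k V))

/-- The levels only contain brackets nested to the right, so closure of their union under arbitrary
brackets has to be proved: by induction on `x`, the union is stable under `⁅x, ·⁆`, where the Jacobi
identity rewrites `⁅⁅x, y⁆, z⁆` through iterated brackets. -/
theorem exists_mem_filtration (x : FreeLie k V) : ∃ n, x ∈ filtration k V n := by
  have hU : ∀ y : FreeLie k V, y ∈ (⨆ n, filtration k V n) ↔ ∃ n, y ∈ filtration k V n := by
    intro y
    exact Submodule.mem_iSup_of_directed _ opFiltration_mono.directed_le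
  have hN : ∀ x : FreeLie k V, ∀ y ∈ (⨆ n, filtration k V n), ⁅x, y⁆ ∈ ⨆ n, filtration k V n := by
    intro x
    induction x using induction with
    | hι v =>
      intro y hy
      obtain ⟨n, hn⟩ := (hU y).mp hy
      exact (hU _).mpr ⟨n + 1, apply_mem_opFiltration v hn⟩
    | add x y hx hy => intro z hz; rw [add_lie]; exact add_mem (hx z hz) (hy z hz)
    | smul c x hx => intro z hz; rw [smul_lie]; exact Submodule.smul_mem _ _ (hx z hz)
    | lie x y hx hy =>
      intro z hz
      rw [lie_lie]
      exact sub_mem (hx _ (hy z hz)) (hy _ (hx z hz))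
  rw [← hU]
  induction x using induction with
  | hι v => exact (hU _).mpr ⟨0, ⟨v, rfl⟩⟩
  | add x y hx hy => exact add_mem hx hy
  | smul c x hx => exact Submodule.smul_mem _ _ hx
  | lie x y hx hy => exact hN x y hy

theorem derivation_mem_filtration (D : LieDerivation k (FreeLie k V) (FreeLie k V))
    (hD : ∀ v, D (ι k V v) ∈ LinearMap.range (ι k V)) (n : ℕ) :
    ∀ x ∈ filtration k V n, D x ∈ filtration k V n := by
  refine map_mem_opFiltration (D : FreeLie k V →ₗ[k] FreeLie k V) ?_ ?_ n
  · rintro _ ⟨v, rfl⟩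
    exact hD v
  · intro n v y hy hDy
    change D ⁅ι k V v, y⁆ ∈ _
    rw [LieDerivation.apply_lie_eq_add]
    obtain ⟨w, hw⟩ := hD v
    rw [← hw]
    exact add_mem (apply_mem_opFiltration v hDy) (apply_mem_opFiltration w hy)

/-! ## The post-Lie algebra `Lie(V)` -/

variable (mag : V →ₗ[k] V →ₗ[k] V)

/-- The derivations `v ▷ ·` of `Lie(V)`. -/
def magDerivation : V →ₗ[k] LieDerivation k (FreeLie k V) (FreeLie k V) where
  toFun v := derivation (ι k V ∘ₗ mag v)
  map_add' v w := by
    apply derivation_ext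
    intro x
    simp
  map_smul' c v := by
    apply derivation_ext
    intro x
    simp

@[simp]
theorem magDerivation_ι (v w : V) : magDerivation mag v (ι k V w) = ι k V (mag v w) := by
  simp [magDerivation]

/-- The action of `Lie(V)` on itself by derivations that extends `v ↦ (v ▷ ·)`. -/
def derAction : FreeLie k V →ₗ⁅k⁆ LieDerivation k (FreeLie k V) (FreeLie k V) :=
  lift (magDerivation mag)

theorem derAction_ι_ι (v w : V) : derAction mag (ι k V v) (ι k V w) = ι k V (mag v w) := by
  simp [derAction]

/-- Derivations that preserve `V` are closed under commutators. This keeps the correction `D_y v` at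
length one, however long `y` is. -/
theorem derAction_mem_range (x : FreeLie k V) (v : V) :
    derAction mag x (ι k V v) ∈ LinearMap.range (ι k V) := by
  induction x using induction generalizing v with
  | hι w => exact ⟨mag w v, (derAction_ι_ι mag w v).symm⟩
  | add x y hx hy => rw [map_add]; exact add_mem (hx v) (hy v)
  | smul c x hx => rw [map_smul]; exact Submodule.smul_mem _ _ (hx v)
  | lie x y hx hy =>
    rw [LieHom.map_lie, LieDerivation.lie_apply]
    obtain ⟨a, ha⟩ := hx v
    obtain ⟨b, hb⟩ := hy v
    rw [← ha, ← hb]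
    exact sub_mem (hx b) (hy a)

theorem derAction_mem_filtration (x : FreeLie k V) {n : ℕ} {y : FreeLie k V}
    (hy : y ∈ filtration k V n) : derAction mag x y ∈ filtration k V n :=
  derivation_mem_filtration _ (derAction_mem_range mag x) n y hy

/-- `Lie(V) → Lie(V) ⋊ Der(Lie(V))`, `v ↦ (v, v ▷ ·)`. -/
def graphHom : FreeLie k V →ₗ⁅k⁆ LieAlgebra.SemiDirectSum (FreeLie k V)
    (LieDerivation k (FreeLie k V) (FreeLie k V)) LieHom.id :=
  lift
    { toFun := fun v => ⟨ι k V v, magDerivation mag v⟩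
      map_add' := fun v w => by simp
      map_smul' := fun c v => by simp }

theorem graphHom_right (x : FreeLie k V) : (graphHom mag x).right = derAction mag x := by
  have : (LieAlgebra.SemiDirectSum.projr _).comp (graphHom mag) = derAction mag := by
    apply hom_ext
    intro v
    change (graphHom mag (ι k V v)).right = lift (magDerivation mag) (ι k V v)
    rw [graphHom, lift_ι, lift_ι]
    rfl
  exact congr($this x)

/-- The Lie algebra map from `Lie(V)` to the sub-adjacent Lie algebra that is the identity on
`V`. -/
def toSubadjacent : FreeLie k V →ₗ[k] FreeLie k V :=
  LieAlgebra.SemiDirectSum.projl LieHom.id ∘ₗ (graphHom mag).toLinearMap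

@[simp]
theorem toSubadjacent_ι (v : V) : toSubadjacent mag (ι k V v) = ι k V v := by
  change (graphHom mag (ι k V v)).left = ι k V v
  rw [graphHom, lift_ι]
  rfl

/-- This is the left component of the bracket of the semidirect sum. It already expresses that
`toSubadjacent` is a Lie map to the sub-adjacent bracket, before the post-Lie product exists. -/
theorem toSubadjacent_lie (x y : FreeLie k V) :
    toSubadjacent mag ⁅x, y⁆ = ⁅toSubadjacent mag x, toSubadjacent mag y⁆ +
      derAction mag x (toSubadjacent mag y) - derAction mag y (toSubadjacent mag x) := by
  change (graphHom mag ⁅x, y⁆).left = _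
  rw [LieHom.map_lie, LieAlgebra.SemiDirectSum.lie_eq_mk, graphHom_right, graphHom_right]
  rfl

theorem toSubadjacent_bijective : Function.Bijective (toSubadjacent (k := k) mag) := by
  refine bijective_of_opFiltration exists_mem_filtration _ ?_ ?_
  · rintro _ ⟨v, rfl⟩
    exact toSubadjacent_ι mag v
  · intro n v y hy hκ
    -- The defect is `D_v κ(y) - D_y v`. The first term keeps the length of `κ(y)` and the second
    -- lies in `V`.
    rw [adι_apply, adι_apply, toSubadjacent_lie, toSubadjacent_ι, add_sub_assoc, add_sub_cancel_left]
    refine sub_mem (derAction_mem_filtration mag _ hκ) ?_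
    exact opFiltration_mono (Nat.zero_le n) (derAction_mem_range mag y v)

/-- `toSubadjacent` as a linear equivalence. -/
def subadjacentEquiv : FreeLie k V ≃ₗ[k] FreeLie k V :=
  LinearEquiv.ofBijective (toSubadjacent mag) (toSubadjacent_bijective mag)

theorem subadjacentEquiv_apply (x : FreeLie k V) :
    subadjacentEquiv mag x = toSubadjacent mag x := rfl

theorem subadjacentEquiv_symm_ι (v : V) : (subadjacentEquiv mag).symm (ι k V v) = ι k V v := by
  rw [LinearEquiv.symm_apply_eq, subadjacentEquiv_apply, toSubadjacent_ι]

/-- The post-Lie product of `Lie(V)` that extends `mag`. -/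
def postLieTri : FreeLie k V →ₗ[k] FreeLie k V →ₗ[k] FreeLie k V where
  toFun x := derAction mag ((subadjacentEquiv mag).symm x)
  map_add' x y := by ext z; simp
  map_smul' c x := by ext z; simp

theorem postLieTri_apply (x y : FreeLie k V) :
    postLieTri mag x y = derAction mag ((subadjacentEquiv mag).symm x) y := rfl

/-- Since `x ▷ y = D_{κ⁻¹x} y`, the formula for `κ` of a bracket inverts to this one. The second
post-Lie axiom then says no more than that `derAction` is a Lie map. -/
theorem subadjacentEquiv_symm_lie (x y : FreeLie k V) :
    (subadjacentEquiv mag).symm (⁅x, y⁆ + postLieTri mag x y - postLieTri mag y x) =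
      ⁅(subadjacentEquiv mag).symm x, (subadjacentEquiv mag).symm y⁆ := by
  rw [LinearEquiv.symm_apply_eq, subadjacentEquiv_apply, toSubadjacent_lie,
    ← subadjacentEquiv_apply, ← subadjacentEquiv_apply, LinearEquiv.apply_symm_apply,
    LinearEquiv.apply_symm_apply]
  rfl

/-- The post-Lie algebra `Lie(V)` generated by the magma algebra `(V, mag)`. -/
def postLie : PostLieAlg k (FreeLie k V) where
  tri := postLieTri mag
  tri_lie x y z := by
    rw [postLieTri_apply, LieDerivation.apply_lie_eq_add, add_comm]
    rfl
  lie_tri x y z := by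
    rw [postLieTri_apply, subadjacentEquiv_symm_lie, LieHom.map_lie, LieDerivation.lie_apply]
    rfl

theorem postLie_tri_ι (v w : V) :
    (postLie mag).tri (ι k V v) (ι k V w) = ι k V (mag v w) := by
  change derAction mag ((subadjacentEquiv mag).symm (ι k V v)) (ι k V w) = _
  rw [subadjacentEquiv_symm_ι, derAction_ι_ι]

theorem postLie_tri_ι_mem {n : ℕ} (v : V) {y : FreeLie k V} (hy : y ∈ filtration k V n) :
    (postLie mag).tri (ι k V v) y ∈ filtration k V n :=
  derAction_mem_filtration mag _ hy

theorem postLie_tri_mem_range (y : FreeLie k V) (v : V) :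
    (postLie mag).tri y (ι k V v) ∈ LinearMap.range (ι k V) :=
  derAction_mem_range mag _ v

/-- The second post-Lie axiom solved for the longest first argument. It serves as a recursion on
length: `v ▷ y` is no longer than `y`, and `y ▷ v` lies in `V`. -/
theorem postLie_lie_tri (v : V) (y z : FreeLie k V) :
    (postLie mag).tri ⁅ι k V v, y⁆ z =
      (postLie mag).tri (ι k V v) ((postLie mag).tri y z) -
      (postLie mag).tri y ((postLie mag).tri (ι k V v) z) -
      (postLie mag).tri ((postLie mag).tri (ι k V v) y) z +
      (postLie mag).tri ((postLie mag).tri y (ι k V v)) z := by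
  rw [← (postLie mag).lie_tri, map_sub, map_add]
  simp only [LinearMap.sub_apply, LinearMap.add_apply]
  abel

/-- The Lie algebra map that extends a map of magma algebras into a post-Lie algebra is a map of
post-Lie algebras. -/
theorem lift_postLie_tri {g : Type*} [LieRing g] [LieAlgebra k g] (P' : PostLieAlg k g)
    (φ : V →ₗ[k] g) (hφ : ∀ v w, φ (mag v w) = P'.tri (φ v) (φ w)) (x y : FreeLie k V) :
    lift φ ((postLie mag).tri x y) = P'.tri (lift φ x) (lift φ y) := by
  let C : Submodule k (FreeLie k V) :=
    { carrier := {x | ∀ y, lift φ ((postLie mag).tri x y) = P'.tri (lift φ x) (lift φ y)}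
      zero_mem' := by simp
      add_mem' := by intro a b ha hb y; simp [ha y, hb y]
      smul_mem' := by intro c a ha y; simp [ha y] }
  -- For a first argument in `V`, both sides obey the same Leibniz rule in `y`, so it is enough to
  -- compare them on generators.
  have hC : ∀ w, ι k V w ∈ C := by
    intro w y
    induction y using induction with
    | hι v => simp [postLie_tri_ι, hφ]
    | add a b ha hb => simp [ha, hb]
    | smul c a ha => simp [ha]
    | lie a b ha hb =>
      rw [PostLieAlg.tri_lie, map_add, LieHom.map_lie, LieHom.map_lie, LieHom.map_lie,
        PostLieAlg.tri_lie, ha, hb]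
  suffices h : x ∈ C from h y
  refine mem_of_opFiltration exists_mem_filtration C ?_ ?_ x
  · rintro _ ⟨w, rfl⟩
    exact hC w
  · intro n hn v y hy z
    -- The recursion for `⁅v, y⁆ ▷ z` has first arguments `v`, `y`, `v ▷ y` and `y ▷ v = w`: those
    -- in `V` are covered by `hC`, the others by the induction hypothesis.
    obtain ⟨w, hw⟩ := postLie_tri_mem_range mag y v
    have h1 := hn (postLie_tri_ι_mem mag v hy) z
    have h2 := hC w z
    have h3 := hC v y
    have h4 := hn hy (ι k V v)
    rw [hw] at h2
    rw [adι_apply, postLie_lie_tri, map_add, map_sub, map_sub, h2, h1, hn hy, hC v, hC v z,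
      hn hy z, h4, h3, LieHom.map_lie, ← P'.lie_tri, map_sub, map_add]
    simp only [LinearMap.sub_apply, LinearMap.add_apply]
    abel

/-- The lift of the inclusion of `V` is the identity, and by `lift_postLie_tri` it respects the
products even when the target carries `P'`. -/
theorem postLie_unique (P' : PostLieAlg k (FreeLie k V))
    (h : ∀ v w, P'.tri (ι k V v) (ι k V w) = ι k V (mag v w)) : P'.tri = (postLie mag).tri := by
  have hid : lift (ι k V) = (LieHom.id : FreeLie k V →ₗ⁅k⁆ FreeLie k V) := by
    apply hom_ext
    simp
  ext x y
  have := lift_postLie_tri mag P' (ι k V) (fun v w => (h v w).symm) x y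
  rw [hid] at this
  exact this.symm

end FreeLie

/-! ## The action post-Lie-Rinehart algebra -/

namespace PostLieAlg

variable {k R g : Type*} [CommRing k] [CommRing R] [Algebra k R] [LieRing g] [LieAlgebra k g]
  (P : PostLieAlg k g) (ρ : g →ₗ[k] Derivation k R R)

/-- The operators `f ⊗ y ↦ ρ(x)(f) ⊗ y + f ⊗ (x ▷ y)`. -/
def actionOp : g →ₗ[k] R ⊗[k] g →ₗ[k] R ⊗[k] g where
  toFun x := (ρ x : R →ₗ[k] R).rTensor g + (P.tri x).lTensor R
  map_add' x y := by
    ext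
    simp only [map_add, TensorProduct.AlgebraTensorModule.curry_apply, TensorProduct.curry_apply,
      LinearMap.coe_restrictScalars, LinearMap.add_apply, LinearMap.rTensor_tmul,
      LinearMap.lTensor_tmul, Derivation.coeFn_coe, Derivation.add_apply, TensorProduct.add_tmul,
      TensorProduct.tmul_add]
    abel
  map_smul' c x := by
    ext
    simp [TensorProduct.smul_tmul']

@[simp]
theorem actionOp_tmul (x : g) (f : R) (y : g) :
    P.actionOp ρ x (f ⊗ₜ y) = ρ x f ⊗ₜ y + f ⊗ₜ P.tri x y := rfl

theorem actionOp_lie (x : g) (y z : R ⊗[k] g) :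
    P.actionOp ρ x ⁅y, z⁆ = ⁅P.actionOp ρ x y, z⁆ + ⁅y, P.actionOp ρ x z⁆ := by
  induction y with
  | zero => simp
  | add a b ha hb => rw [add_lie, map_add, map_add, ha, hb, add_lie, add_lie]; abel
  | tmul f y =>
    induction z with
    | zero => simp
    | add a b ha hb => rw [lie_add, map_add, map_add, ha, hb, lie_add, lie_add]; abel
    | tmul f' z =>
      simp only [LieAlgebra.ExtendScalars.bracket_tmul, actionOp_tmul, add_lie, lie_add,
        Derivation.leibniz, P.tri_lie, TensorProduct.tmul_add, TensorProduct.add_tmul,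
        smul_eq_mul, mul_comm f']
      abel

theorem actionOp_smul (x : g) (f : R) (y : R ⊗[k] g) :
    P.actionOp ρ x (f • y) = f • P.actionOp ρ x y + ρ x f • y := by
  induction y with
  | zero => simp
  | add a b ha hb => rw [smul_add, map_add, map_add, ha, hb, smul_add, smul_add]; abel
  | tmul f' y =>
    simp only [TensorProduct.smul_tmul', actionOp_tmul, smul_eq_mul, Derivation.leibniz,
      smul_add, TensorProduct.add_tmul, mul_comm f']
    abel

/-- The sub-adjacent Lie algebra acts on `R` through `ρ` and on `g` through `▷`, hence diagonally on
the tensor product; the mixed terms cancel in the commutator. -/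
theorem actionOp_comm (hρ : ∀ x y, ρ (P.tri x y - P.tri y x + ⁅x, y⁆) = ⁅ρ x, ρ y⁆)
    (x y : g) (z : R ⊗[k] g) :
    P.actionOp ρ (⁅x, y⁆ + P.tri x y - P.tri y x) z =
      P.actionOp ρ x (P.actionOp ρ y z) - P.actionOp ρ y (P.actionOp ρ x z) := by
  induction z with
  | zero => simp
  | add a b ha hb => simp only [map_add _ a, ha, hb, map_add]; abel
  | tmul f z =>
    have h : ⁅x, y⁆ + P.tri x y - P.tri y x = P.tri x y - P.tri y x + ⁅x, y⁆ := by abel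
    rw [actionOp_tmul, P.lie_tri, h, hρ, Derivation.commutator_apply]
    simp only [actionOp_tmul, map_add, TensorProduct.sub_tmul, TensorProduct.tmul_sub]
    abel

/-- The action post-Lie-Rinehart algebra `R ⊗ g`. -/
def actionPostLieRinehart (hρ : ∀ x y, ρ (P.tri x y - P.tri y x + ⁅x, y⁆) = ⁅ρ x, ρ y⁆) :
    PostLieRinehart k R (R ⊗[k] g) where
  tri := (P.actionOp ρ).liftBaseChange R
  rho := ρ.liftBaseChange R
  tri_lie x y z := by
    induction x with
    | zero => simp
    | add a b ha hb =>
      simp only [map_add, LinearMap.add_apply, ha, hb, add_lie, lie_add]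
      abel
    | tmul f x => simp [actionOp_lie]
  lie_tri x y z := by
    induction x with
    | zero => simp
    | add a b ha hb =>
      have : ⁅a + b, y⁆ + (P.actionOp ρ).liftBaseChange R (a + b) y -
          (P.actionOp ρ).liftBaseChange R y (a + b) =
          (⁅a, y⁆ + (P.actionOp ρ).liftBaseChange R a y -
            (P.actionOp ρ).liftBaseChange R y a) +
          (⁅b, y⁆ + (P.actionOp ρ).liftBaseChange R b y -
            (P.actionOp ρ).liftBaseChange R y b) := by
        simp only [map_add, LinearMap.add_apply, add_lie]
        abel
      rw [this, map_add, LinearMap.add_apply, ha, hb]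
      simp only [map_add, LinearMap.add_apply]
      abel
    | tmul f x =>
      induction y with
      | zero => simp
      | add a b ha hb =>
        have : ⁅f ⊗ₜ[k] x, a + b⁆ + (P.actionOp ρ).liftBaseChange R (f ⊗ₜ[k] x) (a + b) -
            (P.actionOp ρ).liftBaseChange R (a + b) (f ⊗ₜ[k] x) =
            (⁅f ⊗ₜ[k] x, a⁆ + (P.actionOp ρ).liftBaseChange R (f ⊗ₜ[k] x) a -
              (P.actionOp ρ).liftBaseChange R a (f ⊗ₜ[k] x)) +
            (⁅f ⊗ₜ[k] x, b⁆ + (P.actionOp ρ).liftBaseChange R (f ⊗ₜ[k] x) b -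
              (P.actionOp ρ).liftBaseChange R b (f ⊗ₜ[k] x)) := by
          simp only [map_add, LinearMap.add_apply, lie_add]
          abel
        rw [this, map_add, LinearMap.add_apply, ha, hb]
        simp only [map_add, LinearMap.add_apply]
        abel
      | tmul f' y =>
        have h := P.actionOp_comm ρ hρ x y z
        -- Apart from the sub-adjacent bracket of `x` and `y`, two terms remain in which a
        -- coefficient is differentiated. They match the terms that `actionOp_smul` produces when
        -- the operators on the right-hand side pass these coefficients.
        have e : ⁅f ⊗ₜ[k] x, f' ⊗ₜ[k] y⁆ + f • (ρ x f' ⊗ₜ[k] y + f' ⊗ₜ[k] P.tri x y) -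
            f' • (ρ y f ⊗ₜ[k] x + f ⊗ₜ[k] P.tri y x) =
            (f * f') ⊗ₜ[k] (⁅x, y⁆ + P.tri x y - P.tri y x) + (f * ρ x f') ⊗ₜ[k] y -
              (f' * ρ y f) ⊗ₜ[k] x := by
          simp only [LieAlgebra.ExtendScalars.bracket_tmul, TensorProduct.tmul_add,
            TensorProduct.tmul_sub, smul_add, TensorProduct.smul_tmul', smul_eq_mul, mul_comm f']
          abel
        simp only [LinearMap.liftBaseChange_tmul, LinearMap.smul_apply, actionOp_tmul, e]
        simp only [map_add, map_sub, LinearMap.liftBaseChange_tmul, LinearMap.add_apply,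
          LinearMap.sub_apply, LinearMap.smul_apply, actionOp_smul]
        have h' : P.actionOp ρ ⁅x, y⁆ z + P.actionOp ρ (P.tri x y) z -
            P.actionOp ρ (P.tri y x) z =
            P.actionOp ρ x (P.actionOp ρ y z) - P.actionOp ρ y (P.actionOp ρ x z) := by
          rw [← h, map_sub, map_add]
          rfl
        rw [h']
        simp only [smul_add, smul_sub, smul_smul, mul_comm f']
        abel
  rho_lie x y := by
    induction x with
    | zero => simp
    | add a b ha hb =>
      simp only [map_add, map_sub, LinearMap.add_apply, add_lie] at ha hb ⊢
      rw [← ha, ← hb]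
      abel
    | tmul f x =>
      induction y with
      | zero => simp
      | add a b ha hb =>
        simp only [map_add, map_sub, LinearMap.add_apply, lie_add] at ha hb ⊢
        rw [← ha, ← hb]
        abel
      | tmul f' y =>
        ext r
        have h := congr($(hρ x y) r)
        simp only [map_add, map_sub, Derivation.add_apply, Derivation.sub_apply,
          Derivation.commutator_apply] at h
        simp only [LinearMap.liftBaseChange_tmul, LinearMap.smul_apply, actionOp_tmul,
          LieAlgebra.ExtendScalars.bracket_tmul, map_add, map_sub, map_smul,
          Derivation.add_apply, Derivation.sub_apply, Derivation.smul_apply, smul_eq_mul,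
          Derivation.commutator_apply, Derivation.leibniz]
        linear_combination (f * f') * h
  tri_smul x f y := by
    induction x with
    | zero => simp
    | add a b ha hb =>
      simp only [map_add, LinearMap.add_apply, Derivation.add_apply, ha, hb, smul_add, add_smul]
      abel
    | tmul f' x =>
      simp only [LinearMap.liftBaseChange_tmul, LinearMap.smul_apply, Derivation.smul_apply,
        actionOp_smul, smul_add, smul_smul, smul_eq_mul, mul_comm f]

theorem isActionPostLieRinehart
    (hρ : ∀ x y, ρ (P.tri x y - P.tri y x + ⁅x, y⁆) = ⁅ρ x, ρ y⁆) :
    IsActionPostLieRinehart P ρ (P.actionPostLieRinehart ρ hρ) where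
  rho_lie := hρ
  tri_tmul f₁ f₂ x₁ x₂ := by
    change (P.actionOp ρ).liftBaseChange R _ _ = _
    simp [TensorProduct.smul_tmul']
  rho_tmul f x := by
    change ρ.liftBaseChange R _ = _
    simp

end PostLieAlg

/-! ## The free post-Lie-Rinehart algebra -/

namespace LieHom

variable {k g L : Type*} (R : Type*) [CommRing k] [CommRing R] [Algebra k R] [LieRing g]
  [LieAlgebra k g] [LieRing L] [LieAlgebra k L] [LieAlgebra R L] [IsScalarTower k R L]

/-- The `R`-linear extension of a Lie algebra map. -/
def liftBaseChange (φ : g →ₗ⁅k⁆ L) : R ⊗[k] g →ₗ⁅R⁆ L :=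
  { φ.toLinearMap.liftBaseChange R with
    map_lie' := by
      intro x y
      change φ.toLinearMap.liftBaseChange R _ =
        ⁅φ.toLinearMap.liftBaseChange R x, φ.toLinearMap.liftBaseChange R y⁆
      induction x with
      | zero => simp
      | add a b ha hb => simp only [add_lie, map_add, ha, hb]
      | tmul f x =>
        induction y with
        | zero => simp
        | add a b ha hb => simp only [lie_add, map_add, ha, hb]
        | tmul f' y => simp [smul_smul, mul_comm f'] }

theorem liftBaseChange_tmul (φ : g →ₗ⁅k⁆ L) (f : R) (x : g) :
    liftBaseChange R φ (f ⊗ₜ x) = f • φ x :=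
  LinearMap.liftBaseChange_tmul R φ.toLinearMap f x

variable {R} in
theorem eq_liftBaseChange {φ : g →ₗ⁅k⁆ L} {G : R ⊗[k] g →ₗ⁅R⁆ L}
    (h : ∀ x, G (1 ⊗ₜ x) = φ x) : G = liftBaseChange R φ := by
  ext x
  induction x with
  | zero => simp
  | add a b ha hb => simp only [map_add, ha, hb]
  | tmul f x =>
    rw [liftBaseChange_tmul, ← h, ← map_smul, TensorProduct.smul_tmul', smul_eq_mul, mul_one]

variable {R} in
/-- The restriction of an `R`-linear Lie algebra map to `1 ⊗ g`. -/
def restrictBase (G : R ⊗[k] g →ₗ⁅R⁆ L) : g →ₗ⁅k⁆ L :=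
  { (G : R ⊗[k] g →ₗ[R] L).restrictScalars k ∘ₗ TensorProduct.mk k R g 1 with
    map_lie' := by
      intro x y
      change G (1 ⊗ₜ ⁅x, y⁆) = ⁅G (1 ⊗ₜ x), G (1 ⊗ₜ y)⁆
      rw [← LieHom.map_lie, LieAlgebra.ExtendScalars.bracket_tmul, one_mul] }

end LieHom

namespace FreeLie

variable {k : Type*} [CommRing k] {V : Type*} [AddCommGroup V] [Module k V]
  (mag : V →ₗ[k] V →ₗ[k] V)

/-- The map out of the sub-adjacent Lie algebra of `Lie(V)` that extends `f`. -/
def subadjacentLift {D : Type*} [LieRing D] [LieAlgebra k D] (f : V →ₗ[k] D) :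
    FreeLie k V →ₗ[k] D :=
  (lift f).toLinearMap ∘ₗ (subadjacentEquiv mag).symm.toLinearMap

section

variable {D : Type*} [LieRing D] [LieAlgebra k D] (f : V →ₗ[k] D)

theorem subadjacentLift_apply (x : FreeLie k V) :
    subadjacentLift mag f x = lift f ((subadjacentEquiv mag).symm x) := rfl

theorem subadjacentLift_ι (v : V) : subadjacentLift mag f (ι k V v) = f v := by
  rw [subadjacentLift_apply, subadjacentEquiv_symm_ι, lift_ι]

theorem subadjacentLift_lie (x y : FreeLie k V) :
    subadjacentLift mag f ((postLie mag).tri x y - (postLie mag).tri y x + ⁅x, y⁆) =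
      ⁅subadjacentLift mag f x, subadjacentLift mag f y⁆ := by
  have h : (postLie mag).tri x y - (postLie mag).tri y x + ⁅x, y⁆ =
      ⁅x, y⁆ + postLieTri mag x y - postLieTri mag y x := by
    change postLieTri mag x y - postLieTri mag y x + ⁅x, y⁆ = _
    abel
  rw [subadjacentLift_apply, h, subadjacentEquiv_symm_lie, LieHom.map_lie]
  rfl

/-- Precomposing with `subadjacentEquiv` turns `r` into a Lie map for the free bracket, which is
determined on `V`. Thus the sub-adjacent Lie algebra is itself free on `V`. -/
theorem subadjacentLift_unique (r : FreeLie k V →ₗ[k] D) (hι : ∀ v, r (ι k V v) = f v)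
    (hr : ∀ x y, r ((postLie mag).tri x y - (postLie mag).tri y x + ⁅x, y⁆) = ⁅r x, r y⁆) :
    r = subadjacentLift mag f := by
  let F : FreeLie k V →ₗ⁅k⁆ D :=
    { r ∘ₗ (subadjacentEquiv mag).toLinearMap with
      map_lie' := by
        intro x y
        change r (toSubadjacent mag ⁅x, y⁆) = ⁅r (toSubadjacent mag x), r (toSubadjacent mag y)⁆
        rw [← hr, toSubadjacent_lie]
        change _ = r (derAction mag ((subadjacentEquiv mag).symm (subadjacentEquiv mag x)) _ -
          derAction mag ((subadjacentEquiv mag).symm (subadjacentEquiv mag y)) _ + _)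
        rw [LinearEquiv.symm_apply_apply, LinearEquiv.symm_apply_apply]
        congr 1
        abel }
  have h : F = lift f := by
    apply hom_ext
    intro v
    change r (toSubadjacent mag (ι k V v)) = _
    rw [toSubadjacent_ι, hι, lift_ι]
  ext x
  have h2 : r (subadjacentEquiv mag ((subadjacentEquiv mag).symm x)) =
      lift f ((subadjacentEquiv mag).symm x) := congr($h ((subadjacentEquiv mag).symm x))
  rw [LinearEquiv.apply_symm_apply] at h2
  exact h2

end

section

variable {R : Type*} [CommRing R] [Algebra k R] (fV : V →ₗ[k] Derivation k R R)

/-- The free post-Lie-Rinehart algebra `R ⊗ Lie(V)`. -/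
def postLieRinehart : PostLieRinehart k R (R ⊗[k] FreeLie k V) :=
  (postLie mag).actionPostLieRinehart (subadjacentLift mag fV) (subadjacentLift_lie mag fV)

theorem isAction_postLieRinehart :
    IsActionPostLieRinehart (postLie mag) (subadjacentLift mag fV) (postLieRinehart mag fV) :=
  (postLie mag).isActionPostLieRinehart _ _

end

theorem existsUnique_postLieRinehart_hom {R : Type*} [CommRing R] [Algebra k R]
    (fV : V →ₗ[k] Derivation k R R) {L : Type*} [LieRing L] [LieAlgebra R L] [LieAlgebra k L]
    [IsScalarTower k R L] (P' : PostLieRinehart k R L) (φ : V →ₗ[k] L)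
    (hφ : ∀ v w, φ (mag v w) = P'.tri (φ v) (φ w)) (hρ : ∀ v, P'.rho (φ v) = fV v) :
    ∃! F : R ⊗[k] FreeLie k V →ₗ⁅R⁆ L,
      (∀ x y, F ((postLieRinehart mag fV).tri x y) = P'.tri (F x) (F y)) ∧
      (∀ x, P'.rho (F x) = (postLieRinehart mag fV).rho x) ∧
      ∀ v, F (1 ⊗ₜ ι k V v) = φ v := by
  have hA := isAction_postLieRinehart mag fV
  -- The target is viewed as a post-Lie algebra over `k`, so that `lift_postLie_tri` applies.
  let P₀ : PostLieAlg k L :=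
    { tri := P'.tri.restrictScalars k
      tri_lie := P'.tri_lie
      lie_tri := P'.lie_tri }
  have htri : ∀ x y, lift φ ((postLie mag).tri x y) = P'.tri (lift φ x) (lift φ y) :=
    lift_postLie_tri mag P₀ φ hφ
  -- Both anchors are Lie maps on the sub-adjacent Lie algebra that restrict to `fV` on `V`, and
  -- such a map is unique.
  have hrho : ∀ x, P'.rho (lift φ x) = subadjacentLift mag fV x := by
    have := subadjacentLift_unique mag fV (P'.rho.restrictScalars k ∘ₗ (lift φ).toLinearMap)
      (fun v => by simp [hρ]) (fun x y => by
        change P'.rho (lift φ _) = ⁅P'.rho (lift φ x), P'.rho (lift φ y)⁆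
        rw [map_add, map_sub, htri, htri, LieHom.map_lie, P'.rho_lie])
    exact fun x => congr($this x)
  have hF := LieHom.liftBaseChange_tmul R (lift φ)
  refine ⟨LieHom.liftBaseChange R (lift φ), ⟨fun x y => ?_, fun x => ?_, fun v => ?_⟩, ?_⟩
  · induction x with
    | zero => simp
    | add a b ha hb => simp only [map_add, LinearMap.add_apply, ha, hb]
    | tmul f x =>
      induction y with
      | zero => simp
      | add a b ha hb => simp only [map_add, ha, hb]
      | tmul f' y =>
        rw [hA.tri_tmul, map_add, hF, hF, hF, hF, htri, P'.tri.map_smul,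
          LinearMap.smul_apply, P'.tri_smul, hrho, smul_add, smul_smul, smul_smul, add_comm]
  · induction x with
    | zero => simp
    | add a b ha hb => simp only [map_add, ha, hb]
    | tmul f x => rw [hF, hA.rho_tmul, map_smul, hrho]
  · rw [hF, one_smul, lift_ι]
  -- Uniqueness needs only the Lie structure: an `R`-linear Lie map out of `R ⊗ Lie(V)` is
  -- determined on `1 ⊗ V`.
  · rintro G ⟨-, -, hG⟩
    apply LieHom.eq_liftBaseChange
    have h : LieHom.restrictBase G = lift φ := by
      apply hom_ext
      intro v
      rw [lift_ι]
      exact hG v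
    exact fun x => congr($h x)

theorem isFree_postLieRinehart {k : Type u} [CommRing k] {R : Type v} [CommRing R] [Algebra k R]
    {V : Type w} [AddCommGroup V] [Module k V] (mag : V →ₗ[k] V →ₗ[k] V)
    (fV : V →ₗ[k] Derivation k R R) :
    IsFreePostLieRinehart.{u, v, w, max v u w, t} mag fV (postLieRinehart mag fV)
      (TensorProduct.mk k R (FreeLie k V) 1 ∘ₗ FreeLie.ι k V) := by
  have hA := isAction_postLieRinehart mag fV
  refine ⟨fun v w => ?_, fun v => ?_, ?_⟩
  · simp [hA.tri_tmul, postLie_tri_ι]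
  · simp [hA.rho_tmul, subadjacentLift_ι]
  intro L' _ _ _ _ P' φ hφ hρ
  -- The `k`-bilinearity of the bracket is inherited from its `R`-bilinearity.
  let _ : LieAlgebra k L' :=
    { (inferInstance : Module k L') with
      lie_smul := fun c x y => by
        rw [← algebraMap_smul R c y, lie_smul, algebraMap_smul] }
  exact existsUnique_postLieRinehart_hom mag fV P' φ hφ hρ

end FreeLie

/-! ## Tensor algebras: induction, derivations, actions -/

namespace TensorAlgebra

variable {k : Type*} [CommRing k] {V : Type*} [AddCommGroup V] [Module k V]

theorem induction_left {C : TensorAlgebra k V → Prop} (one : C 1)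
    (smul : ∀ (c : k) x, C x → C (c • x)) (add : ∀ x y, C x → C y → C (x + y))
    (ι_mul : ∀ v x, C x → C (ι k v * x)) (x : TensorAlgebra k V) : C x := by
  -- Stability of `C` under left multiplication by `x` is compatible with products in `x`, unlike `C
  -- x` itself.
  suffices h : ∀ y, C y → C (x * y) by simpa using h 1 one
  induction x using TensorAlgebra.induction with
  | algebraMap r => intro y hy; rw [← Algebra.smul_def]; exact smul r y hy
  | ι v => exact ι_mul v
  | mul a b ha hb => intro y hy; rw [mul_assoc]; exact ha _ (hb y hy)
  | add a b ha hb => intro y hy; rw [add_mul]; exact add _ _ (ha y hy) (hb y hy)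

theorem linearMap_ext_left {M : Type*} [AddCommGroup M] [Module k M]
    {F G : TensorAlgebra k V →ₗ[k] M} (one : F 1 = G 1)
    (ι_mul : ∀ v x, F x = G x → F (ι k v * x) = G (ι k v * x)) : F = G := by
  ext x
  induction x using induction_left with
  | one => exact one
  | smul c x hx => rw [map_smul, map_smul, hx]
  | add x y hx hy => rw [map_add, map_add, hx, hy]
  | ι_mul v x hx => exact ι_mul v x hx

section Derivation

/-- The associative form of the dual number argument: lift `v ↦ v + ε f(v)` to the trivial
square-zero extension and take the second component. -/
theorem exists_derivation (f : V →ₗ[k] TensorAlgebra k V) :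
    ∃ D : Module.End k (TensorAlgebra k V), (∀ v, D (ι k v) = f v) ∧
      ∀ x y, D (x * y) = x * D y + D x * y := by
  let F : TensorAlgebra k V →ₐ[k] TrivSqZeroExt (TensorAlgebra k V) (TensorAlgebra k V) :=
    lift k ((TrivSqZeroExt.inlAlgHom k (TensorAlgebra k V) (TensorAlgebra k V)).toLinearMap ∘ₗ ι k +
      (TrivSqZeroExt.inrHom (TensorAlgebra k V) (TensorAlgebra k V)).restrictScalars k ∘ₗ f)
  have h1 : ∀ x, (F x).fst = x := by
    have : (TrivSqZeroExt.fstHom k (TensorAlgebra k V) (TensorAlgebra k V)).comp F =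
        AlgHom.id k _ := by
      ext v
      simp [F]
    exact fun x => congr($this x)
  refine ⟨(TrivSqZeroExt.sndHom (TensorAlgebra k V) (TensorAlgebra k V)).restrictScalars k ∘ₗ
    F.toLinearMap, fun v => by simp [F], fun x y => ?_⟩
  change (F (x * y)).snd = x * (F y).snd + (F x).snd * y
  rw [map_mul, TrivSqZeroExt.snd_mul, h1, h1]
  rfl

theorem derivation_apply_one {D : Module.End k (TensorAlgebra k V)}
    (hD : ∀ x y, D (x * y) = x * D y + D x * y) : D 1 = 0 := by
  have := hD 1 1
  rw [mul_one, mul_one, one_mul] at this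
  simpa using this

theorem derivation_ext {D E : Module.End k (TensorAlgebra k V)}
    (hD : ∀ x y, D (x * y) = x * D y + D x * y) (hE : ∀ x y, E (x * y) = x * E y + E x * y)
    (h : ∀ v, D (ι k v) = E (ι k v)) : D = E := by
  apply linearMap_ext_left
  · rw [derivation_apply_one hD, derivation_apply_one hE]
  · intro v x hx
    rw [hD, hE, hx, h]

/-- The derivation of `T(V)` that extends `f`. -/
def derivation (f : V →ₗ[k] TensorAlgebra k V) : Module.End k (TensorAlgebra k V) :=
  (exists_derivation f).choose

theorem derivation_ι (f : V →ₗ[k] TensorAlgebra k V) (v : V) : derivation f (ι k v) = f v :=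
  (exists_derivation f).choose_spec.1 v

theorem derivation_mul (f : V →ₗ[k] TensorAlgebra k V) (x y : TensorAlgebra k V) :
    derivation f (x * y) = x * derivation f y + derivation f x * y :=
  (exists_derivation f).choose_spec.2 x y

end Derivation

section Equivariance

variable {M N P : Type*} [AddCommGroup M] [Module k M] [AddCommGroup N] [Module k N]
  [AddCommGroup P] [Module k P]

theorem comul_ι_mul (v : V) (x : TensorAlgebra k V) :
    Coalgebra.comul (R := k) (ι k v * x) =
      (ι k v ⊗ₜ[k] 1 + 1 ⊗ₜ[k] ι k v) * Coalgebra.comul (R := k) x := by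
  rw [Bialgebra.comul_mul, comul_ι]

theorem intertwine {α : TensorAlgebra k V →ₐ[k] Module.End k M}
    {γ : TensorAlgebra k V →ₐ[k] Module.End k N} (F : M →ₗ[k] N)
    (h : ∀ v x, F (α (ι k v) x) = γ (ι k v) (F x)) (z : TensorAlgebra k V) (x : M) :
    F (α z x) = γ z (F x) := by
  induction z using induction_left generalizing x with
  | one => simp
  | smul c z hz => simp [hz]
  | add y z hy hz => simp [hy, hz]
  | ι_mul v z hz => rw [map_mul, map_mul, Module.End.mul_apply, Module.End.mul_apply, h, hz]

/-- A bilinear map for which `v ∈ V` satisfy the Leibniz rule intertwines the action on pairs given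
by the comultiplication. -/
theorem equivariant {α : TensorAlgebra k V →ₐ[k] Module.End k M}
    {β : TensorAlgebra k V →ₐ[k] Module.End k N} {γ : TensorAlgebra k V →ₐ[k] Module.End k P}
    (m : M →ₗ[k] N →ₗ[k] P)
    (h : ∀ v x y, γ (ι k v) (m x y) = m (α (ι k v) x) y + m x (β (ι k v) y))
    (z : TensorAlgebra k V) (x : M) (y : N) :
    γ z (m x y) = TensorProduct.lift m (TensorProduct.map (α.toLinearMap.flip x)
      (β.toLinearMap.flip y) (Coalgebra.comul (R := k) z)) := by
  induction z using induction_left with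
  | one => simp [Algebra.TensorProduct.one_def]
  | smul c z hz => simp [hz]
  | add y z hy hz => simp [hy, hz]
  | ι_mul v z hz =>
    rw [map_mul, Module.End.mul_apply, hz, comul_ι_mul]
    -- After the induction hypothesis has been used, the claim is linear in `Δ z`, and an arbitrary
    -- tensor may take its place.
    generalize Coalgebra.comul (R := k) z = t
    induction t with
    | zero => simp
    | add s t hs ht => rw [map_add, map_add, map_add, hs, ht, mul_add, map_add, map_add]
    | tmul a b => simp [h, add_mul]

end Equivariance

/-! ## Compatibility of the coshuffle antipode with the coalgebra structure -/

theorem antipode_mul (x y : TensorAlgebra k V) : HopfAlgebra.antipode k (x * y) =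
    HopfAlgebra.antipode k y * HopfAlgebra.antipode k x := coshuffleAntipode_mul k V x y

theorem antipode_ι (v : V) : HopfAlgebra.antipode k (ι k v) = -ι k v := coshuffleAntipode_ι k v

theorem antipode_ι_mul (v : V) (x : TensorAlgebra k V) : HopfAlgebra.antipode k (ι k v * x) =
    -(HopfAlgebra.antipode k x * ι k v) := by
  rw [antipode_mul, antipode_ι, mul_neg]

theorem antipode_antipode (x : TensorAlgebra k V) :
    HopfAlgebra.antipode k (HopfAlgebra.antipode k x) = x := by
  induction x using induction_left with
  | one => simp
  | smul c z hz => simp [hz]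
  | add y z hy hz => simp [hy, hz]
  | ι_mul v z hz => rw [antipode_ι_mul, map_neg, antipode_mul, hz, antipode_ι]; simp

/-- No flip of the two factors appears, in accordance with cocommutativity: both sides turn a
primitive left factor `v` into right multiplication by `-(v ⊗ 1 + 1 ⊗ v)`. -/
theorem comul_antipode (x : TensorAlgebra k V) :
    Coalgebra.comul (R := k) (HopfAlgebra.antipode k x) =
      TensorProduct.map (HopfAlgebra.antipode k) (HopfAlgebra.antipode k)
        (Coalgebra.comul (R := k) x) := by
  induction x using induction_left with
  | one => simp [Algebra.TensorProduct.one_def]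
  | smul c z hz => simp [hz]
  | add y z hy hz => simp [hy, hz]
  | ι_mul v z hz =>
    rw [antipode_ι_mul, map_neg, Bialgebra.comul_mul, hz, comul_ι_mul, comul_ι]
    generalize Coalgebra.comul (R := k) z = t
    induction t with
    | zero => simp
    | add s t hs ht => rw [map_add, add_mul, neg_add, hs, ht, mul_add, map_add]
    | tmul a b => simp [mul_add, add_mul, antipode_ι_mul, TensorProduct.neg_tmul,
        TensorProduct.tmul_neg]; abel

/-! ## The post-Hopf algebra `T(V)` -/

section PostHopf

variable (mag : V →ₗ[k] V →ₗ[k] V)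

/-- The derivations `v ▷ ·` of `T(V)`. -/
def magDerivation : V →ₗ[k] Module.End k (TensorAlgebra k V) where
  toFun v := derivation (ι k ∘ₗ mag v)
  map_add' v w := by
    apply derivation_ext (derivation_mul _)
    · intro x y
      simp only [LinearMap.add_apply, derivation_mul, mul_add, add_mul]
      abel
    · simp [derivation_ι]
  map_smul' c v := by
    apply derivation_ext (derivation_mul _)
    · intro x y
      simp [derivation_mul]
    · simp [derivation_ι]

theorem magDerivation_ι (v w : V) : magDerivation mag v (ι k w) = ι k (mag v w) :=
  derivation_ι _ w

theorem magDerivation_mul (v : V) (x y : TensorAlgebra k V) :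
    magDerivation mag v (x * y) = x * magDerivation mag v y + magDerivation mag v x * y :=
  derivation_mul _ x y

theorem magDerivation_one (v : V) : magDerivation (k := k) mag v 1 = 0 :=
  derivation_apply_one (magDerivation_mul mag v)

/-- The action of `T(V)` on itself that extends `v ↦ (v ▷ ·)`. -/
def derAction : TensorAlgebra k V →ₐ[k] Module.End k (TensorAlgebra k V) :=
  lift k (magDerivation mag)

@[simp]
theorem derAction_ι (v : V) : derAction mag (ι k v) = magDerivation mag v := lift_ι_apply _ v

/-- The operators `x ↦ v * x = v x + (v ▷ x)` of left multiplication for the Grossman-Larson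
product. -/
def glOp : V →ₗ[k] Module.End k (TensorAlgebra k V) :=
  LinearMap.mul k _ ∘ₗ ι k + magDerivation mag

theorem glOp_apply (v : V) (x : TensorAlgebra k V) :
    glOp mag v x = ι k v * x + magDerivation mag v x := rfl

/-- The action of `T(V)` on itself that extends `v ↦ (v ▷ ·) + (v · )`. -/
def glAction : TensorAlgebra k V →ₐ[k] Module.End k (TensorAlgebra k V) :=
  lift k (glOp mag)

theorem glAction_ι (v : V) (x : TensorAlgebra k V) :
    glAction mag (ι k v) x = ι k v * x + magDerivation mag v x := by
  simp [glAction, glOp_apply]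

/-- The algebra map from `T(V)` to the sub-adjacent Hopf algebra that is the identity on `V`. -/
def toSubadjacent : TensorAlgebra k V →ₗ[k] TensorAlgebra k V := (glAction mag).toLinearMap.flip 1

theorem toSubadjacent_apply (x : TensorAlgebra k V) :
    toSubadjacent mag x = glAction mag x 1 := rfl

theorem toSubadjacent_one : toSubadjacent (k := k) mag 1 = 1 := by simp [toSubadjacent_apply]

theorem toSubadjacent_ι (v : V) : toSubadjacent mag (ι k v) = ι k v := by
  rw [toSubadjacent_apply, glAction_ι, magDerivation_one, mul_one, add_zero]

theorem toSubadjacent_mul (x y : TensorAlgebra k V) :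
    toSubadjacent mag (x * y) = glAction mag x (toSubadjacent mag y) := by
  rw [toSubadjacent_apply, map_mul]
  rfl

theorem toSubadjacent_ι_mul (v : V) (x : TensorAlgebra k V) : toSubadjacent mag (ι k v * x) =
    ι k v * toSubadjacent mag x + magDerivation mag v (toSubadjacent mag x) := by
  rw [toSubadjacent_mul, glAction_ι]

variable (k V) in
/-- The filtration of `T(V)` by length. -/
abbrev filtration : ℕ → Submodule k (TensorAlgebra k V) :=
  opFiltration (fun v => LinearMap.mulLeft k (ι k (M := V) v)) (Submodule.span k {1})

theorem exists_mem_filtration (x : TensorAlgebra k V) : ∃ n, x ∈ filtration k V n := by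
  induction x using induction_left with
  | one => exact ⟨0, Submodule.mem_span_singleton_self 1⟩
  | smul c z hz => exact hz.imp fun n hn => Submodule.smul_mem _ _ hn
  | add y z hy hz =>
    obtain ⟨m, hm⟩ := hy
    obtain ⟨n, hn⟩ := hz
    exact ⟨max m n, add_mem (opFiltration_mono (le_max_left m n) hm)
      (opFiltration_mono (le_max_right m n) hn)⟩
  | ι_mul v z hz =>
    obtain ⟨n, hn⟩ := hz
    exact ⟨n + 1, apply_mem_opFiltration v hn⟩

theorem magDerivation_mem_filtration (v : V) {n : ℕ} {x : TensorAlgebra k V}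
    (hx : x ∈ filtration k V n) : magDerivation mag v x ∈ filtration k V n := by
  refine map_mem_opFiltration (magDerivation mag v) ?_ ?_ n x hx
  · intro x hx
    obtain ⟨c, rfl⟩ := Submodule.mem_span_singleton.mp hx
    rw [map_smul, magDerivation_one, smul_zero]
    exact zero_mem _
  · intro n w y hy hDy
    rw [LinearMap.mulLeft_apply, magDerivation_mul, magDerivation_ι]
    exact add_mem (apply_mem_opFiltration w hDy) (apply_mem_opFiltration (mag v w) hy)

theorem toSubadjacent_bijective : Function.Bijective (toSubadjacent (k := k) mag) := by
  refine bijective_of_opFiltration exists_mem_filtration _ ?_ ?_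
  · intro x hx
    obtain ⟨c, rfl⟩ := Submodule.mem_span_singleton.mp hx
    rw [map_smul, toSubadjacent_one]
  · intro n v y hy hκ
    -- The defect is `D_v` applied to the image of `y`; since `D_v` does not raise the length, it
    -- stays in level `n`.
    rw [LinearMap.mulLeft_apply, LinearMap.mulLeft_apply, toSubadjacent_ι_mul, add_sub_cancel_left]
    exact magDerivation_mem_filtration mag v hκ

theorem counit_magDerivation (v : V) (x : TensorAlgebra k V) :
    Coalgebra.counit (R := k) (magDerivation mag v x) = 0 := by
  induction x using induction_left with
  | one => rw [magDerivation_one, map_zero]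
  | smul c z hz => simp [hz]
  | add y z hy hz => simp [hy, hz]
  | ι_mul w z hz => simp [magDerivation_mul, magDerivation_ι, counit_ι]

theorem counit_toSubadjacent (x : TensorAlgebra k V) :
    Coalgebra.counit (R := k) (toSubadjacent mag x) = Coalgebra.counit (R := k) x := by
  induction x using induction_left with
  | one => rw [toSubadjacent_one]
  | smul c z hz => simp [hz]
  | add y z hy hz => simp [hy, hz]
  | ι_mul w z hz => simp [toSubadjacent_ι_mul, counit_ι, counit_magDerivation]

/-- The operators `D_v ⊗ 1 + 1 ⊗ D_v`. -/
def diagonal {M N : Type*} [AddCommGroup M] [Module k M] [AddCommGroup N] [Module k N]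
    (a : V →ₗ[k] Module.End k M) (b : V →ₗ[k] Module.End k N) :
    V →ₗ[k] Module.End k (M ⊗[k] N) :=
  LinearMap.rTensorHom N ∘ₗ a + LinearMap.lTensorHom M ∘ₗ b

@[simp]
theorem diagonal_tmul {M N : Type*} [AddCommGroup M] [Module k M] [AddCommGroup N] [Module k N]
    (a : V →ₗ[k] Module.End k M) (b : V →ₗ[k] Module.End k N) (v : V) (x : M) (y : N) :
    diagonal a b v (x ⊗ₜ y) = a v x ⊗ₜ y + x ⊗ₜ b v y := rfl

/-- This is `equivariant` for the universal bilinear map: letting `V` act diagonally on a tensor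
product amounts to letting `T(V)` act through its coproduct. -/
theorem lift_diagonal_tmul {M N : Type*} [AddCommGroup M] [Module k M] [AddCommGroup N]
    [Module k N] (a : V →ₗ[k] Module.End k M) (b : V →ₗ[k] Module.End k N)
    (z : TensorAlgebra k V) (x : M) (y : N) :
    lift k (diagonal a b) z (x ⊗ₜ y) = TensorProduct.map ((lift k a).toLinearMap.flip x)
      ((lift k b).toLinearMap.flip y) (Coalgebra.comul (R := k) z) := by
  have h := equivariant (α := lift k a) (β := lift k b) (γ := lift k (diagonal a b))
    (TensorProduct.mk k M N) (by simp) z x y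
  rw [TensorProduct.lift_mk] at h
  exact h

/-- `D_v` sends the primitive generators to primitive elements, so this derivation is a coderivation
too. -/
theorem comul_magDerivation (v : V) (x : TensorAlgebra k V) :
    Coalgebra.comul (R := k) (magDerivation mag v x) =
      diagonal (magDerivation mag) (magDerivation mag) v (Coalgebra.comul (R := k) x) := by
  induction x using induction_left with
  | one => simp [magDerivation_one, Algebra.TensorProduct.one_def]
  | smul c z hz => simp [hz]
  | add y z hy hz => simp [hy, hz]
  | ι_mul w z hz =>
    rw [magDerivation_mul, map_add, comul_ι_mul, hz, magDerivation_ι, comul_ι_mul, comul_ι_mul]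
    generalize Coalgebra.comul (R := k) z = t
    induction t with
    | zero => simp
    | add s t hs ht =>
      rw [mul_add _ s t, map_add, mul_add, mul_add, map_add, ← hs, ← ht]
      abel
    | tmul a b =>
      simp [mul_add, add_mul, magDerivation_mul, magDerivation_ι, TensorProduct.tmul_add,
        TensorProduct.add_tmul]
      abel

theorem comul_derAction (z x : TensorAlgebra k V) :
    Coalgebra.comul (R := k) (derAction mag z x) =
      lift k (diagonal (magDerivation mag) (magDerivation mag)) z (Coalgebra.comul (R := k) x) :=
  intertwine _ (fun v x => by simp [comul_magDerivation]) z x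

/-- Both summands of `glOp mag v` are coderivations: `D_v`, and left multiplication by `v` because
`v` is primitive. -/
theorem comul_glOp (v : V) (x : TensorAlgebra k V) :
    Coalgebra.comul (R := k) (glOp mag v x) =
      diagonal (glOp mag) (glOp mag) v (Coalgebra.comul (R := k) x) := by
  rw [glOp_apply, map_add, comul_ι_mul, comul_magDerivation]
  generalize Coalgebra.comul (R := k) x = t
  induction t with
  | zero => simp
  | add s t hs ht =>
    rw [mul_add, map_add, map_add, ← hs, ← ht]
    abel
  | tmul a b =>
    simp [add_mul, glOp_apply, TensorProduct.tmul_add, TensorProduct.add_tmul]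
    abel

/-- The orbit map of the group-like element `1` under an action whose generators are coderivations
is a coalgebra map. -/
theorem comul_toSubadjacent (x : TensorAlgebra k V) :
    Coalgebra.comul (R := k) (toSubadjacent mag x) =
      TensorProduct.map (toSubadjacent mag) (toSubadjacent mag) (Coalgebra.comul (R := k) x) := by
  rw [toSubadjacent_apply, intertwine (α := glAction mag)
    (γ := lift k (diagonal (glOp mag) (glOp mag))) (Coalgebra.comul (R := k))
    (fun v x => by simp [glAction, comul_glOp]), Bialgebra.comul_one,
    Algebra.TensorProduct.one_def, lift_diagonal_tmul]
  rfl

/-- The inverse of Gavrilov's `K`-map. -/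
def subadjacentEquiv : TensorAlgebra k V ≃ₗc[k] TensorAlgebra k V :=
  { LinearEquiv.ofBijective (toSubadjacent mag) (toSubadjacent_bijective mag) with
    counit_comp := LinearMap.ext (counit_toSubadjacent mag)
    map_comp_comul := LinearMap.ext fun x => (comul_toSubadjacent mag x).symm }

theorem subadjacentEquiv_apply (x : TensorAlgebra k V) :
    subadjacentEquiv mag x = toSubadjacent mag x := rfl

/-- Gavrilov's `K`-map. -/
def kMap : TensorAlgebra k V ≃ₗc[k] TensorAlgebra k V := (subadjacentEquiv mag).symm

theorem kMap_toSubadjacent (x : TensorAlgebra k V) : kMap mag (toSubadjacent mag x) = x :=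
  (subadjacentEquiv mag).symm_apply_apply x

theorem toSubadjacent_kMap (x : TensorAlgebra k V) : toSubadjacent mag (kMap mag x) = x :=
  (subadjacentEquiv mag).apply_symm_apply x

theorem kMap_ι (v : V) : kMap mag (ι k v) = ι k v := by
  conv_lhs => rw [← toSubadjacent_ι mag v, kMap_toSubadjacent]

theorem kMap_one : kMap (k := k) mag 1 = 1 := by
  conv_lhs => rw [← toSubadjacent_one mag, kMap_toSubadjacent]

/-- `K` turns `glAction` into left multiplication. Its multiplicativity for the Grossman-Larson
product rests on this. -/
theorem kMap_glAction (z x : TensorAlgebra k V) :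
    kMap mag (glAction mag z x) = z * kMap mag x := by
  conv_lhs => rw [← toSubadjacent_kMap mag x, ← toSubadjacent_mul, kMap_toSubadjacent]

/-- Gavrilov's `K`-map as a linear map. -/
def kLin : TensorAlgebra k V →ₗ[k] TensorAlgebra k V := (kMap mag : _ →ₗ[k] _)

@[simp]
theorem kLin_apply (x : TensorAlgebra k V) : kLin mag x = kMap mag x := rfl

theorem comul_kMap (x : TensorAlgebra k V) : Coalgebra.comul (R := k) (kMap mag x) =
    TensorProduct.map (kLin mag) (kLin mag) (Coalgebra.comul (R := k) x) :=
  (CoalgHomClass.map_comp_comul_apply (kMap mag) x).symm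

theorem counit_kMap (x : TensorAlgebra k V) :
    Coalgebra.counit (R := k) (kMap mag x) = Coalgebra.counit (R := k) x :=
  CoalgHomClass.counit_comp_apply (kMap mag) x

end PostHopf

end TensorAlgebra

/-! ## General facts on post-Hopf algebras -/

namespace Coalgebra.Repr

variable {R A M N P : Type*} [CommRing R] [AddCommGroup A] [Module R A] [Coalgebra R A]
  [AddCommGroup M] [Module R M] [AddCommGroup N] [Module R N] [AddCommGroup P] [Module R P]

/-- Exchanges a Sweedler sum over a chosen representation for a linear map evaluated at `Δ x`, which
can be treated by linearity and induction. -/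
theorem lift_map_comul {x : A} {ι : Type*} (r : Coalgebra.Repr R x ι) (m : M →ₗ[R] N →ₗ[R] P)
    (f : A →ₗ[R] M) (g : A →ₗ[R] N) :
    TensorProduct.lift m (_root_.TensorProduct.map f g (Coalgebra.comul (R := R) x)) =
      ∑ i ∈ r.index, m (f (r.left i)) (g (r.right i)) := by
  simp [← r.eq]

theorem map_comul {x : A} {ι : Type*} (r : Coalgebra.Repr R x ι) (f : A →ₗ[R] M)
    (g : A →ₗ[R] N) :
    _root_.TensorProduct.map f g (Coalgebra.comul (R := R) x) =
      ∑ i ∈ r.index, f (r.left i) ⊗ₜ[R] g (r.right i) := by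
  simp [← r.eq]

end Coalgebra.Repr

namespace PostHopf

variable {k H : Type*} [CommRing k] [Ring H] [HopfAlgebra k H] (Q : PostHopf k H)

theorem tri_mul_eq (x y z : H) : Q.tri x (y * z) = LinearMap.mul' k H
    (TensorProduct.map (Q.tri.flip y) (Q.tri.flip z) (Coalgebra.comul (R := k) x)) := by
  rw [Q.tri_mul x y z (.arbitrary k x)]
  conv_rhs => rw [← (Coalgebra.Repr.arbitrary k x).eq]
  simp

theorem gl_tri (x y z : H) : Q.tri x (Q.tri y z) = Q.tri (Q.gl x y) z := by
  rw [Q.tri_tri x y z (.arbitrary k x), gl, grossmanLarson_eq_sum _ _ _ (.arbitrary k x)]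

/-- The convolution inverse makes `1 ▷ ·` surjective. It is also multiplicative, so `1 ▷ 1 = 1`.
Then `1 ▷ (1 ▷ w) = (1 (1 ▷ 1)) ▷ w = 1 ▷ w`, and every `z` has the form `1 ▷ w`. -/
theorem one_tri (z : H) : Q.tri 1 z = z := by
  have hs : ∀ y, ∃ w, Q.tri 1 w = y := by
    intro y
    let r : Coalgebra.Repr k (1 : H) PUnit :=
      { index := {PUnit.unit}
        left := fun _ => 1
        right := fun _ => 1
        eq := by simp [Algebra.TensorProduct.one_def] }
    exact ⟨_, by simpa [r] using Q.tri_beta 1 y r⟩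
  have hm : ∀ y z, Q.tri 1 (y * z) = Q.tri 1 y * Q.tri 1 z := by
    intro y z
    simp [tri_mul_eq, Algebra.TensorProduct.one_def]
  have h1 : Q.tri 1 1 = 1 := by
    obtain ⟨w, hw⟩ := hs 1
    have := hm 1 w
    rw [one_mul, hw, mul_one] at this
    exact this.symm
  obtain ⟨w, hw⟩ := hs z
  have := Q.gl_tri 1 1 w
  rw [hw] at this
  rw [this, gl, grossmanLarson]
  simp [Algebra.TensorProduct.one_def, h1, hw]

variable {x : H} (hx : Coalgebra.comul (R := k) x = x ⊗ₜ 1 + 1 ⊗ₜ x)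
include hx

theorem tri_mul_of_primitive (y z : H) :
    Q.tri x (y * z) = y * Q.tri x z + Q.tri x y * z := by
  rw [tri_mul_eq, hx]
  simp [one_tri, add_comm]

/-- For primitive `x` the Grossman-Larson product is `x * y = x y + x ▷ y`. -/
theorem mul_tri_of_primitive (y z : H) :
    Q.tri (x * y) z = Q.tri x (Q.tri y z) - Q.tri (Q.tri x y) z := by
  rw [gl_tri, gl, grossmanLarson]
  simp [hx, one_tri]

end PostHopf

/-! ### Sweedler identities, uniqueness, sub-adjacent antipode and module action for `T(V)`. -/

namespace TensorAlgebra

variable {k : Type*} [CommRing k] {V : Type*} [AddCommGroup V] [Module k V]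
  (mag : V →ₗ[k] V →ₗ[k] V)

/-- As `K` is a coalgebra map, the components of `Δ K(z)` are `K` of those of `Δ z`. Any Leibniz
rule for `V` thereby becomes a Sweedler identity for operators of the form `K(z)`. -/
theorem equivariant_kMap {M N P : Type*} [AddCommGroup M] [Module k M] [AddCommGroup N]
    [Module k N] [AddCommGroup P] [Module k P] {α : TensorAlgebra k V →ₐ[k] Module.End k M}
    {β : TensorAlgebra k V →ₐ[k] Module.End k N} {γ : TensorAlgebra k V →ₐ[k] Module.End k P}
    (m : M →ₗ[k] N →ₗ[k] P)
    (h : ∀ v x y, γ (ι k v) (m x y) = m (α (ι k v) x) y + m x (β (ι k v) y))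
    (z : TensorAlgebra k V) (x : M) (y : N) :
    γ (kMap mag z) (m x y) = TensorProduct.lift m
      (TensorProduct.map (α.toLinearMap.flip x ∘ₗ kLin mag)
      (β.toLinearMap.flip y ∘ₗ kLin mag) (Coalgebra.comul (R := k) z)) := by
  rw [equivariant m h, comul_kMap, TensorProduct.map_comp]
  rfl

/-- The post-Hopf product of `T(V)` that extends `mag`. -/
def postHopfTri : TensorAlgebra k V →ₗ[k] TensorAlgebra k V →ₗ[k] TensorAlgebra k V :=
  (derAction mag).toLinearMap ∘ₗ kLin mag

theorem postHopfTri_apply (x y : TensorAlgebra k V) :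
    postHopfTri mag x y = derAction mag (kMap mag x) y := rfl

/-- The Leibniz rule `v·(xy) = (v·x) y + x D_v(y)`, in which `·` is `glAction`, extends to `K(x)`
acting on `1 y`. The first components become `K(x₁)·1 = x₁`, which leaves `∑ x₁ (x₂ ▷ y)`. -/
theorem grossmanLarson_postHopfTri (x y : TensorAlgebra k V) :
    grossmanLarson (postHopfTri mag) x y = glAction mag (kMap mag x) y := by
  have h := equivariant_kMap mag (α := glAction mag) (β := derAction mag) (γ := glAction mag)
    (LinearMap.mul k _) (fun v x y => by
      simp only [LinearMap.mul_apply', glAction_ι, magDerivation_mul, derAction_ι, add_mul,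
        mul_assoc]
      abel) x 1 y
  have h2 : (glAction mag).toLinearMap.flip 1 ∘ₗ kLin mag = LinearMap.id :=
    LinearMap.ext (toSubadjacent_kMap mag)
  rw [h2, LinearMap.mul_apply', one_mul] at h
  rw [h]
  rfl

/-- The convolution inverse of the post-Hopf product. -/
def postHopfBeta : TensorAlgebra k V →ₗ[k] TensorAlgebra k V →ₗ[k] TensorAlgebra k V :=
  (derAction mag).toLinearMap ∘ₗ HopfAlgebra.antipode k ∘ₗ kLin mag

theorem postHopfBeta_apply (x y : TensorAlgebra k V) :
    postHopfBeta mag x y = derAction mag (HopfAlgebra.antipode k (kMap mag x)) y := rfl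

theorem counit_derAction (z x : TensorAlgebra k V) :
    Coalgebra.counit (R := k) (derAction mag z x) =
      Coalgebra.counit (R := k) z * Coalgebra.counit (R := k) x := by
  induction z using induction_left generalizing x with
  | one => simp
  | smul c z hz => simp [hz, mul_assoc]
  | add y z hy hz => simp [hy, hz, add_mul]
  | ι_mul v z hz => simp [counit_magDerivation, counit_ι]

theorem sum_kMap_mul_antipode {x : TensorAlgebra k V} {ι : Type*} (r : Coalgebra.Repr k x ι) :
    ∑ i ∈ r.index, kMap mag (r.left i) * HopfAlgebra.antipode k (kMap mag (r.right i)) =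
      algebraMap k _ (Coalgebra.counit x) := by
  rw [← counit_kMap mag, ← HopfAlgebra.mul_antipode_lTensor_comul_apply, comul_kMap, ← r.eq]
  simp

theorem sum_antipode_kMap_mul {x : TensorAlgebra k V} {ι : Type*} (r : Coalgebra.Repr k x ι) :
    ∑ i ∈ r.index, HopfAlgebra.antipode k (kMap mag (r.left i)) * kMap mag (r.right i) =
      algebraMap k _ (Coalgebra.counit x) := by
  rw [← counit_kMap mag, ← HopfAlgebra.mul_antipode_rTensor_comul_apply, comul_kMap, ← r.eq]
  simp

/-- The post-Hopf algebra `T(V)` generated by the magma algebra `(V, mag)`. -/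
def postHopf : PostHopf k (TensorAlgebra k V) where
  tri := postHopfTri mag
  beta := postHopfBeta mag
  comul_tri x y ι κ r s := by
    rw [postHopfTri_apply, comul_derAction, ← s.eq, map_sum, Finset.sum_comm]
    refine Finset.sum_congr rfl fun j _ => ?_
    rw [lift_diagonal_tmul, comul_kMap, ← r.eq]
    simp [postHopfTri_apply]
    rfl
  counit_tri x y := by rw [postHopfTri_apply, counit_derAction, counit_kMap]
  tri_mul x y z ι r := by
    have h := equivariant_kMap mag (α := derAction mag) (β := derAction mag) (γ := derAction mag)
      (LinearMap.mul k _) (fun v x y => by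
        simp only [LinearMap.mul_apply', magDerivation_mul, derAction_ι, add_comm]) x y z
    rw [r.lift_map_comul] at h
    exact h
  tri_tri x y z ι r := by
    -- Both sides are the action of `K(x) K(y)` on `z`.
    rw [← grossmanLarson_eq_sum, grossmanLarson_postHopfTri, postHopfTri_apply, postHopfTri_apply,
      postHopfTri_apply, kMap_glAction, map_mul, Module.End.mul_apply]
  tri_beta x y ι r := by
    -- The algebra map `derAction` carries the antipode identity at `K(x)` to convolution
    -- invertibility.
    have h := congr(derAction mag $(sum_kMap_mul_antipode mag r) y)
    rw [map_sum, LinearMap.sum_apply] at h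
    simpa [postHopfTri_apply, postHopfBeta_apply] using h
  beta_tri x y ι r := by
    have h := congr(derAction mag $(sum_antipode_kMap_mul mag r) y)
    rw [map_sum, LinearMap.sum_apply] at h
    simpa [postHopfTri_apply, postHopfBeta_apply] using h

theorem postHopf_tri (x y : TensorAlgebra k V) :
    (postHopf mag).tri x y = derAction mag (kMap mag x) y := rfl

theorem postHopf_tri_ι (v : V) (y : TensorAlgebra k V) :
    (postHopf mag).tri (ι k v) y = magDerivation mag v y := by
  rw [postHopf_tri, kMap_ι, derAction_ι]

theorem postHopf_tri_ι_ι (v w : V) : (postHopf mag).tri (ι k v) (ι k w) = ι k (mag v w) := by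
  rw [postHopf_tri_ι, magDerivation_ι]

theorem postHopf_gl (x y : TensorAlgebra k V) :
    (postHopf mag).gl x y = glAction mag (kMap mag x) y :=
  grossmanLarson_postHopfTri mag x y

theorem kMap_gl (x y : TensorAlgebra k V) :
    kMap mag ((postHopf mag).gl x y) = kMap mag x * kMap mag y := by
  rw [postHopf_gl, kMap_glAction]

/-- Primitivity forces `v ▷ ·` to be the derivation extending `mag v`. Then `(v y) ▷ z = v ▷ (y ▷ z)
- (v ▷ y) ▷ z` determines the product by induction on length, since `v ▷ y` is no longer than `y`.
-/
theorem postHopf_unique (Q' : PostHopf k (TensorAlgebra k V))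
    (h : ∀ v w, Q'.tri (ι k v) (ι k w) = ι k (mag v w)) : Q'.tri = (postHopf mag).tri := by
  have hι : ∀ v, Q'.tri (ι k v) = magDerivation mag v := by
    intro v
    apply derivation_ext (Q'.tri_mul_of_primitive (comul_ι k v)) (magDerivation_mul mag v)
    intro w
    rw [h, magDerivation_ι]
  let C : Submodule k (TensorAlgebra k V) := LinearMap.eqLocus Q'.tri (postHopf mag).tri
  ext1 x
  change x ∈ C
  refine mem_of_opFiltration exists_mem_filtration C ?_ ?_ x
  · rw [Submodule.span_singleton_le_iff_mem]
    change Q'.tri 1 = (postHopf mag).tri 1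
    ext1 y
    rw [PostHopf.one_tri, PostHopf.one_tri]
  · intro n hn v y hy
    change Q'.tri (ι k v * y) = (postHopf mag).tri (ι k v * y)
    ext1 z
    have h1 : Q'.tri y = (postHopf mag).tri y := hn hy
    have h2 : Q'.tri (magDerivation mag v y) = (postHopf mag).tri (magDerivation mag v y) :=
      hn (magDerivation_mem_filtration mag v hy)
    rw [PostHopf.mul_tri_of_primitive _ (comul_ι k v), PostHopf.mul_tri_of_primitive _ (comul_ι k v),
      hι, h1, h2, postHopf_tri_ι, postHopf_tri_ι]

theorem magDerivation_antipode (v : V) (x : TensorAlgebra k V) :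
    magDerivation mag v (HopfAlgebra.antipode k x) =
      HopfAlgebra.antipode k (magDerivation mag v x) := by
  induction x using induction_left with
  | one => simp [magDerivation_one]
  | smul c z hz => simp [hz]
  | add y z hy hz => simp [hy, hz]
  | ι_mul w z hz =>
    rw [antipode_ι_mul, map_neg, magDerivation_mul, magDerivation_mul, map_add, magDerivation_ι,
      antipode_ι_mul, antipode_ι_mul, hz, neg_add, add_comm]

/-- The extra factor `w` is there for the induction: `S(vz) = -S(z) v`, so removing `v` from `z`
replaces `w` by the image of `w` under `glOp mag v`. Only `w = 1` is used later. -/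
theorem lift_derAction_antipode (z w : TensorAlgebra k V) :
    TensorProduct.lift ((derAction mag).toLinearMap ∘ₗ HopfAlgebra.antipode k)
      (TensorProduct.map LinearMap.id (LinearMap.mulRight k w ∘ₗ HopfAlgebra.antipode k ∘ₗ
        toSubadjacent mag) (Coalgebra.comul (R := k) z)) =
      glAction mag (HopfAlgebra.antipode k z) w := by
  induction z using induction_left generalizing w with
  | one => simp [Algebra.TensorProduct.one_def, toSubadjacent_one]
  | smul c z hz => simp [hz]
  | add y z hy hz => simp [hy, hz]
  | ι_mul v z hz =>
    rw [antipode_ι_mul, map_neg, map_mul (glAction mag), LinearMap.neg_apply, Module.End.mul_apply, ← hz,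
      comul_ι_mul]
    generalize Coalgebra.comul (R := k) z = t
    induction t with
    | zero => simp
    | add s t hs ht => rw [mul_add, map_add, map_add, map_add, map_add, hs, ht, neg_add]
    | tmul a b =>
      simp [add_mul, toSubadjacent_ι_mul, antipode_mul, antipode_ι, glAction_ι,
        magDerivation_mul, magDerivation_antipode, mul_add, mul_assoc]
      abel

/-- The sub-adjacent antipode is the coshuffle antipode carried over by `K`. -/
theorem glAntipode_toSubadjacent (z : TensorAlgebra k V) :
    (postHopf mag).glAntipode (toSubadjacent mag z) =
      toSubadjacent mag (HopfAlgebra.antipode k z) := by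
  rw [toSubadjacent_apply mag (HopfAlgebra.antipode k z), ← lift_derAction_antipode]
  simp only [PostHopf.glAntipode, LinearMap.comp_apply, comul_toSubadjacent]
  generalize Coalgebra.comul (R := k) z = t
  induction t with
  | zero => simp
  | add s t hs ht => simp only [map_add, hs, ht]
  | tmul a b =>
    simp only [TensorProduct.map_tmul, LinearMap.lTensor_tmul, TensorProduct.lift.tmul,
      LinearMap.comp_apply, LinearMap.mulRight_apply, mul_one, LinearMap.id_apply]
    change derAction mag (HopfAlgebra.antipode k (kMap mag (toSubadjacent mag a))) _ = _
    rw [kMap_toSubadjacent]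
    rfl

/-! ## The action on `R` -/

section Action

variable {R : Type*} [CommRing R] [Algebra k R] (fV : V →ₗ[k] Derivation k R R)

/-- The action of `T(V)` on `R` that extends `fV`. -/
def baseAction : TensorAlgebra k V →ₐ[k] Module.End k R := lift k (derToEnd k R ∘ₗ fV)

@[simp]
theorem baseAction_ι (v : V) (f : R) : baseAction fV (ι k v) f = fV v f := by
  simp [baseAction, derToEnd]

theorem baseAction_apply_one (z : TensorAlgebra k V) :
    baseAction fV z 1 = algebraMap k R (Coalgebra.counit z) := by
  induction z using induction_left with
  | one => simp
  | smul c z hz => simp [hz, Algebra.smul_def]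
  | add y z hy hz => simp [hy, hz]
  | ι_mul v z hz => simp [hz, counit_ι]

/-- The action of the sub-adjacent Hopf algebra of `T(V)` on `R`. -/
def subadjacentAction : TensorAlgebra k V →ₗ[k] R →ₗ[k] R :=
  (baseAction fV).toLinearMap ∘ₗ kLin mag

theorem subadjacentAction_apply (x : TensorAlgebra k V) :
    subadjacentAction mag fV x = baseAction fV (kMap mag x) := rfl

theorem subadjacentAction_ι_mul (v : V) (x : TensorAlgebra k V) (f : R) :
    subadjacentAction mag fV (ι k v * x) f =
      subadjacentAction mag fV (ι k v) (subadjacentAction mag fV x f) -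
        subadjacentAction mag fV ((postHopf mag).tri (ι k v) x) f := by
  -- Gavrilov's recursion for `K`, from `K(v x + D_v x) = v K(x)`.
  have h : kMap mag (ι k v * x) = ι k v * kMap mag x - kMap mag (magDerivation mag v x) := by
    rw [eq_sub_iff_add_eq, ← map_add, ← glAction_ι, kMap_glAction]
  rw [subadjacentAction_apply, h, postHopf_tri_ι, map_sub, map_mul, subadjacentAction_apply,
    subadjacentAction_apply, subadjacentAction_apply, kMap_ι]
  rfl

theorem isModuleAlgebra {k : Type u} [CommRing k] {V : Type w} [AddCommGroup V] [Module k V]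
    (mag : V →ₗ[k] V →ₗ[k] V) {R : Type v} [CommRing R] [Algebra k R]
    (fV : V →ₗ[k] Derivation k R R) :
    (postHopf mag).IsModuleAlgebra (subadjacentAction mag fV) where
  gl_act x y f := by
    rw [subadjacentAction_apply, kMap_gl, map_mul]
    rfl
  one_act f := by rw [subadjacentAction_apply, kMap_one, map_one, Module.End.one_apply]
  act_mul x f g ι r := by
    have h := equivariant_kMap mag (α := baseAction fV) (β := baseAction fV) (γ := baseAction fV)
      (LinearMap.mul k _) (fun v x y => by simp [mul_comm, add_comm]) x f g
    rw [r.lift_map_comul] at h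
    exact h
  act_one x := by rw [subadjacentAction_apply, baseAction_apply_one, counit_kMap]

end Action

end TensorAlgebra

namespace TensorAlgebra

/-! ## The action post-Hopf algebroid `R ⊗ T(V)` -/

section BaseExtension

variable {k : Type*} [CommRing k] {V : Type*} [AddCommGroup V] [Module k V]
  (mag : V →ₗ[k] V →ₗ[k] V) {R : Type*} [CommRing R] [Algebra k R]
  (fV : V →ₗ[k] Derivation k R R)

/-- The operators `f ⊗ x ↦ v(f) ⊗ x + f ⊗ b v x` on `R ⊗ T(V)`. -/
def baseDiagonal (b : V →ₗ[k] Module.End k (TensorAlgebra k V)) :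
    V →ₗ[k] Module.End k (R ⊗[k] TensorAlgebra k V) :=
  diagonal (derToEnd k R ∘ₗ fV) b

variable (b : V →ₗ[k] Module.End k (TensorAlgebra k V))

@[simp]
theorem baseDiagonal_tmul (v : V) (f : R) (x : TensorAlgebra k V) :
    baseDiagonal fV b v (f ⊗ₜ x) = fV v f ⊗ₜ x + f ⊗ₜ b v x := rfl

theorem baseDiagonal_smul (v : V) (f : R) (x : R ⊗[k] TensorAlgebra k V) :
    baseDiagonal fV b v (f • x) = fV v f • x + f • baseDiagonal fV b v x := by
  induction x with
  | zero => simp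
  | add x y hx hy => rw [smul_add, map_add, map_add, hx, hy, smul_add, smul_add]; abel
  | tmul g x =>
    simp only [TensorProduct.smul_tmul', baseDiagonal_tmul, smul_eq_mul, Derivation.leibniz,
      smul_add, TensorProduct.add_tmul, mul_comm g]
    abel

/-- The action of `T(V)` on `R ⊗ T(V)` that extends `baseDiagonal`. -/
def baseExt : TensorAlgebra k V →ₐ[k] Module.End k (R ⊗[k] TensorAlgebra k V) :=
  lift k (baseDiagonal fV b)

@[simp]
theorem baseExt_ι (v : V) : baseExt fV b (ι k v) = baseDiagonal fV b v := lift_ι_apply _ v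

theorem baseExt_tmul (z : TensorAlgebra k V) (f : R) (x : TensorAlgebra k V) :
    baseExt fV b z (f ⊗ₜ x) = TensorProduct.map ((baseAction fV).toLinearMap.flip f)
      ((lift k b).toLinearMap.flip x) (Coalgebra.comul (R := k) z) :=
  lift_diagonal_tmul _ _ z f x

/-- The product `(f ⊗ a, y) ↦ f • K(a) y` on `R ⊗ T(V)`. -/
def baseOp : R ⊗[k] TensorAlgebra k V →ₗ[R] R ⊗[k] TensorAlgebra k V →ₗ[k]
    R ⊗[k] TensorAlgebra k V :=
  LinearMap.liftBaseChange R
    (((baseExt fV b).toLinearMap ∘ₗ kLin mag : TensorAlgebra k V →ₗ[k]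
      R ⊗[k] TensorAlgebra k V →ₗ[k] R ⊗[k] TensorAlgebra k V))

@[simp]
theorem baseOp_tmul (f : R) (a : TensorAlgebra k V) (y : R ⊗[k] TensorAlgebra k V) :
    baseOp mag fV b (f ⊗ₜ a) y = f • baseExt fV b (kMap mag a) y := by
  rw [baseOp, LinearMap.liftBaseChange_tmul]
  rfl

/-- For `z = v` and `x = f ⊗ a`, the Leibniz rule gives `v(f) K(a) y + f v K(a) y`, and `v K(a)` is
`K` of `glOp mag v a`. The operators `b` are arbitrary: `b = magDerivation mag` serves for `▷` and
`b = glOp mag` for the Grossman-Larson product. -/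
theorem baseExt_baseOp (z : TensorAlgebra k V) (x y : R ⊗[k] TensorAlgebra k V) :
    baseExt fV b z (baseOp mag fV b x y) =
      baseOp mag fV b (baseExt fV (glOp mag) z x) y := by
  symm
  apply intertwine (α := baseExt fV (glOp mag)) (γ := baseExt fV b)
    (((baseOp mag fV b).restrictScalars k).flip y)
  intro v x
  change baseOp mag fV b (baseExt fV (glOp mag) (ι k v) x) y =
    baseExt fV b (ι k v) (baseOp mag fV b x y)
  rw [baseExt_ι, baseExt_ι]
  induction x with
  | zero => simp
  | add x x' hx hx' => simp only [map_add, LinearMap.add_apply, hx, hx']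
  | tmul f a =>
    have h : kMap mag (glOp mag v a) = ι k v * kMap mag a := by
      rw [glOp_apply, ← glAction_ι, kMap_glAction]
    rw [baseDiagonal_tmul, map_add, LinearMap.add_apply, baseOp_tmul, baseOp_tmul, baseOp_tmul,
      baseDiagonal_smul, h, map_mul, baseExt_ι, Module.End.mul_apply]

theorem baseDiagonal_magDerivation_mul (v : V) (x y : R ⊗[k] TensorAlgebra k V) :
    baseDiagonal fV (magDerivation mag) v (x * y) =
      baseDiagonal fV (magDerivation mag) v x * y +
        x * baseDiagonal fV (magDerivation mag) v y := by
  induction x with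
  | zero => simp
  | add x x' hx hx' => rw [add_mul, map_add, map_add, hx, hx', add_mul, add_mul]; abel
  | tmul f a =>
    induction y with
    | zero => simp
    | add y y' hy hy' => rw [mul_add, map_add, map_add, hy, hy', mul_add, mul_add]; abel
    | tmul g c =>
      simp only [Algebra.TensorProduct.tmul_mul_tmul, baseDiagonal_tmul, Derivation.leibniz,
        magDerivation_mul, add_mul, mul_add, TensorProduct.tmul_add, TensorProduct.add_tmul,
        smul_eq_mul, mul_comm g]
      abel

theorem baseDiagonal_glOp_mul (v : V) (a : TensorAlgebra k V) (y : R ⊗[k] TensorAlgebra k V) :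
    baseDiagonal fV (glOp mag) v ((1 ⊗ₜ a) * y) =
      (1 ⊗ₜ glOp mag v a) * y + (1 ⊗ₜ a) * baseDiagonal fV (magDerivation mag) v y := by
  induction y with
  | zero => simp
  | add y y' hy hy' => rw [mul_add, map_add, map_add, hy, hy', mul_add, mul_add]; abel
  | tmul g c =>
    simp only [Algebra.TensorProduct.tmul_mul_tmul, baseDiagonal_tmul, glOp_apply, one_mul,
      magDerivation_mul, add_mul, mul_add, TensorProduct.tmul_add, mul_assoc]
    abel

/-! ### The coalgebra structure of `R ⊗ T(V)` -/

theorem comul_base_tmul {ι : Type*} (f : R) {a : TensorAlgebra k V} (r : Coalgebra.Repr k a ι) :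
    Coalgebra.comul (R := R) (f ⊗ₜ[k] a) =
      ∑ i ∈ r.index, (f ⊗ₜ[k] r.left i) ⊗ₜ[R] (1 ⊗ₜ[k] r.right i) := by
  have h : Coalgebra.comul (R := R) f = f ⊗ₜ[R] (1 : R) := by
    rw [CommSemiring.comul_apply]
    simpa using (TensorProduct.smul_tmul (R := R) f (1 : R) (1 : R)).symm
  rw [TensorProduct.comul_tmul, ← r.eq, TensorProduct.tmul_sum, map_sum, h]
  rfl

variable (k V R) in
/-- `(R ⊗ T(V)) ⊗[R] (R ⊗ T(V))` is `(R ⊗ T(V)) ⊗[k] T(V)`. -/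
def cancelBase : (R ⊗[k] TensorAlgebra k V) ⊗[R] (R ⊗[k] TensorAlgebra k V) ≃ₗ[R]
    (R ⊗[k] TensorAlgebra k V) ⊗[k] TensorAlgebra k V :=
  TensorProduct.AlgebraTensorModule.cancelBaseChange k R R (R ⊗[k] TensorAlgebra k V)
    (TensorAlgebra k V)

@[simp]
theorem cancelBase_tmul (x : R ⊗[k] TensorAlgebra k V) (g : R) (a : TensorAlgebra k V) :
    cancelBase k V R (x ⊗ₜ[R] (g ⊗ₜ[k] a)) = (g • x) ⊗ₜ[k] a := rfl

variable (k V R) in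
/-- The comultiplication with values in `(R ⊗ T(V)) ⊗[k] T(V)`. -/
def baseComul : R ⊗[k] TensorAlgebra k V →ₗ[k] (R ⊗[k] TensorAlgebra k V) ⊗[k] TensorAlgebra k V :=
  ((cancelBase k V R).toLinearMap ∘ₗ Coalgebra.comul (R := R)).restrictScalars k

theorem baseComul_apply (x : R ⊗[k] TensorAlgebra k V) :
    baseComul k V R x = cancelBase k V R (Coalgebra.comul (R := R) x) := rfl

theorem baseComul_tmul (f : R) (a : TensorAlgebra k V) : baseComul k V R (f ⊗ₜ a) =
    (TensorProduct.mk k R (TensorAlgebra k V) f).rTensor _ (Coalgebra.comul (R := k) a) := by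
  rw [baseComul_apply, comul_base_tmul f (.arbitrary k a), map_sum]
  conv_rhs => rw [← (Coalgebra.Repr.arbitrary k a).eq]
  simp

/-- Over `⊗[R]` the two summands of a diagonal operator are not separately well defined, because `v`
differentiates scalars. After passage to `(R ⊗ T(V)) ⊗[k] T(V)` they are, and the compatibility can
be checked on generators. -/
theorem baseComul_baseExt (hb : ∀ v x, Coalgebra.comul (R := k) (b v x) =
      diagonal b b v (Coalgebra.comul (R := k) x))
    (z : TensorAlgebra k V) (x : R ⊗[k] TensorAlgebra k V) :
    baseComul k V R (baseExt fV b z x) =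
      lift k (diagonal (baseDiagonal fV b) b) z (baseComul k V R x) := by
  apply intertwine
  intro v x
  rw [baseExt_ι, lift_ι_apply]
  induction x with
  | zero => simp
  | add x x' hx hx' => simp only [map_add, hx, hx']
  | tmul f a =>
    rw [baseDiagonal_tmul, map_add, baseComul_tmul, baseComul_tmul, baseComul_tmul, hb]
    generalize Coalgebra.comul (R := k) a = t
    induction t with
    | zero => simp
    | add s t hs ht => simp only [map_add, ← hs, ← ht]; abel
    | tmul c d => simp [TensorProduct.add_tmul, add_assoc]

theorem counit_baseExt (hb : ∀ v x, Coalgebra.counit (R := k) (b v x) = 0)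
    (z : TensorAlgebra k V) (x : R ⊗[k] TensorAlgebra k V) :
    Coalgebra.counit (R := R) (baseExt fV b z x) =
      baseAction fV z (Coalgebra.counit (R := R) x) := by
  apply intertwine (α := baseExt fV b) (γ := baseAction fV)
    ((Coalgebra.counit (R := R) (A := R ⊗[k] TensorAlgebra k V)).restrictScalars k)
  intro v x
  rw [baseExt_ι, baseAction_ι]
  induction x with
  | zero => simp
  | add x x' hx hx' => simp only [map_add, hx, hx']
  | tmul f a => simp [hb]

end BaseExtension

end TensorAlgebra

/-! ### The weak post-Hopf algebroid axioms for `R ⊗ T(V)`. -/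

namespace TensorAlgebra

section Algebroid

variable {k : Type*} [CommRing k] {V : Type*} [AddCommGroup V] [Module k V]
  (mag : V →ₗ[k] V →ₗ[k] V) {R : Type*} [CommRing R] [Algebra k R]
  (fV : V →ₗ[k] Derivation k R R)

/-- The product of the action post-Hopf algebroid `R ⊗ T(V)`. -/
abbrev algebroidTri : R ⊗[k] TensorAlgebra k V →ₗ[R] R ⊗[k] TensorAlgebra k V →ₗ[k]
    R ⊗[k] TensorAlgebra k V :=
  baseOp mag fV (magDerivation mag)

theorem baseExt_magDerivation_tmul_one (z : TensorAlgebra k V) (f : R) :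
    baseExt fV (magDerivation mag) z (f ⊗ₜ 1) = baseAction fV z f ⊗ₜ 1 := by
  symm
  apply intertwine (α := baseAction fV) (γ := baseExt fV (magDerivation mag))
    ((TensorProduct.mk k R (TensorAlgebra k V)).flip 1)
  intro v f
  simp [magDerivation_one]

theorem baseExt_glOp_one (z : TensorAlgebra k V) :
    baseExt fV (glOp mag) z 1 = 1 ⊗ₜ toSubadjacent mag z := by
  induction z using induction_left with
  | one => simp [toSubadjacent_one, Algebra.TensorProduct.one_def]
  | smul c z hz => simp [hz]
  | add y z hy hz => simp [hy, hz, TensorProduct.tmul_add]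
  | ι_mul v z hz =>
    rw [map_mul, Module.End.mul_apply, hz, toSubadjacent_ι_mul, baseExt_ι, baseDiagonal_tmul,
      Derivation.map_one_eq_zero, TensorProduct.zero_tmul, zero_add, glOp_apply]

theorem sum_algebroidTri {P : Type*} [AddCommGroup P] [Module R P] [Module k P]
    [IsScalarTower k R P]
    (m : R ⊗[k] TensorAlgebra k V →ₗ[R] R ⊗[k] TensorAlgebra k V →ₗ[R] P) (f : R)
    (a : TensorAlgebra k V) {ι : Type*} (r : Coalgebra.Repr R (f ⊗ₜ[k] a) ι)
    (y z : R ⊗[k] TensorAlgebra k V) :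
    ∑ i ∈ r.index, m (algebroidTri mag fV (r.left i) y) (algebroidTri mag fV (r.right i) z) =
      f • TensorProduct.lift (m.restrictScalars₁₂ k k) (TensorProduct.map
        ((baseExt fV (magDerivation mag)).toLinearMap.flip y ∘ₗ kLin mag)
        ((baseExt fV (magDerivation mag)).toLinearMap.flip z ∘ₗ kLin mag)
        (Coalgebra.comul (R := k) a)) := by
  have h := r.lift_map_comul m ((algebroidTri mag fV).flip y) ((algebroidTri mag fV).flip z)
  simp only [LinearMap.flip_apply] at h
  rw [← h, comul_base_tmul f (.arbitrary k a), map_sum, map_sum,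
    (Coalgebra.Repr.arbitrary k a).lift_map_comul, Finset.smul_sum]
  simp

/-- The counterpart of `equivariant_kMap` over `R`. The coproduct of `f ⊗ a` can be written with
second components `1 ⊗ a₂`, so `f` factors out of the sum. -/
theorem equivariant_algebroidTri {P : Type*} [AddCommGroup P] [Module R P] [Module k P]
    [IsScalarTower k R P] {γ : TensorAlgebra k V →ₐ[k] Module.End k P}
    (m : R ⊗[k] TensorAlgebra k V →ₗ[R] R ⊗[k] TensorAlgebra k V →ₗ[R] P)
    (h : ∀ v x y, γ (ι k v) (m x y) = m (baseDiagonal fV (magDerivation mag) v x) y +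
      m x (baseDiagonal fV (magDerivation mag) v y))
    (f : R) (a : TensorAlgebra k V) {ι : Type*} (r : Coalgebra.Repr R (f ⊗ₜ[k] a) ι)
    (y z : R ⊗[k] TensorAlgebra k V) :
    ∑ i ∈ r.index, m (algebroidTri mag fV (r.left i) y) (algebroidTri mag fV (r.right i) z) =
      f • γ (kMap mag a) (m y z) := by
  have h2 := equivariant_kMap mag (α := baseExt fV (magDerivation mag))
    (β := baseExt fV (magDerivation mag)) (γ := γ) (m.restrictScalars₁₂ k k)
    (fun v x y => by simpa using h v x y) a y z
  rw [sum_algebroidTri, ← h2]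
  rfl

/-- As for `T(V)`: let `K(a)` act on `(1 ⊗ 1) y` by the mixed Leibniz rule `baseDiagonal_glOp_mul`,
and use `K(a₁)·1 = a₁`. -/
theorem grossmanLarson_algebroidTri (x y : R ⊗[k] TensorAlgebra k V) :
    grossmanLarson (algebroidTri mag fV) x y = baseOp mag fV (glOp mag) x y := by
  induction x with
  | zero => simp
  | add x x' hx hx' => simp only [map_add, LinearMap.add_apply, hx, hx']
  | tmul f a =>
    have h := equivariant_kMap mag (α := glAction mag) (β := baseExt fV (magDerivation mag))
      (γ := baseExt fV (glOp mag))
      (LinearMap.mul k (R ⊗[k] TensorAlgebra k V) ∘ₗ TensorProduct.mk k R (TensorAlgebra k V) 1)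
      (fun v x y => by simp [baseDiagonal_glOp_mul, glAction_ι, glOp_apply]) a 1 y
    have h2 : (glAction mag).toLinearMap.flip 1 ∘ₗ kLin mag = LinearMap.id :=
      LinearMap.ext (toSubadjacent_kMap mag)
    rw [h2] at h
    have h3 : ((1 : R) ⊗ₜ[k] (1 : TensorAlgebra k V)) * y = y := one_mul y
    simp only [LinearMap.comp_apply, TensorProduct.mk_apply, LinearMap.mul_apply', h3] at h
    rw [baseOp_tmul, h, (Coalgebra.Repr.arbitrary k a).lift_map_comul, grossmanLarson,
      LinearMap.mk₂_apply, comul_base_tmul f (.arbitrary k a), map_sum, map_sum, Finset.smul_sum]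
    refine Finset.sum_congr rfl fun i _ => ?_
    rw [LinearMap.lTensor_tmul, LinearMap.mul'_apply, LinearMap.flip_apply, baseOp_tmul, one_smul]
    simp only [LinearMap.comp_apply, LinearMap.id_apply, TensorProduct.mk_apply,
      LinearMap.mul_apply', kLin_apply, LinearMap.flip_apply]
    rw [← smul_mul_assoc, TensorProduct.smul_tmul', smul_eq_mul, mul_one]
    rfl

theorem cancelBase_diagonal (v : V) (x y : R ⊗[k] TensorAlgebra k V) :
    diagonal (baseDiagonal fV (magDerivation mag)) (magDerivation mag) v
        (cancelBase k V R (x ⊗ₜ[R] y)) =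
      cancelBase k V R (baseDiagonal fV (magDerivation mag) v x ⊗ₜ[R] y) +
        cancelBase k V R (x ⊗ₜ[R] baseDiagonal fV (magDerivation mag) v y) := by
  induction y with
  | zero => simp
  | add y y' hy hy' => simp only [TensorProduct.tmul_add, map_add, hy, hy']; abel
  | tmul g c =>
    simp only [cancelBase_tmul, diagonal_tmul, baseDiagonal_smul, baseDiagonal_tmul,
      TensorProduct.tmul_add, map_add, TensorProduct.add_tmul]
    abel

/-- The weak post-Hopf algebroid `R ⊗ T(V)`. -/
def weakAlgebroid : WeakPostHopfAlgebroid k R (R ⊗[k] TensorAlgebra k V) where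
  tri := algebroidTri mag fV
  comul_tri x y ι κ r s := by
    -- The given representation is tied to `x`. Once the sum is a linear map at `Δ x`, it can be
    -- discarded and `x` reduced to a pure tensor.
    have hlin : ∀ (y₁ y₂ : R ⊗[k] TensorAlgebra k V),
        ∑ i ∈ r.index, algebroidTri mag fV (r.left i) y₁ ⊗ₜ[R]
          algebroidTri mag fV (r.right i) y₂ =
        TensorProduct.map ((algebroidTri mag fV).flip y₁) ((algebroidTri mag fV).flip y₂)
          (Coalgebra.comul (R := R) x) := fun y₁ y₂ =>
      (r.map_comul ((algebroidTri mag fV).flip y₁) ((algebroidTri mag fV).flip y₂)).symm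
    rw [Finset.sum_comm]
    simp only [hlin]
    clear hlin r
    induction x with
    | zero => simp
    | add x x' hx hx' =>
      simp only [map_add, LinearMap.add_apply, hx, hx', Finset.sum_add_distrib]
    | tmul f a =>
      apply (cancelBase k V R).injective
      rw [baseOp_tmul, map_smul, map_smul, ← baseComul_apply,
        baseComul_baseExt fV _ (comul_magDerivation mag), baseComul_apply, ← s.eq, map_sum,
        map_sum, map_sum, Finset.smul_sum]
      refine Finset.sum_congr rfl fun j _ => ?_
      have h := equivariant_algebroidTri mag fV
        (γ := lift k (diagonal (baseDiagonal fV (magDerivation mag)) (magDerivation mag)))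
        ((TensorProduct.mk R _ _).compr₂ (cancelBase k V R).toLinearMap)
        (fun v x y => by
          rw [lift_ι_apply]
          exact cancelBase_diagonal mag fV v x y) f a (.arbitrary R _) (s.left j) (s.right j)
      rw [Coalgebra.Repr.map_comul (.arbitrary R (f ⊗ₜ[k] a)), map_sum]
      exact h.symm
  tri_one x := by
    induction x with
    | zero => simp
    | add x x' hx hx' => simp only [map_add, LinearMap.add_apply, hx, hx']
    | tmul f a =>
      rw [baseOp_tmul, Algebra.TensorProduct.one_def, baseExt_magDerivation_tmul_one,
        baseAction_apply_one, counit_kMap]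
      simp [Algebra.smul_def, mul_comm]
  one_tri x := by
    rw [Algebra.TensorProduct.one_def, baseOp_tmul, kMap_one]
    simp
  counit_tri x y := by
    induction x with
    | zero => simp
    | add x x' hx hx' => simp only [map_add, LinearMap.add_apply, hx, hx']
    | tmul f a =>
      rw [baseOp_tmul, baseOp_tmul, map_smul, counit_baseExt fV _ (counit_magDerivation mag),
        Algebra.TensorProduct.algebraMap_apply, Algebra.TensorProduct.algebraMap_apply]
      simp [baseExt_magDerivation_tmul_one, TensorProduct.smul_tmul']
  tri_mul x y z ι r := by
    have hlin : ∑ i ∈ r.index, algebroidTri mag fV (r.left i) y * algebroidTri mag fV (r.right i) z =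
        TensorProduct.lift (LinearMap.mul R _) (TensorProduct.map ((algebroidTri mag fV).flip y)
          ((algebroidTri mag fV).flip z) (Coalgebra.comul (R := R) x)) :=
      (r.lift_map_comul (LinearMap.mul R _) ((algebroidTri mag fV).flip y)
        ((algebroidTri mag fV).flip z)).symm
    rw [hlin]
    clear hlin r
    induction x with
    | zero => simp
    | add x x' hx hx' => simp only [map_add, LinearMap.add_apply, hx, hx']
    | tmul f a =>
      have h := equivariant_algebroidTri mag fV (γ := baseExt fV (magDerivation mag))
        (LinearMap.mul R _) (fun v x y => by simp [baseDiagonal_magDerivation_mul]) f a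
        (.arbitrary R _) y z
      rw [Coalgebra.Repr.lift_map_comul (.arbitrary R (f ⊗ₜ[k] a)), baseOp_tmul]
      exact h.symm
  tri_tri x y z ι r := by
    rw [← grossmanLarson_eq_sum, grossmanLarson_algebroidTri]
    clear r
    induction x with
    | zero => simp
    | add x x' hx hx' => simp only [map_add, LinearMap.add_apply, hx, hx']
    | tmul f a =>
      rw [baseOp_tmul, baseOp_tmul, baseExt_baseOp, map_smul, LinearMap.smul_apply]

end Algebroid

end TensorAlgebra

/-! ### The antipode `θ` of `R ⊗ T(V)`. -/

namespace TensorAlgebra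

section Theta

variable {k : Type*} [CommRing k] {V : Type*} [AddCommGroup V] [Module k V]
  (mag : V →ₗ[k] V →ₗ[k] V) {R : Type*} [CommRing R] [Algebra k R]
  (fV : V →ₗ[k] Derivation k R R)

/-- The Grossman-Larson product of `R ⊗ T(V)`. -/
abbrev algebroidGl : R ⊗[k] TensorAlgebra k V →ₗ[R] R ⊗[k] TensorAlgebra k V →ₗ[k]
    R ⊗[k] TensorAlgebra k V :=
  baseOp mag fV (glOp mag)

theorem weakAlgebroid_gl (x y : R ⊗[k] TensorAlgebra k V) :
    (weakAlgebroid mag fV).gl x y = algebroidGl mag fV x y :=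
  grossmanLarson_algebroidTri mag fV x y

theorem algebroidGl_tmul_one (f : R) (y : R ⊗[k] TensorAlgebra k V) :
    algebroidGl mag fV (f ⊗ₜ 1) y = f • y := by
  rw [baseOp_tmul, kMap_one]
  simp

theorem algebroidGl_assoc (x y z : R ⊗[k] TensorAlgebra k V) :
    algebroidGl mag fV (algebroidGl mag fV x y) z =
      algebroidGl mag fV x (algebroidGl mag fV y z) := by
  induction x with
  | zero => simp
  | add x x' hx hx' => simp only [map_add, LinearMap.add_apply, hx, hx']
  | tmul f a =>
    rw [baseOp_tmul, baseOp_tmul, baseExt_baseOp, map_smul, LinearMap.smul_apply]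

theorem algebroidGl_one_tmul_toSubadjacent (z : TensorAlgebra k V) (y : R ⊗[k] TensorAlgebra k V) :
    algebroidGl mag fV (1 ⊗ₜ toSubadjacent mag z) y = baseExt fV (glOp mag) z y := by
  rw [baseOp_tmul, kMap_toSubadjacent, one_smul]

/-- The linear map `f ⊗ a ↦ S(K(a)) (f ⊗ 1)`. -/
def thetaLin : R ⊗[k] TensorAlgebra k V →ₗ[k] R ⊗[k] TensorAlgebra k V :=
  TensorProduct.lift
    (LinearMap.compl₂ (((baseExt fV (glOp mag)).toLinearMap ∘ₗ HopfAlgebra.antipode k ∘ₗ kLin mag :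
      TensorAlgebra k V →ₗ[k] R ⊗[k] TensorAlgebra k V →ₗ[k] R ⊗[k] TensorAlgebra k V))
      ((TensorProduct.mk k R (TensorAlgebra k V)).flip 1)).flip

theorem thetaLin_tmul (f : R) (a : TensorAlgebra k V) : thetaLin mag fV (f ⊗ₜ a) =
    baseExt fV (glOp mag) (HopfAlgebra.antipode k (kMap mag a)) (f ⊗ₜ 1) := rfl

theorem thetaLin_tmul_one (f : R) : thetaLin mag fV (f ⊗ₜ 1) = f ⊗ₜ 1 := by
  rw [thetaLin_tmul, kMap_one, HopfAlgebra.antipode_one, map_one, Module.End.one_apply]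

theorem thetaLin_one_tmul (a : TensorAlgebra k V) : thetaLin mag fV (1 ⊗ₜ a) =
    1 ⊗ₜ toSubadjacent mag (HopfAlgebra.antipode k (kMap mag a)) := by
  rw [thetaLin_tmul, ← baseExt_glOp_one mag fV, Algebra.TensorProduct.one_def]

theorem thetaLin_smul (g : R) (y : R ⊗[k] TensorAlgebra k V) :
    thetaLin mag fV (g • y) = algebroidGl mag fV (thetaLin mag fV y) (g ⊗ₜ 1) := by
  induction y with
  | zero => simp
  | add y y' hy hy' => simp only [smul_add, map_add, LinearMap.add_apply, hy, hy']
  | tmul f a =>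
    rw [TensorProduct.smul_tmul', thetaLin_tmul, thetaLin_tmul, ← baseExt_baseOp,
      algebroidGl_tmul_one, TensorProduct.smul_tmul', smul_eq_mul, smul_eq_mul, mul_comm]

/-- Anti-multiplicativity with left factor `1 ⊗ v`. For `y = f ⊗ a`, the term from differentiating
`f` cancels the same term inside `S(K(a)) v (f ⊗ 1)`, and `-S(K(a)) (f ⊗ v)` is left. With
`thetaLin_smul` for scalars, this generates the general case. -/
theorem thetaLin_baseDiagonal (v : V) (y : R ⊗[k] TensorAlgebra k V) :
    thetaLin mag fV (baseDiagonal fV (glOp mag) v y) =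
      -algebroidGl mag fV (thetaLin mag fV y) (1 ⊗ₜ ι k v) := by
  induction y with
  | zero => simp
  | add y y' hy hy' => simp only [map_add, LinearMap.add_apply, hy, hy', neg_add]
  | tmul f a =>
    have h : kMap mag (glOp mag v a) = ι k v * kMap mag a := by
      rw [glOp_apply, ← glAction_ι, kMap_glAction]
    rw [baseDiagonal_tmul, map_add, thetaLin_tmul, thetaLin_tmul, thetaLin_tmul, h,
      antipode_ι_mul, map_neg, map_mul, LinearMap.neg_apply, Module.End.mul_apply,
      ← baseExt_baseOp, algebroidGl_tmul_one, ← sub_eq_add_neg, ← map_sub, ← map_neg,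
      baseExt_ι, baseDiagonal_tmul, sub_add_cancel_left, glOp_apply, magDerivation_one, mul_one,
      add_zero, TensorProduct.smul_tmul', smul_eq_mul, mul_one]

theorem thetaLin_baseExt (z : TensorAlgebra k V) (y : R ⊗[k] TensorAlgebra k V) :
    thetaLin mag fV (baseExt fV (glOp mag) z y) =
      algebroidGl mag fV (thetaLin mag fV y)
        (baseExt fV (glOp mag) (HopfAlgebra.antipode k z) 1) := by
  induction z using induction_left with
  | one =>
    induction y with
    | zero => simp
    | add y y' hy hy' => simp only [map_add, LinearMap.add_apply, hy, hy']
    | tmul f a =>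
      have h : baseExt fV (glOp mag) (1 : TensorAlgebra k V) (1 : R ⊗[k] TensorAlgebra k V) =
          (1 : R) ⊗ₜ 1 := by
        rw [map_one (baseExt fV (glOp mag)), Module.End.one_apply, Algebra.TensorProduct.one_def]
      rw [HopfAlgebra.antipode_one, h, ← thetaLin_smul, one_smul, map_one, Module.End.one_apply]
  | smul c z hz => simp [hz]
  | add z z' hz hz' => simp [hz, hz']
  | ι_mul v z hz =>
    have h : baseExt fV (glOp mag) (ι k v) (1 : R ⊗[k] TensorAlgebra k V) = 1 ⊗ₜ ι k v := by
      rw [baseExt_glOp_one, toSubadjacent_ι]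
    rw [map_mul, Module.End.mul_apply, baseExt_ι, thetaLin_baseDiagonal, hz, algebroidGl_assoc,
      antipode_ι_mul, map_neg, LinearMap.neg_apply, map_neg, map_mul, Module.End.mul_apply, h,
      baseExt_glOp_one, algebroidGl_one_tmul_toSubadjacent]

theorem thetaLin_gl (x y : R ⊗[k] TensorAlgebra k V) :
    thetaLin mag fV (algebroidGl mag fV x y) =
      algebroidGl mag fV (thetaLin mag fV y) (thetaLin mag fV x) := by
  induction x with
  | zero => simp
  | add x x' hx hx' => simp only [map_add, LinearMap.add_apply, hx, hx']
  | tmul f a =>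
    rw [baseOp_tmul, thetaLin_smul, thetaLin_baseExt, algebroidGl_assoc, baseExt_glOp_one,
      algebroidGl_one_tmul_toSubadjacent, thetaLin_tmul]

/-- Applying `θ` to `S(K(a)) (f ⊗ 1)` gives `(f ⊗ 1) * (S(S(K(a))) · 1)`. Since `S² = 1` and `K(a) ·
1 = a`, this is `f ⊗ a`. -/
theorem thetaLin_involutive : Function.Involutive (thetaLin mag fV) := by
  intro x
  induction x with
  | zero => simp
  | add x x' hx hx' => rw [map_add, map_add, hx, hx']
  | tmul f a =>
    rw [thetaLin_tmul, thetaLin_baseExt, thetaLin_tmul_one, algebroidGl_tmul_one,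
      antipode_antipode, baseExt_glOp_one, toSubadjacent_kMap, TensorProduct.smul_tmul',
      smul_eq_mul, mul_one]

/-- The antipode of the action post-Hopf algebroid `R ⊗ T(V)`. -/
def theta : R ⊗[k] TensorAlgebra k V ≃ₗ[k] R ⊗[k] TensorAlgebra k V :=
  LinearEquiv.ofInvolutive (thetaLin mag fV) (thetaLin_involutive mag fV)

theorem theta_apply (x : R ⊗[k] TensorAlgebra k V) : theta mag fV x = thetaLin mag fV x := rfl

theorem glAntipode_eq (a : TensorAlgebra k V) : (postHopf mag).glAntipode a =
    toSubadjacent mag (HopfAlgebra.antipode k (kMap mag a)) := by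
  conv_lhs => rw [← toSubadjacent_kMap mag a, glAntipode_toSubadjacent]

theorem theta_tmul (f : R) (a : TensorAlgebra k V) {ι : Type*} (r : Coalgebra.Repr k a ι) :
    theta mag fV (f ⊗ₜ[k] a) =
      ∑ i ∈ r.index, subadjacentAction mag fV ((postHopf mag).glAntipode (r.left i)) f ⊗ₜ[k]
        (postHopf mag).glAntipode (r.right i) := by
  rw [theta_apply, thetaLin_tmul, baseExt_tmul, comul_antipode, comul_kMap, ← r.eq]
  simp only [map_sum, TensorProduct.map_tmul, glAntipode_eq, subadjacentAction_apply,
    kMap_toSubadjacent]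
  rfl

theorem comul_thetaLin (f : R) (a : TensorAlgebra k V) {ι : Type*} (r : Coalgebra.Repr k a ι) :
    Coalgebra.comul (R := R) (thetaLin mag fV (f ⊗ₜ[k] a)) =
      ∑ i ∈ r.index, thetaLin mag fV (f ⊗ₜ[k] r.left i) ⊗ₜ[R]
        thetaLin mag fV (1 ⊗ₜ[k] r.right i) := by
  apply (cancelBase k V R).injective
  have h : baseComul k V R (f ⊗ₜ[k] 1) = (f ⊗ₜ[k] 1) ⊗ₜ[k] 1 := by
    rw [baseComul_tmul]
    simp [Algebra.TensorProduct.one_def]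
  rw [← baseComul_apply, thetaLin_tmul, baseComul_baseExt fV _ (comul_glOp mag), h,
    lift_diagonal_tmul, comul_antipode, comul_kMap, ← r.eq]
  simp only [map_sum, TensorProduct.map_tmul, thetaLin_one_tmul, cancelBase_tmul, one_smul]
  rfl

theorem counit_thetaLin (f : R) (a : TensorAlgebra k V) :
    Coalgebra.counit (R := R) (thetaLin mag fV (f ⊗ₜ[k] a)) =
      baseAction fV (HopfAlgebra.antipode k (kMap mag a)) f := by
  rw [thetaLin_tmul, counit_baseExt fV]
  · simp
  · intro v x
    rw [glOp_apply, map_add, counit_magDerivation, Bialgebra.counit_mul, counit_ι, zero_mul,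
      add_zero]

/-- In the induction step, the terms where `v` acts on the tensor factor cancel between the two
halves of `Δ(vz)`. What remains is the sum for `z` with `f` replaced by `-v(f)`, hence the induction
over all `f`. -/
theorem lift_baseExt_antipode (z : TensorAlgebra k V) (f : R) :
    TensorProduct.lift ((baseExt fV (glOp mag)).toLinearMap ∘ₗ HopfAlgebra.antipode k :
        TensorAlgebra k V →ₗ[k] R ⊗[k] TensorAlgebra k V →ₗ[k] R ⊗[k] TensorAlgebra k V)
      (TensorProduct.map LinearMap.id (TensorProduct.mk k R (TensorAlgebra k V) f ∘ₗ
        toSubadjacent mag) (Coalgebra.comul (R := k) z)) =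
      baseAction fV (HopfAlgebra.antipode k z) f ⊗ₜ 1 := by
  induction z using induction_left generalizing f with
  | one => simp [Algebra.TensorProduct.one_def, toSubadjacent_one]
  | smul c z hz => simp [hz, TensorProduct.smul_tmul']
  | add y z hy hz => simp [hy, hz, TensorProduct.add_tmul]
  | ι_mul v z hz =>
    rw [antipode_ι_mul, map_neg, map_mul (baseAction fV), LinearMap.neg_apply,
      Module.End.mul_apply, TensorProduct.neg_tmul, ← hz, comul_ι_mul]
    generalize Coalgebra.comul (R := k) z = t
    induction t with
    | zero => simp
    | add s t hs ht => rw [mul_add, map_add, map_add, map_add, map_add, hs, ht, neg_add]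
    | tmul a b =>
      simp [add_mul, toSubadjacent_ι_mul, antipode_mul, antipode_ι, glOp_apply]

variable (k V R) in
/-- The section `f a ⊗ b ↦ f a ⊗ b` of the projection onto the tensor product over `R`. -/
def baseSection : (R ⊗[k] TensorAlgebra k V) ⊗[R] (R ⊗[k] TensorAlgebra k V) →ₗ[k]
    (R ⊗[k] TensorAlgebra k V) ⊗[k] (R ⊗[k] TensorAlgebra k V) :=
  (TensorProduct.mk k R (TensorAlgebra k V) 1).lTensor (R ⊗[k] TensorAlgebra k V) ∘ₗ
    (cancelBase k V R).toLinearMap.restrictScalars k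

theorem baseSection_tmul (x : R ⊗[k] TensorAlgebra k V) (g : R) (b : TensorAlgebra k V) :
    baseSection k V R (x ⊗ₜ[R] (g ⊗ₜ[k] b)) = (g • x) ⊗ₜ[k] (1 ⊗ₜ[k] b) := rfl

theorem baseSection_comul {ι : Type*} (f : R) {a : TensorAlgebra k V}
    (r : Coalgebra.Repr k a ι) :
    baseSection k V R (Coalgebra.comul (R := R) (f ⊗ₜ[k] a)) =
      ∑ i ∈ r.index, (f ⊗ₜ[k] r.left i) ⊗ₜ[k] (1 ⊗ₜ[k] r.right i) := by
  rw [comul_base_tmul f r, map_sum]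
  simp [baseSection_tmul]

theorem isAntipodeWith_theta :
    (weakAlgebroid mag fV).IsAntipodeWith (theta mag fV) (baseSection k V R) where
  section_apply t := by
    induction t with
    | zero => simp
    | add s t hs ht => rw [map_add, map_add, hs, ht]
    | tmul x y =>
      induction y with
      | zero => simp
      | add y y' hy hy' => rw [TensorProduct.tmul_add, map_add, map_add, hy, hy']
      | tmul g b =>
        rw [baseSection_tmul, TensorProduct.mapOfCompatibleSMul_tmul, TensorProduct.smul_tmul,
          TensorProduct.smul_tmul', smul_eq_mul, mul_one]
  map_one := by rw [Algebra.TensorProduct.one_def, theta_apply, thetaLin_tmul_one]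
  map_gl x y := by
    rw [weakAlgebroid_gl, weakAlgebroid_gl]
    exact thetaLin_gl mag fV x y
  comul_map x := by
    induction x with
    | zero => simp
    | add x x' hx hx' => simp only [map_add, hx, hx']
    | tmul f a =>
      rw [baseSection_comul f (.arbitrary k a), theta_apply, comul_thetaLin mag fV f a (.arbitrary k a)]
      simp [theta_apply]
  gl_map_right x := by
    induction x with
    | zero => simp
    | add x x' hx hx' => simp only [map_add, hx, hx']
    | tmul f a =>
      rw [baseSection_comul f (.arbitrary k a)]
      -- Here `θ(1 ⊗ a₂) = S(K(a₂)) · 1`, so the axiom is the antipode identity of `T(V)` at `K(a)`,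
      -- applied to `1` and scaled by `f`.
      have h := congr(f • baseExt fV (glOp mag)
        $(sum_kMap_mul_antipode mag (.arbitrary k a)) (1 : R ⊗[k] TensorAlgebra k V))
      simp only [map_sum, map_mul, LinearMap.sum_apply, Module.End.mul_apply,
        baseExt_glOp_one] at h
      simp only [map_sum, TensorProduct.map_tmul, TensorProduct.lift.tmul, weakAlgebroid_gl,
        LinearMap.id_apply, LinearEquiv.coe_coe, theta_apply, thetaLin_one_tmul, baseOp_tmul]
      rw [← Finset.smul_sum, h, Algebra.algebraMap_eq_smul_one, map_smul, toSubadjacent_one,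
        TensorProduct.tmul_smul, TensorProduct.smul_tmul']
      simp [Algebra.smul_def, mul_comm]
  gl_map_left x := by
    induction x with
    | zero => simp
    | add x x' hx hx' => simp only [map_add, hx, hx']
    | tmul f a =>
      rw [baseSection_comul f (.arbitrary k a), theta_apply, counit_thetaLin]
      -- With `z = K(a)`, the components `toSubadjacent mag (kMap mag a₂)` are just `a₂`.
      have h := lift_baseExt_antipode mag fV (kMap mag a) f
      rw [comul_kMap, ← (Coalgebra.Repr.arbitrary k a).eq] at h
      rw [Algebra.TensorProduct.algebraMap_apply]
      refine Eq.trans ?_ h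
      simp only [map_sum, TensorProduct.map_tmul, TensorProduct.lift.tmul, weakAlgebroid_gl,
        LinearMap.id_apply, LinearEquiv.coe_coe, theta_apply, kLin_apply]
      refine Finset.sum_congr rfl fun i _ => ?_
      rw [thetaLin_tmul, ← baseExt_baseOp, algebroidGl_tmul_one]
      simp [toSubadjacent_kMap, TensorProduct.smul_tmul']

/-- The action post-Hopf algebroid `R ⊗ T(V)`. -/
def algebroid : PostHopfAlgebroid k R (R ⊗[k] TensorAlgebra k V) where
  toWeakPostHopfAlgebroid := weakAlgebroid mag fV
  theta := theta mag fV
  exists_section := ⟨_, isAntipodeWith_theta mag fV⟩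

theorem algebroid_tri_tmul (f : R) (a : TensorAlgebra k V) (y : R ⊗[k] TensorAlgebra k V) :
    (algebroid mag fV).tri (f ⊗ₜ a) y =
      f • baseExt fV (magDerivation mag) (kMap mag a) y :=
  baseOp_tmul mag fV _ f a y

theorem isActionPostHopfAlgebroid {k : Type u} [CommRing k] {V : Type w} [AddCommGroup V]
    [Module k V] (mag : V →ₗ[k] V →ₗ[k] V) {R : Type v} [CommRing R] [Algebra k R]
    (fV : V →ₗ[k] Derivation k R R) :
    IsActionPostHopfAlgebroid (postHopf mag) (subadjacentAction mag fV) (algebroid mag fV) where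
  isModuleAlgebra := isModuleAlgebra mag fV
  tri_tmul f g a b ι r := by
    rw [algebroid_tri_tmul, baseExt_tmul, comul_kMap, ← r.eq]
    simp only [map_sum, TensorProduct.map_tmul, Finset.smul_sum, TensorProduct.smul_tmul',
      smul_eq_mul]
    rfl
  theta_tmul f a ι r := theta_tmul mag fV f a r
  section_tmul := ⟨baseSection k V R, isAntipodeWith_theta mag fV, fun f a b => by
    rw [baseSection_tmul, one_smul]⟩

end Theta

end TensorAlgebra

/-! ## The canonical map from `Lie(V)` to `T(V)` -/

namespace FreeLie

variable {k : Type*} [CommRing k] {V : Type*} [AddCommGroup V] [Module k V]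

theorem comul_toTensor (x : FreeLie k V) : Coalgebra.comul (R := k) (toTensor k V x) =
    toTensor k V x ⊗ₜ 1 + 1 ⊗ₜ toTensor k V x := by
  induction x using FreeLie.induction with
  | hι v => rw [toTensor_ι, TensorAlgebra.comul_ι]
  | add x y hx hy =>
    rw [map_add, map_add, hx, hy, TensorProduct.add_tmul, TensorProduct.tmul_add]
    abel
  | smul c x hx => rw [map_smul, map_smul, hx, smul_add, TensorProduct.smul_tmul',
      TensorProduct.tmul_smul]
  | lie x y hx hy =>
    rw [toTensor_lie, map_sub, Bialgebra.comul_mul, Bialgebra.comul_mul, hx, hy]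
    simp only [mul_add, add_mul, Algebra.TensorProduct.tmul_mul_tmul, one_mul, mul_one,
      TensorProduct.sub_tmul, TensorProduct.tmul_sub]
    abel

theorem counit_toTensor (x : FreeLie k V) :
    Coalgebra.counit (R := k) (toTensor k V x) = 0 := by
  induction x using FreeLie.induction with
  | hι v => rw [toTensor_ι, TensorAlgebra.counit_ι]
  | add x y hx hy => rw [map_add, map_add, hx, hy, add_zero]
  | smul c x hx => rw [map_smul, map_smul, hx, smul_zero]
  | lie x y hx hy => simp [toTensor_lie, hx, hy]

theorem antipode_toTensor (x : FreeLie k V) :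
    HopfAlgebra.antipode k (toTensor k V x) = -toTensor k V x := by
  induction x using FreeLie.induction with
  | hι v => rw [toTensor_ι, TensorAlgebra.antipode_ι]
  | add x y hx hy => rw [map_add, map_add, hx, hy, neg_add]
  | smul c x hx => rw [map_smul, map_smul, hx, smul_neg]
  | lie x y hx hy => simp [toTensor_lie, TensorAlgebra.antipode_mul, hx, hy]

variable (mag : V →ₗ[k] V →ₗ[k] V)

/-- Commutators of derivations are derivations, so Lie elements, unlike general tensors, act by
derivations. -/
theorem derAction_toTensor_mul (x : FreeLie k V) (y z : TensorAlgebra k V) :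
    TensorAlgebra.derAction mag (toTensor k V x) (y * z) =
      y * TensorAlgebra.derAction mag (toTensor k V x) z +
        TensorAlgebra.derAction mag (toTensor k V x) y * z := by
  induction x using FreeLie.induction generalizing y z with
  | hι v => rw [toTensor_ι, TensorAlgebra.derAction_ι, TensorAlgebra.magDerivation_mul]
  | add a b ha hb =>
    simp only [map_add, LinearMap.add_apply, ha, hb, mul_add, add_mul]
    abel
  | smul c a ha => simp only [map_smul, LinearMap.smul_apply, ha, smul_add, mul_smul_comm,
      smul_mul_assoc]
  | lie a b ha hb =>
    simp only [toTensor_lie, map_sub, map_mul, LinearMap.sub_apply, Module.End.mul_apply, ha, hb,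
      map_add, mul_sub, sub_mul]
    abel

theorem derAction_toTensor (x y : FreeLie k V) :
    TensorAlgebra.derAction mag (toTensor k V x) (toTensor k V y) =
      toTensor k V (derAction mag x y) := by
  induction x using FreeLie.induction generalizing y with
  | hι v =>
    rw [toTensor_ι, TensorAlgebra.derAction_ι]
    induction y using FreeLie.induction with
    | hι w =>
      rw [toTensor_ι, TensorAlgebra.magDerivation_ι, derAction_ι_ι, toTensor_ι]
    | add a b ha hb => simp only [map_add, ha, hb]
    | smul c a ha => simp only [map_smul, ha]
    | lie a b ha hb =>
      simp only [toTensor_lie, map_sub, TensorAlgebra.magDerivation_mul, ha, hb,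
        LieDerivation.apply_lie_eq_add, map_add]
      abel
  | add a b ha hb => simp only [map_add, LinearMap.add_apply, LieDerivation.add_apply, ha, hb]
  | smul c a ha => simp only [map_smul, LinearMap.smul_apply, LieDerivation.smul_apply, ha]
  | lie a b ha hb =>
    simp only [toTensor_lie, map_sub, map_mul, LinearMap.sub_apply, Module.End.mul_apply, ha, hb,
      LieHom.map_lie, LieDerivation.lie_apply]

/-- The commutator of two operators "multiply by `κ(a)`, plus `D_a`" has multiplication part `[κ(a),
κ(b)] + D_a κ(b) - D_b κ(a)`, which is the recursion `toSubadjacent_lie` on `Lie(V)`. Evaluated at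
`1`, this identifies the two maps `toSubadjacent`. -/
theorem glAction_toTensor (x : FreeLie k V) (y : TensorAlgebra k V) :
    TensorAlgebra.glAction mag (toTensor k V x) y = toTensor k V (toSubadjacent mag x) * y +
      TensorAlgebra.derAction mag (toTensor k V x) y := by
  induction x using FreeLie.induction generalizing y with
  | hι v => rw [toTensor_ι, TensorAlgebra.glAction_ι, TensorAlgebra.derAction_ι,
      toSubadjacent_ι, toTensor_ι]
  | add a b ha hb =>
    simp only [map_add, LinearMap.add_apply, ha, hb, add_mul]
    abel
  | smul c a ha => simp only [map_smul, LinearMap.smul_apply, ha, smul_add, smul_mul_assoc]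
  | lie a b ha hb =>
    simp only [toTensor_lie, map_sub, map_mul, LinearMap.sub_apply, Module.End.mul_apply, ha, hb,
      map_add, toSubadjacent_lie, derAction_toTensor_mul, derAction_toTensor, mul_add, add_mul,
      sub_mul, mul_assoc]
    abel

theorem toSubadjacent_toTensor (x : FreeLie k V) :
    TensorAlgebra.toSubadjacent mag (toTensor k V x) = toTensor k V (toSubadjacent mag x) := by
  have h : TensorAlgebra.derAction mag (toTensor k V x) 1 = 0 :=
    TensorAlgebra.derivation_apply_one (derAction_toTensor_mul mag x)
  rw [TensorAlgebra.toSubadjacent_apply, glAction_toTensor, h, mul_one, add_zero]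

theorem kMap_toTensor (x : FreeLie k V) : TensorAlgebra.kMap mag (toTensor k V x) =
    toTensor k V ((subadjacentEquiv mag).symm x) := by
  conv_lhs => rw [← (subadjacentEquiv mag).apply_symm_apply x, subadjacentEquiv_apply,
    ← toSubadjacent_toTensor, TensorAlgebra.kMap_toSubadjacent]

variable {R : Type*} [CommRing R] [Algebra k R] (fV : V →ₗ[k] Derivation k R R)

theorem baseAction_toTensor (x : FreeLie k V) (f : R) :
    TensorAlgebra.baseAction fV (toTensor k V x) f = lift fV x f := by
  induction x using FreeLie.induction generalizing f with
  | hι v => rw [toTensor_ι, TensorAlgebra.baseAction_ι, lift_ι]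
  | add a b ha hb => simp only [map_add, LinearMap.add_apply, Derivation.add_apply, ha, hb]
  | smul c a ha => simp only [map_smul, LinearMap.smul_apply, Derivation.smul_apply, ha]
  | lie a b ha hb =>
    simp only [toTensor_lie, map_sub, map_mul, LinearMap.sub_apply, Module.End.mul_apply, ha, hb,
      LieHom.map_lie, Derivation.commutator_apply]

/-- `K` sends a Lie element to a Lie element, whose coproduct has two terms: one acts on `g`, the
other on `a`. -/
theorem algebroid_tri_toTensor_tmul (f g : R) (x : FreeLie k V) (a : TensorAlgebra k V) :
    (TensorAlgebra.algebroid mag fV).tri (f ⊗ₜ toTensor k V x) (g ⊗ₜ a) =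
      (f * subadjacentLift mag fV x g) ⊗ₜ a +
        (f * g) ⊗ₜ (TensorAlgebra.postHopf mag).tri (toTensor k V x) a := by
  rw [TensorAlgebra.algebroid_tri_tmul, TensorAlgebra.baseExt_tmul,
    TensorAlgebra.postHopf_tri, kMap_toTensor, comul_toTensor]
  simp only [map_add, TensorProduct.map_tmul, LinearMap.flip_apply, AlgHom.toLinearMap_apply,
    baseAction_toTensor, map_one, Module.End.one_apply, smul_add, TensorProduct.smul_tmul',
    smul_eq_mul, subadjacentLift_apply]
  rfl

theorem algebroid_tri_toTensor (x y : R ⊗[k] FreeLie k V) :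
    (TensorAlgebra.algebroid mag fV).tri ((toTensor k V).lTensor R x) ((toTensor k V).lTensor R y) =
      (toTensor k V).lTensor R ((postLieRinehart mag fV).tri x y) := by
  induction x with
  | zero => simp
  | add a b ha hb => simp only [map_add, LinearMap.add_apply, ha, hb]
  | tmul f x =>
    induction y with
    | zero => simp
    | add a b ha hb => simp only [map_add, ha, hb]
    | tmul g y =>
      rw [(isAction_postLieRinehart mag fV).tri_tmul, LinearMap.lTensor_tmul,
        LinearMap.lTensor_tmul, algebroid_tri_toTensor_tmul, map_add, LinearMap.lTensor_tmul,
        LinearMap.lTensor_tmul, TensorAlgebra.postHopf_tri, kMap_toTensor, derAction_toTensor]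
      rfl

theorem algebroid_tri_toTensor_algebraMap (x : R ⊗[k] FreeLie k V) (f : R) :
    (TensorAlgebra.algebroid mag fV).tri ((toTensor k V).lTensor R x) (f ⊗ₜ 1) =
      (postLieRinehart mag fV).rho x f ⊗ₜ 1 := by
  induction x with
  | zero => simp
  | add a b ha hb =>
    simp only [map_add, LinearMap.add_apply, ha, hb, Derivation.add_apply, TensorProduct.add_tmul]
  | tmul g x =>
    rw [LinearMap.lTensor_tmul, TensorAlgebra.algebroid_tri_tmul,
      TensorAlgebra.baseExt_magDerivation_tmul_one, kMap_toTensor, baseAction_toTensor,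
      (isAction_postLieRinehart mag fV).rho_tmul, TensorProduct.smul_tmul']
    rfl

end FreeLie

/-! ## The universal enveloping algebra of `R ⊗ Lie(V)` -/

namespace FreeLie

open UniversalEnvelopingAlgebra

attribute [local instance 2000] LieRing.ofAssociativeRing

variable (k : Type*) [CommRing k] (V : Type*) [AddCommGroup V] [Module k V]
  (R : Type*) [CommRing R] [Algebra k R]

/-- The algebra map `𝓤_R(R ⊗ Lie(V)) → R ⊗ T(V)`. -/
def envelopingToTensor :
    UniversalEnvelopingAlgebra R (R ⊗[k] FreeLie k V) →ₐ[R] R ⊗[k] TensorAlgebra k V :=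
  UniversalEnvelopingAlgebra.lift R
    { (toTensor k V).baseChange R with
      map_lie' := by
        intro x y
        change (toTensor k V).baseChange R ⁅x, y⁆ =
          (toTensor k V).baseChange R x * (toTensor k V).baseChange R y -
            (toTensor k V).baseChange R y * (toTensor k V).baseChange R x
        induction x with
        | zero => simp
        | add a b ha hb =>
          simp only [add_lie, map_add, ha, hb, add_mul, mul_add]
          abel
        | tmul f x =>
          induction y with
          | zero => simp
          | add a b ha hb =>
            simp only [lie_add, map_add, ha, hb, add_mul, mul_add]
            abel
          | tmul g y =>
            simp [toTensor_lie, TensorProduct.tmul_sub, mul_comm g] }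

theorem envelopingToTensor_ι (x : R ⊗[k] FreeLie k V) :
    envelopingToTensor k V R (UniversalEnvelopingAlgebra.ι R x) = (toTensor k V).lTensor R x := by
  rw [envelopingToTensor, lift_ι_apply]
  rfl

/-- The algebra map `T(V) → 𝓤_R(R ⊗ Lie(V))`. -/
def tensorToEnveloping₀ :
    TensorAlgebra k V →ₐ[k] UniversalEnvelopingAlgebra R (R ⊗[k] FreeLie k V) :=
  TensorAlgebra.lift k
    (((UniversalEnvelopingAlgebra.ι R (L := R ⊗[k] FreeLie k V)).toLinearMap.restrictScalars k) ∘ₗ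
      TensorProduct.mk k R (FreeLie k V) 1 ∘ₗ ι k V)

theorem tensorToEnveloping₀_toTensor (x : FreeLie k V) :
    tensorToEnveloping₀ k V R (toTensor k V x) = UniversalEnvelopingAlgebra.ι R (1 ⊗ₜ x) := by
  induction x using FreeLie.induction with
  | hι v =>
    rw [toTensor_ι, tensorToEnveloping₀, TensorAlgebra.lift_ι_apply]
    rfl
  | add a b ha hb => rw [map_add, map_add, ha, hb, TensorProduct.tmul_add, map_add]
  | smul c a ha =>
    rw [map_smul, map_smul, ha, TensorProduct.tmul_smul, ← algebraMap_smul R c,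
      ← algebraMap_smul R c, map_smul]
  | lie a b ha hb =>
    have h : (1 : R) ⊗ₜ[k] ⁅a, b⁆ = ⁅(1 : R) ⊗ₜ[k] a, (1 : R) ⊗ₜ[k] b⁆ := by
      rw [LieAlgebra.ExtendScalars.bracket_tmul, one_mul]
    rw [toTensor_lie, map_sub, map_mul, map_mul, ha, hb, h, LieHom.map_lie,
      LieRing.of_associative_ring_bracket]

/-- The algebra map `R ⊗ T(V) → 𝓤_R(R ⊗ Lie(V))`. -/
def tensorToEnveloping :
    R ⊗[k] TensorAlgebra k V →ₐ[R] UniversalEnvelopingAlgebra R (R ⊗[k] FreeLie k V) :=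
  Algebra.TensorProduct.lift (Algebra.ofId R _) (tensorToEnveloping₀ k V R)
    (by
      intro f a
      rw [Algebra.ofId_apply]
      exact Algebra.commute_algebraMap_left f _)

theorem tensorToEnveloping_tmul (f : R) (a : TensorAlgebra k V) :
    tensorToEnveloping k V R (f ⊗ₜ a) = f • tensorToEnveloping₀ k V R a := by
  rw [tensorToEnveloping, Algebra.TensorProduct.lift_tmul, Algebra.smul_def]
  rfl

/-- The isomorphism of algebras `𝓤_R(R ⊗ Lie(V)) ≅ R ⊗ T(V)`. -/
def envelopingAlgEquiv :
    UniversalEnvelopingAlgebra R (R ⊗[k] FreeLie k V) ≃ₐ[R] R ⊗[k] TensorAlgebra k V :=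
  AlgEquiv.ofAlgHom (envelopingToTensor k V R) (tensorToEnveloping k V R)
    (by
      ext v
      change envelopingToTensor k V R (tensorToEnveloping k V R (1 ⊗ₜ TensorAlgebra.ι k v)) =
        1 ⊗ₜ TensorAlgebra.ι k v
      rw [tensorToEnveloping_tmul, one_smul, ← toTensor_ι, tensorToEnveloping₀_toTensor,
        envelopingToTensor_ι, LinearMap.lTensor_tmul])
    (by
      apply algHom_ext_gen
      intro x
      change tensorToEnveloping k V R (envelopingToTensor k V R (UniversalEnvelopingAlgebra.ι R x)) =
        UniversalEnvelopingAlgebra.ι R x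
      rw [envelopingToTensor_ι]
      induction x with
      | zero => simp only [map_zero]
      | add a b ha hb => simp only [map_add, ha, hb]
      | tmul f x =>
        rw [LinearMap.lTensor_tmul, tensorToEnveloping_tmul, tensorToEnveloping₀_toTensor,
          ← map_smul, TensorProduct.smul_tmul', smul_eq_mul, mul_one])

theorem comul_lTensor_toTensor (x : R ⊗[k] FreeLie k V) :
    Coalgebra.comul (R := R) ((toTensor k V).lTensor R x) =
      (toTensor k V).lTensor R x ⊗ₜ 1 + 1 ⊗ₜ (toTensor k V).lTensor R x := by
  induction x with
  | zero => simp
  | add a b ha hb =>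
    simp only [map_add, ha, hb, TensorProduct.add_tmul, TensorProduct.tmul_add]
    abel
  | tmul f x =>
    apply (TensorAlgebra.cancelBase k V R).injective
    rw [← TensorAlgebra.baseComul_apply, LinearMap.lTensor_tmul, TensorAlgebra.baseComul_tmul,
      comul_toTensor, map_add, map_add, Algebra.TensorProduct.one_def]
    simp [TensorProduct.smul_tmul']

theorem counit_lTensor_toTensor (x : R ⊗[k] FreeLie k V) :
    Coalgebra.counit (R := R) ((toTensor k V).lTensor R x) = 0 := by
  induction x with
  | zero => simp
  | add a b ha hb => rw [map_add, map_add, ha, hb, add_zero]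
  | tmul f x => simp [counit_toTensor]

theorem antipode_lTensor_toTensor (x : R ⊗[k] FreeLie k V) :
    HopfAlgebra.antipode R ((toTensor k V).lTensor R x) = -(toTensor k V).lTensor R x := by
  induction x with
  | zero => simp
  | add a b ha hb => rw [map_add, map_add, ha, hb, neg_add]
  | tmul f x =>
    change TensorProduct.AlgebraTensorModule.map _ _ _ = _
    simp [antipode_toTensor, TensorProduct.tmul_neg]

/-- The isomorphism of bialgebras `𝓤_R(R ⊗ Lie(V)) ≅ R ⊗ T(V)`. -/
def envelopingEquiv :
    UniversalEnvelopingAlgebra R (R ⊗[k] FreeLie k V) ≃ₐc[R] R ⊗[k] TensorAlgebra k V :=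
  BialgEquiv.ofAlgEquiv (envelopingAlgEquiv k V R)
    (by
      apply algHom_ext_gen
      intro x
      change Coalgebra.counit (R := R) (envelopingToTensor k V R (UniversalEnvelopingAlgebra.ι R x)) =
        Coalgebra.counit (R := R) (UniversalEnvelopingAlgebra.ι R x)
      rw [envelopingToTensor_ι, counit_lTensor_toTensor, UniversalEnvelopingAlgebra.counit_ι])
    (by
      apply algHom_ext_gen
      intro x
      change TensorProduct.map (envelopingToTensor k V R).toLinearMap
        (envelopingToTensor k V R).toLinearMap
        (Coalgebra.comul (R := R) (UniversalEnvelopingAlgebra.ι R x)) =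
        Coalgebra.comul (R := R) (envelopingToTensor k V R (UniversalEnvelopingAlgebra.ι R x))
      rw [UniversalEnvelopingAlgebra.comul_ι, envelopingToTensor_ι, comul_lTensor_toTensor,
        map_add, TensorProduct.map_tmul, TensorProduct.map_tmul, AlgHom.toLinearMap_apply,
        AlgHom.toLinearMap_apply, envelopingToTensor_ι, map_one])

theorem envelopingEquiv_ι (x : R ⊗[k] FreeLie k V) :
    envelopingEquiv k V R (UniversalEnvelopingAlgebra.ι R x) = (toTensor k V).lTensor R x :=
  envelopingToTensor_ι k V R x

/-- Both antipodes reverse products and negate the Lie elements that generate. -/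
theorem envelopingEquiv_antipode (x : UniversalEnvelopingAlgebra R (R ⊗[k] FreeLie k V)) :
    envelopingEquiv k V R (HopfAlgebra.antipode R x) =
      HopfAlgebra.antipode R (envelopingEquiv k V R x) := by
  induction x using induction_gen with
  | algebraMap r =>
    rw [Algebra.algebraMap_eq_smul_one, map_smul, map_smul, map_smul, map_smul,
      HopfAlgebra.antipode_one, map_one, HopfAlgebra.antipode_one]
  | gen x =>
    have h : HopfAlgebra.antipode R (UniversalEnvelopingAlgebra.ι R x) =
      -UniversalEnvelopingAlgebra.ι R x := antipodeMap_ι R x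
    rw [h, map_neg, envelopingEquiv_ι, antipode_lTensor_toTensor]
  | mul a b ha hb =>
    rw [HopfAlgebra.antipode_mul_antidistrib, map_mul, map_mul, ha, hb,
      HopfAlgebra.antipode_mul_antidistrib]
  | add a b ha hb => simp only [map_add, ha, hb]

end FreeLie

/-! ## Transport of post-Hopf algebroids, primitive elements -/

namespace WeakPostHopfAlgebroid

section Primitive

variable {k R H : Type*} [CommRing k] [CommRing R] [Algebra k R] [Ring H] [HopfAlgebra R H]
  [Coalgebra.IsCocomm R H] [Algebra k H] [IsScalarTower k R H] (W : WeakPostHopfAlgebroid k R H)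
  {x : H} (hx : Coalgebra.comul (R := R) x = x ⊗ₜ 1 + 1 ⊗ₜ x)
include hx

theorem tri_mul_of_primitive (y z : H) : W.tri x (y * z) = W.tri x y * z + y * W.tri x z := by
  have h : W.tri x (y * z) = LinearMap.mul' R H (TensorProduct.map (W.tri.flip y) (W.tri.flip z)
      (Coalgebra.comul (R := R) x)) := by
    rw [W.tri_mul x y z (.arbitrary R x), Coalgebra.Repr.map_comul (.arbitrary R x)]
    simp
  rw [h, hx]
  simp [W.one_tri]

theorem mul_tri_of_primitive (y z : H) :
    W.tri (x * y) z = W.tri x (W.tri y z) - W.tri (W.tri x y) z := by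
  rw [W.tri_tri x y z (.arbitrary R x), ← grossmanLarson_eq_sum, grossmanLarson]
  simp [hx, W.one_tri]

end Primitive

section Transport

variable {k : Type u} {R : Type v} {H H' : Type w} [CommRing k] [CommRing R] [Algebra k R]
  [Ring H] [HopfAlgebra R H] [Algebra k H] [IsScalarTower k R H]
  [Ring H'] [HopfAlgebra R H'] [Algebra k H'] [IsScalarTower k R H']
  (e : H' ≃ₐc[R] H)

theorem comul_apply (x : H') : Coalgebra.comul (R := R) (e x) =
    TensorProduct.map (e : H' ≃ₐ[R] H).toLinearMap (e : H' ≃ₐ[R] H).toLinearMap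
      (Coalgebra.comul (R := R) x) :=
  (CoalgHomClass.map_comp_comul_apply e x).symm

theorem counit_apply (x : H') :
    Coalgebra.counit (R := R) (e x) = Coalgebra.counit (R := R) x :=
  CoalgHomClass.counit_comp_apply e x

/-- The image of a representation under an isomorphism of coalgebras. -/
def mapRepr {x : H'} {ι : Type*} (r : Coalgebra.Repr R x ι) : Coalgebra.Repr R (e x) ι where
  index := r.index
  left i := e (r.left i)
  right i := e (r.right i)
  eq := by
    rw [comul_apply, ← r.eq, map_sum]
    rfl

variable (k) in
/-- The underlying `k`-linear equivalence. -/
def baseEquiv : H' ≃ₗ[k] H := (e : H' ≃ₐ[R] H).toLinearEquiv.restrictScalars k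

@[simp]
theorem baseEquiv_apply (x : H') : baseEquiv k e x = e x := rfl

@[simp]
theorem baseEquiv_symm_apply (x : H) : (baseEquiv k e).symm x = e.symm x := rfl

theorem mapOfCompatibleSMul_map (t : H ⊗[k] H) :
    TensorProduct.mapOfCompatibleSMul R k k H' H'
      (TensorProduct.map (baseEquiv k e).symm.toLinearMap (baseEquiv k e).symm.toLinearMap t) =
    TensorProduct.map (e.symm : H ≃ₐ[R] H').toLinearMap (e.symm : H ≃ₐ[R] H').toLinearMap
      (TensorProduct.mapOfCompatibleSMul R k k H H t) := by
  induction t with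
  | zero => simp
  | add s t hs ht => simp only [map_add, hs, ht]
  | tmul x y => rfl

/-- The section transported along `e`. -/
def transportSection (γ : H ⊗[R] H →ₗ[k] H ⊗[k] H) : H' ⊗[R] H' →ₗ[k] H' ⊗[k] H' :=
  TensorProduct.map (baseEquiv k e).symm.toLinearMap (baseEquiv k e).symm.toLinearMap ∘ₗ γ ∘ₗ
    (TensorProduct.map (e : H' ≃ₐ[R] H).toLinearMap
      (e : H' ≃ₐ[R] H).toLinearMap).restrictScalars k

theorem transportSection_comul (γ : H ⊗[R] H →ₗ[k] H ⊗[k] H) (x : H') :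
    transportSection e γ (Coalgebra.comul (R := R) x) =
      TensorProduct.map (baseEquiv k e).symm.toLinearMap (baseEquiv k e).symm.toLinearMap
        (γ (Coalgebra.comul (R := R) (e x))) := by
  rw [comul_apply]
  rfl

/-- The antipode transported along `e`. -/
def transportTheta (θ : H ≃ₗ[k] H) : H' ≃ₗ[k] H' :=
  (baseEquiv k e).trans (θ.trans (baseEquiv k e).symm)

theorem transportTheta_apply (θ : H ≃ₗ[k] H) (x : H') :
    transportTheta e θ x = e.symm (θ (e x)) := rfl

theorem apply_transportTheta (θ : H ≃ₗ[k] H) (x : H') :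
    e (transportTheta e θ x) = θ (e x) := by
  rw [transportTheta_apply, BialgEquiv.apply_symm_apply]

variable [Coalgebra.IsCocomm R H] (W : WeakPostHopfAlgebroid k R H)

/-- The product transported along `e`. -/
def transportTri : H' →ₗ[R] H' →ₗ[k] H' where
  toFun x := (baseEquiv k e).symm.toLinearMap ∘ₗ W.tri (e x) ∘ₗ (baseEquiv k e).toLinearMap
  map_add' x y := by
    ext z
    simp
  map_smul' f x := by
    ext z
    simp

theorem transportTri_apply (x y : H') : transportTri e W x y = e.symm (W.tri (e x) (e y)) := rfl

theorem apply_transportTri (x y : H') : e (transportTri e W x y) = W.tri (e x) (e y) := by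
  rw [transportTri_apply, BialgEquiv.apply_symm_apply]

variable [Coalgebra.IsCocomm R H']

/-- The weak post-Hopf algebroid transported along `e`. -/
def transport : WeakPostHopfAlgebroid k R H' where
  tri := transportTri e W
  comul_tri x y ι κ r s := by
    have h := W.comul_tri (e x) (e y) (mapRepr e r) (mapRepr e s)
    have h2 := congr(TensorProduct.map (e.symm : H ≃ₐ[R] H').toLinearMap
      (e.symm : H ≃ₐ[R] H').toLinearMap $h)
    rw [← comul_apply] at h2
    rw [transportTri_apply, h2, map_sum]
    refine Finset.sum_congr rfl fun i _ => ?_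
    rw [map_sum]
    rfl
  tri_one x := by
    apply EquivLike.injective e
    rw [apply_transportTri, map_one, W.tri_one, counit_apply]
    exact ((e : H' ≃ₐ[R] H).commutes _).symm
  one_tri x := by
    apply EquivLike.injective e
    rw [apply_transportTri, map_one, W.one_tri]
  counit_tri x y := by
    have he : ∀ f, e (algebraMap R H' f) = algebraMap R H f := (e : H' ≃ₐ[R] H).commutes
    apply EquivLike.injective e
    rw [apply_transportTri, he, he, ← counit_apply e, ← counit_apply e, apply_transportTri,
      W.counit_tri]
  tri_mul x y z ι r := by
    apply EquivLike.injective e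
    rw [apply_transportTri, map_mul, map_sum, W.tri_mul _ _ _ (mapRepr e r)]
    refine Finset.sum_congr rfl fun i _ => ?_
    rw [map_mul, apply_transportTri, apply_transportTri]
    rfl
  tri_tri x y z ι r := by
    apply EquivLike.injective e
    rw [apply_transportTri, apply_transportTri, apply_transportTri, map_sum,
      W.tri_tri _ _ _ (mapRepr e r)]
    congr 2
    refine Finset.sum_congr rfl fun i _ => ?_
    rw [map_mul, apply_transportTri]
    rfl

theorem apply_transport_tri (x y : H') : e ((transport e W).tri x y) = W.tri (e x) (e y) :=
  apply_transportTri e W x y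

theorem apply_transport_gl (x y : H') : e ((transport e W).gl x y) = W.gl (e x) (e y) := by
  rw [gl, gl, grossmanLarson_eq_sum _ _ _ (.arbitrary R x),
    grossmanLarson_eq_sum _ _ _ (mapRepr e (.arbitrary R x)), map_sum]
  refine Finset.sum_congr rfl fun i _ => ?_
  rw [map_mul, apply_transport_tri]
  rfl

variable {W} in
theorem IsAntipodeWith.transport {θ : H ≃ₗ[k] H} {γ : H ⊗[R] H →ₗ[k] H ⊗[k] H}
    (h : W.IsAntipodeWith θ γ) :
    (transport e W).IsAntipodeWith (transportTheta e θ) (transportSection e γ) where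
  section_apply t := by
    rw [transportSection, LinearMap.comp_apply, mapOfCompatibleSMul_map, LinearMap.comp_apply,
      h.section_apply]
    induction t with
    | zero => simp
    | add s t hs ht => simp only [map_add, hs, ht]
    | tmul x y => simp
  map_one := by
    apply EquivLike.injective e
    have he : e 1 = 1 := _root_.map_one (e : H' ≃ₐ[R] H)
    rw [apply_transportTheta, he, h.map_one]
  map_gl x y := by
    apply EquivLike.injective e
    rw [apply_transportTheta, apply_transport_gl, apply_transport_gl, apply_transportTheta,
      apply_transportTheta, h.map_gl]
  comul_map x := by
    rw [transportTheta_apply, comul_apply, h.comul_map, ← mapOfCompatibleSMul_map,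
      transportSection_comul]
    congr 1
    generalize γ (Coalgebra.comul (R := R) (e x)) = t
    induction t with
    | zero => simp
    | add s t hs ht => simp only [map_add, hs, ht]
    | tmul x y => simp [transportTheta_apply]
  gl_map_right x := by
    apply EquivLike.injective e
    have he : ∀ f, e (algebraMap R H' f) = algebraMap R H f := (e : H' ≃ₐ[R] H).commutes
    rw [he, ← counit_apply e, ← h.gl_map_right, transportSection_comul]
    generalize γ (Coalgebra.comul (R := R) (e x)) = t
    induction t with
    | zero => simp
    | add s t hs ht => simp only [map_add, hs, ht]
    | tmul x y => simp [transportTheta_apply, apply_transport_gl]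
  gl_map_left x := by
    apply EquivLike.injective e
    have he : ∀ f, e (algebraMap R H' f) = algebraMap R H f := (e : H' ≃ₐ[R] H).commutes
    rw [he, ← counit_apply e, apply_transportTheta, ← h.gl_map_left, transportSection_comul]
    generalize γ (Coalgebra.comul (R := R) (e x)) = t
    induction t with
    | zero => simp
    | add s t hs ht => simp only [map_add, hs, ht]
    | tmul x y => simp [transportTheta_apply, apply_transport_gl]

end Transport

end WeakPostHopfAlgebroid

/-- The post-Hopf algebroid transported along `e`. -/
def PostHopfAlgebroid.transport {k : Type u} {R : Type v} {H H' : Type w} [CommRing k] [CommRing R]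
    [Algebra k R] [Ring H] [HopfAlgebra R H] [Coalgebra.IsCocomm R H] [Algebra k H]
    [IsScalarTower k R H] [Ring H'] [HopfAlgebra R H'] [Coalgebra.IsCocomm R H'] [Algebra k H']
    [IsScalarTower k R H'] (e : H' ≃ₐc[R] H) (W : PostHopfAlgebroid k R H) :
    PostHopfAlgebroid k R H' where
  toWeakPostHopfAlgebroid := WeakPostHopfAlgebroid.transport e W.toWeakPostHopfAlgebroid
  theta := WeakPostHopfAlgebroid.transportTheta e W.theta
  exists_section := by
    obtain ⟨γ, hγ⟩ := W.exists_section
    exact ⟨_, hγ.transport e⟩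

/-! ## The universal enveloping algebra of the free post-Lie-Rinehart algebra -/

namespace FreeLie

variable {k : Type u} [CommRing k] {V : Type w} [AddCommGroup V] [Module k V]
  (mag : V →ₗ[k] V →ₗ[k] V) {R : Type v} [CommRing R] [Algebra k R]
  (fV : V →ₗ[k] Derivation k R R)

/-- The universal enveloping algebra of the free post-Lie-Rinehart algebra. -/
def envelopingAlgebroid :
    PostHopfAlgebroid k R (UniversalEnvelopingAlgebra R (R ⊗[k] FreeLie k V)) :=
  (TensorAlgebra.algebroid mag fV).transport (envelopingEquiv k V R)

theorem envelopingEquiv_tri (x y : UniversalEnvelopingAlgebra R (R ⊗[k] FreeLie k V)) :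
    envelopingEquiv k V R ((envelopingAlgebroid mag fV).tri x y) =
      (TensorAlgebra.algebroid mag fV).tri (envelopingEquiv k V R x) (envelopingEquiv k V R y) :=
  WeakPostHopfAlgebroid.apply_transport_tri _ _ x y

theorem envelopingEquiv_theta (x : UniversalEnvelopingAlgebra R (R ⊗[k] FreeLie k V)) :
    envelopingEquiv k V R ((envelopingAlgebroid mag fV).theta x) =
      (TensorAlgebra.algebroid mag fV).theta (envelopingEquiv k V R x) :=
  WeakPostHopfAlgebroid.apply_transportTheta _ _ x

/-- The two recursive rules for products hold in any weak post-Hopf algebroid with a primitive first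
factor. Only the values on `R` and on the Lie algebra need the explicit isomorphism. -/
theorem isUniversalEnveloping : IsUniversalEnveloping (postLieRinehart mag fV)
    (envelopingAlgebroid mag fV).toWeakPostHopfAlgebroid where
  base_tri f X := by
    rw [Algebra.algebraMap_eq_smul_one, map_smul, LinearMap.smul_apply,
      WeakPostHopfAlgebroid.one_tri, smul_mul_assoc, one_mul]
  tri_base x f := by
    have he : ∀ f, envelopingEquiv k V R (algebraMap R _ f) = f ⊗ₜ 1 :=
      (envelopingAlgEquiv k V R).commutes
    apply EquivLike.injective (envelopingEquiv k V R)
    rw [envelopingEquiv_tri, he, he, envelopingEquiv_ι, algebroid_tri_toTensor_algebraMap]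
  tri_mul x y X := by
    have h : UniversalEnvelopingAlgebra.ι R ((postLieRinehart mag fV).tri x y) =
        (envelopingAlgebroid mag fV).tri (UniversalEnvelopingAlgebra.ι R x)
          (UniversalEnvelopingAlgebra.ι R y) := by
      apply EquivLike.injective (envelopingEquiv k V R)
      rw [envelopingEquiv_tri, envelopingEquiv_ι, envelopingEquiv_ι, envelopingEquiv_ι,
        algebroid_tri_toTensor]
    rw [h]
    exact WeakPostHopfAlgebroid.tri_mul_of_primitive _ (UniversalEnvelopingAlgebra.comul_ι R x) _ _
  mul_tri x X Y :=
    WeakPostHopfAlgebroid.mul_tri_of_primitive _ (UniversalEnvelopingAlgebra.comul_ι R x) _ _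

end FreeLie

theorem mainTheorem8 {k : Type u} [Field k] [CharZero k] [IsAlgClosed k]
    {R : Type v} [CommRing R] [Algebra k R] {V : Type w} [AddCommGroup V] [Module k V]
    (mag : V →ₗ[k] V →ₗ[k] V) (fV : V →ₗ[k] Derivation k R R) :
    ∃ (P : PostLieAlg k (FreeLie k V)) (ρ : FreeLie k V →ₗ[k] Derivation k R R)
      (𝓛 : PostLieRinehart k R (R ⊗[k] FreeLie k V))
      (Q : PostHopf k (TensorAlgebra k V))
      (K : TensorAlgebra k V ≃ₗc[k] TensorAlgebra k V)
      (act : TensorAlgebra k V →ₗ[k] R →ₗ[k] R)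
      (𝓗 : PostHopfAlgebroid k R (R ⊗[k] TensorAlgebra k V))
      (𝓤 : PostHopfAlgebroid k R (UniversalEnvelopingAlgebra R (R ⊗[k] FreeLie k V)))
      (e : UniversalEnvelopingAlgebra R (R ⊗[k] FreeLie k V) ≃ₐc[R] R ⊗[k] TensorAlgebra k V),
      -- `P` is the unique post-Lie product on `Lie(V)` that extends `mag`
      (∀ v w, P.tri (FreeLie.ι k V v) (FreeLie.ι k V w) = FreeLie.ι k V (mag v w)) ∧
      (∀ P' : PostLieAlg k (FreeLie k V),
        (∀ v w, P'.tri (FreeLie.ι k V v) (FreeLie.ι k V w) = FreeLie.ι k V (mag v w)) →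
          P'.tri = P.tri) ∧
      -- `𝓛 = R ⊗ Lie(V)` is the free post-Lie-Rinehart algebra generated by `(V, mag, fV)`
      (∀ v, ρ (FreeLie.ι k V v) = fV v) ∧
      IsActionPostLieRinehart P ρ 𝓛 ∧
      IsFreePostLieRinehart.{u, v, w, max v u w, t} mag fV 𝓛 (TensorProduct.mk k R (FreeLie k V) 1 ∘ₗ FreeLie.ι k V) ∧
      -- `Q` is the unique post-Hopf algebra structure on `T(V)` that extends `mag`
      (∀ v w, Q.tri (TensorAlgebra.ι k v) (TensorAlgebra.ι k w) = TensorAlgebra.ι k (mag v w)) ∧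
      (∀ Q' : PostHopf k (TensorAlgebra k V),
        (∀ v w, Q'.tri (TensorAlgebra.ι k v) (TensorAlgebra.ι k w) =
          TensorAlgebra.ι k (mag v w)) → Q'.tri = Q.tri) ∧
      -- `K` is the Hopf algebra isomorphism from the sub-adjacent Hopf algebra onto `T(V)`
      (∀ v, K (TensorAlgebra.ι k v) = TensorAlgebra.ι k v) ∧
      K 1 = 1 ∧ (∀ X Y, K (Q.gl X Y) = K X * K Y) ∧
      -- `act` is the pullback along `K` of the action of `T(V)` on `R` that extends `fV`
      (∀ X, act X = TensorAlgebra.lift k (derToEnd k R ∘ₗ fV) (K X)) ∧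
      (∀ v X f, act (TensorAlgebra.ι k v * X) f =
        act (TensorAlgebra.ι k v) (act X f) - act (Q.tri (TensorAlgebra.ι k v) X) f) ∧
      -- `𝓗 = R ⊗ T(V)` is the action post-Hopf algebroid
      IsActionPostHopfAlgebroid Q act 𝓗 ∧
      -- `𝓤` is the universal enveloping algebra of `𝓛`, and it is `𝓗` through `e`
      IsUniversalEnveloping 𝓛 𝓤.toWeakPostHopfAlgebroid ∧
      (∀ f X, e (UniversalEnvelopingAlgebra.ι R (f ⊗ₜ[k] X)) =
        f ⊗ₜ[k] FreeLie.toTensor k V X) ∧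
      (∀ x, e (HopfAlgebra.antipode R x) = HopfAlgebra.antipode R (e x)) ∧
      (∀ x y, e (𝓤.tri x y) = 𝓗.tri (e x) (e y)) ∧
      (∀ x, e (𝓤.theta x) = 𝓗.theta (e x))
 := by
  exact ⟨FreeLie.postLie mag, FreeLie.subadjacentLift mag fV, FreeLie.postLieRinehart mag fV,
    TensorAlgebra.postHopf mag, TensorAlgebra.kMap mag, TensorAlgebra.subadjacentAction mag fV,
    TensorAlgebra.algebroid mag fV, FreeLie.envelopingAlgebroid mag fV,
    FreeLie.envelopingEquiv k V R,
    FreeLie.postLie_tri_ι mag, FreeLie.postLie_unique mag, FreeLie.subadjacentLift_ι mag fV,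
    FreeLie.isAction_postLieRinehart mag fV, FreeLie.isFree_postLieRinehart mag fV,
    TensorAlgebra.postHopf_tri_ι_ι mag, TensorAlgebra.postHopf_unique mag,
    TensorAlgebra.kMap_ι mag, TensorAlgebra.kMap_one mag, TensorAlgebra.kMap_gl mag,
    fun _ => rfl, TensorAlgebra.subadjacentAction_ι_mul mag fV,
    TensorAlgebra.isActionPostHopfAlgebroid mag fV, FreeLie.isUniversalEnveloping mag fV,
    fun f X => FreeLie.envelopingEquiv_ι k V R (f ⊗ₜ X), FreeLie.envelopingEquiv_antipode k V R,
    FreeLie.envelopingEquiv_tri mag fV, FreeLie.envelopingEquiv_theta mag fV⟩
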